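/- In the generalized assignment problem (GAP) there are $n$ bins and $m$ items; bin $i$ has a capacity $C_i$, and item $j$ has weight $w_{ij}$ and value $v_{ij}$ for bin $i$. A set $S$ of items fits into bin $i$ if $\sum_{j\in S}w_{ij}\le C_i$. An allocation $(S_1,\dots,S_n)$ is feasible if every $S_i$ fits into bin $i$ and the $S_i$ are pairwise disjoint (items may remain unassigned). The valuation of bin $i$ is $g_i(S)=\sum_{j\in S}v_{ij}$ if $S$ fits into bin $i$, and $g_i(S)=0$ otherwise; the social welfare of an allocation is $\sum_i g_i(S_i)$. All numbers are nonnegative rationals encoded in binary. Weights and capacities are public; the values $v_i=(v_{ij})_j$ are private to bidder $i$, who holds bin $i$. A randomized mechanism maps the public data and the reported values $v=(v_1,\dots,v_n)$, using fair coin flips, to an allocation $\mathcal A(v)$ and payments $p_i(v)$. It is $(1-\epsilon)$-approximately truthful-in-expectation if for every bidder $i$, all true values $v_i$, all reported values $v_i'$, and all reports $v_{-i}$ of the other bidders, $$\mathbb E[g_i(\mathcal A(v_i,v_{-i}))-p_i(v_i,v_{-i})]\ \ge\ (1-\epsilon)\,\mathbb E[g_i(\mathcal A(v_i',v_{-i}))-p_i(v_i',v_{-i})],$$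 where $g_i$ is the valuation given by the true values $v_i$ and the expectations are over the coin flips of the mechanism. Theorem. Let $\epsilon=\epsilon(m,n)\le 1$ be such that $\epsilon(m,n)\ge 1/q(m,n)$ for all $m,n\ge1$, where $q$ is a polynomial with nonnegative integer coefficients that is positive for all $m,n\ge 1$. Then there is a randomized mechanism for GAP that runs in time polynomial in the size of the input, always returns a feasible allocation, is $(1-\epsilon)$-approximately truthful-in-expectation, and whose expected social welfare is, on every input, at least $(1-1/e-\epsilon)$ times the maximum social welfare of a feasible allocation. -/

import Mathlib

namespace GAP

/-! ## The generalized assignment problem -/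

/-- The public data of an instance with `n` bins and `m` items: the weight of each item for each
bin, and the capacity of each bin. -/
structure Instance (n m : ℕ) where
  weight : Fin n → Fin m → NNRat
  capacity : Fin n → NNRat

/-- A profile of (reported or true) values: `v i j` is the value of bin (bidder) `i` for item `j`. -/
abbrev Values (n m : ℕ) : Type := Fin n → Fin m → NNRat

/-- `S i` is the set of items assigned to bin `i`. -/
abbrev Allocation (n m : ℕ) : Type := Fin n → Finset (Fin m)

variable {n m : ℕ}

/-- The set `S` of items fits into bin `i`. -/
def Instance.Fits (G : Instance n m) (i : Fin n) (S : Finset (Fin m)) : Prop :=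
  ∑ j ∈ S, G.weight i j ≤ G.capacity i

/-- Every bin gets a set that fits, and every item is assigned to at most one bin. -/
def Instance.Feasible (G : Instance n m) (S : Allocation n m) : Prop :=
  (∀ i, G.Fits i (S i)) ∧ Pairwise fun i k => Disjoint (S i) (S k)

open Classical in
/-- The valuation of bidder `i` with item values `vᵢ`: additive on sets that fit, `0` on others. -/
noncomputable def Instance.valuation (G : Instance n m) (i : Fin n) (vi : Fin m → NNRat)
    (S : Finset (Fin m)) : ℝ :=
  if G.Fits i S then ∑ j ∈ S, (vi j : ℝ) else 0

/-- The social welfare of an allocation. -/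
noncomputable def Instance.welfare (G : Instance n m) (v : Values n m) (S : Allocation n m) : ℝ :=
  ∑ i, G.valuation i (v i) (S i)

/-- The maximum social welfare of a feasible allocation (a supremum over a finite nonempty set). -/
noncomputable def Instance.opt (G : Instance n m) (v : Values n m) : ℝ :=
  sSup {x | ∃ S : Allocation n m, G.Feasible S ∧ G.welfare v S = x}

/-! ## Randomized mechanisms -/

/-- The expectation of `X` over `k` independent fair coin flips. -/
noncomputable def expect (k : ℕ) (X : (Fin k → Bool) → ℝ) : ℝ :=
  (∑ r, X r) / 2 ^ k

/-- A randomized direct-revelation mechanism for all instances of GAP. On the public data `G` and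
the reports `v` it flips `coins G v` fair coins and returns an allocation and one payment per
bidder, depending on the results. -/
structure Mechanism where
  coins : ∀ {n m : ℕ}, Instance n m → Values n m → ℕ
  alloc : ∀ {n m : ℕ} (G : Instance n m) (v : Values n m),
    (Fin (coins G v) → Bool) → Allocation n m
  pay : ∀ {n m : ℕ} (G : Instance n m) (v : Values n m),
    (Fin (coins G v) → Bool) → Fin n → ℚ

/-- The expected utility of bidder `i` with true item values `vi` when the reports are `v`. -/
noncomputable def Mechanism.expectedUtility (M : Mechanism) (G : Instance n m) (i : Fin n)
    (vi : Fin m → NNRat) (v : Values n m) : ℝ :=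
  expect (M.coins G v) fun r => G.valuation i vi (M.alloc G v r i) - (M.pay G v r i : ℝ)

/-- On `G`, reporting the truth maximizes every bidder's expected utility up to the factor `1 - ε`,
whatever the other bidders report. -/
def Mechanism.IsApproxTruthfulInExpectation (M : Mechanism) (G : Instance n m) (ε : ℝ) : Prop :=
  ∀ (i : Fin n) (v : Values n m) (vi' : Fin m → NNRat),
    M.expectedUtility G i (v i) v ≥
      (1 - ε) * M.expectedUtility G i (v i) (Function.update v i vi')

/-- On `G`, the mechanism always returns a feasible allocation, and its expected welfare is at least
`α` times the optimum. -/
def Mechanism.IsApproximation (M : Mechanism) (G : Instance n m) (α : ℝ) : Prop :=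
  ∀ v : Values n m, (∀ r, G.Feasible (M.alloc G v r)) ∧
    expect (M.coins G v) (fun r => G.welfare v (M.alloc G v r)) ≥ α * G.opt v

/-! ## The machine model: a RAM with rational registers, arrays and logarithmic cost

A program uses finitely many two-dimensional arrays of rational numbers. Every operation is charged
the bit length of the number it produces, so that polynomial cost here is polynomial time on a
Turing machine. -/

/-- The number of bits used to write down a rational number as a reduced fraction. -/
def bitSize (q : ℚ) : ℕ := q.num.natAbs.size + q.den.size

/-- The contents `s a i j` of the cell `(i, j)` of each array `a`. -/
abbrev Store : Type := ℕ → ℕ → ℕ → ℚ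

/-- Arithmetic expressions; `cell a i j` reads the cell `(i, j)` of the array `a`. -/
inductive Expr : Type
  | const (q : ℚ) : Expr
  | cell (a : ℕ) (i j : Expr) : Expr
  | add (e f : Expr) : Expr
  | sub (e f : Expr) : Expr
  | mul (e f : Expr) : Expr
  | div (e f : Expr) : Expr
  | floor (e : Expr) : Expr

/-- The value of an expression. An index is rounded down to a natural number (negative ones to `0`),
and division by `0` gives `0`. -/
def Expr.eval (s : Store) : Expr → ℚ
  | const q => q
  | cell a i j => s a ⌊i.eval s⌋₊ ⌊j.eval s⌋₊
  | add e f => e.eval s + f.eval s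
  | sub e f => e.eval s - f.eval s
  | mul e f => e.eval s * f.eval s
  | div e f => e.eval s / f.eval s
  | floor e => (⌊e.eval s⌋ : ℚ)

/-- The cost of evaluating an expression: every node costs one plus the bit length of its value. -/
def Expr.cost (s : Store) : Expr → ℕ
  | const q => 1 + bitSize q
  | cell a i j => i.cost s + j.cost s + (1 + bitSize ((cell a i j).eval s))
  | add e f => e.cost s + f.cost s + (1 + bitSize ((add e f).eval s))
  | sub e f => e.cost s + f.cost s + (1 + bitSize ((sub e f).eval s))
  | mul e f => e.cost s + f.cost s + (1 + bitSize ((mul e f).eval s))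
  | div e f => e.cost s + f.cost s + (1 + bitSize ((div e f).eval s))
  | floor e => e.cost s + (1 + bitSize ((floor e).eval s))

/-- Programs; the test of a conditional or a loop is `e ≤ f`. -/
inductive Prog : Type
  | skip : Prog
  | assign (a : ℕ) (i j e : Expr) : Prog
  | seq (p q : Prog) : Prog
  | ifLe (e f : Expr) (p q : Prog) : Prog
  | whileLe (e f : Expr) (p : Prog) : Prog

/-- The store after writing `x` into the cell `(i, j)` of the array `a`. -/
def Store.write (s : Store) (a i j : ℕ) (x : ℚ) : Store :=
  fun b k l => if b = a ∧ k = i ∧ l = j then x else s b k l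

/-- `Exec p s s' t`: started in the store `s`, the program `p` halts in the store `s'`, at the total
cost `t`. -/
inductive Exec : Prog → Store → Store → ℕ → Prop
  | skip (s : Store) : Exec .skip s s 1
  | assign (s : Store) (a : ℕ) (i j e : Expr) :
      Exec (.assign a i j e) s (s.write a ⌊i.eval s⌋₊ ⌊j.eval s⌋₊ (e.eval s))
        (i.cost s + j.cost s + e.cost s + 1)
  | seq {p q : Prog} {s s' s'' : Store} {t t' : ℕ} :
      Exec p s s' t → Exec q s' s'' t' → Exec (.seq p q) s s'' (t + t')
  | ifTrue {e f : Expr} {p q : Prog} {s s' : Store} {t : ℕ} :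
      e.eval s ≤ f.eval s → Exec p s s' t →
      Exec (.ifLe e f p q) s s' (e.cost s + f.cost s + 1 + t)
  | ifFalse {e f : Expr} {p q : Prog} {s s' : Store} {t : ℕ} :
      f.eval s < e.eval s → Exec q s s' t →
      Exec (.ifLe e f p q) s s' (e.cost s + f.cost s + 1 + t)
  | whileTrue {e f : Expr} {p : Prog} {s s' s'' : Store} {t t' : ℕ} :
      e.eval s ≤ f.eval s → Exec p s s' t → Exec (.whileLe e f p) s' s'' t' →
      Exec (.whileLe e f p) s s'' (e.cost s + f.cost s + 1 + t + t')
  | whileFalse {e f : Expr} {p : Prog} {s : Store} :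
      f.eval s < e.eval s → Exec (.whileLe e f p) s s (e.cost s + f.cost s + 1)

/-! ## Polynomial-time mechanisms -/

/-- The number of bits of the input `(n, m, G, v)`, with `n` and `m` in unary. -/
def inputSize (G : Instance n m) (v : Values n m) : ℕ :=
  n + m + ∑ i, bitSize (G.capacity i) + ∑ i, ∑ j, (bitSize (G.weight i j) + bitSize (v i j))

/-- The initial store: arrays `0` to `5` hold `n`, `m`, the capacities, the weights, the reported
values and the coin flips (`1` for `true`); all other cells are `0`. -/
def inputStore (G : Instance n m) (v : Values n m) {k : ℕ} (r : Fin k → Bool) : Store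
  | 0, 0, 0 => n
  | 1, 0, 0 => m
  | 2, i, 0 => if h : i < n then (G.capacity ⟨i, h⟩ : ℚ) else 0
  | 3, i, j => if h : i < n ∧ j < m then (G.weight ⟨i, h.1⟩ ⟨j, h.2⟩ : ℚ) else 0
  | 4, i, j => if h : i < n ∧ j < m then (v ⟨i, h.1⟩ ⟨j, h.2⟩ : ℚ) else 0
  | 5, l, 0 => if h : l < k then (if r ⟨l, h⟩ then 1 else 0) else 0
  | _, _, _ => 0

/-- The store `s` displays the allocation `S` (as a 0-1 matrix in array `6`) and the payments `p`
(in array `7`). -/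
def IsOutput (s : Store) (S : Allocation n m) (p : Fin n → ℚ) : Prop :=
  (∀ (i : Fin n) (j : Fin m), s 6 i j = if j ∈ S i then 1 else 0) ∧ ∀ i : Fin n, s 7 i 0 = p i

/-- The mechanism is computed by one program, for all instances, reports and coin flips; the number
of coin flips is a polynomial `R` in the input size, and the running time is at most a polynomial
`T` in the input size. -/
def Mechanism.IsPolyTime (M : Mechanism) : Prop :=
  ∃ (P : Prog) (R T : Polynomial ℕ), ∀ (n m : ℕ) (G : Instance n m) (v : Values n m),
    M.coins G v = R.eval (inputSize G v) ∧
    ∀ r : Fin (M.coins G v) → Bool, ∃ (s : Store) (t : ℕ),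
      Exec P (inputStore G v r) s t ∧ t ≤ T.eval (inputSize G v) ∧
        IsOutput s (M.alloc G v r) (M.pay G v r)

end GAP

/-!
Truthfulness is obtained from Groves payments: every bidder is paid the reported value of the
others, so that the utility of a bidder is the welfare of the chosen allocation with respect to its
true values and the reports of the others. A misreport then only replaces the outcome for `v` by
the outcome that the algorithm computes for some other `v'`, and it remains to find a polynomial-time
algorithm whose expected welfare for `v` is, up to a factor `1 - ε`, at least the expected welfare
for `v` of any outcome `v'` that it can produce (`groves_truthful`), and at least `1 - 1/e - ε` times
the optimum (`groves_approximation`).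

The algorithm maximizes a concave relaxation whose value is what the rounding achieves. Every bin
`i` has `T` candidate sets ("rows"), all of which fit. The relaxation (`potential`) counts, for every
item `j` and every level `θ` of the rounded values, `1 - (1 - 1/T) ^ c`, where `c` (`demand`) is the
number of the rows containing `j` of the bins whose value for `j` exceeds `θ`. The rounding lets
each bin draw one of its rows, and thins the claims so that bin `i` claims `j` with probability about
`1 - (1 - 1/T) ^ rowCount` (`Claims`); the item goes to the claimant with the highest rounded value
(`topIdx`). As the bins draw independently, the probability that some bin with value above `θ`
claims `j` is about `1 - (1 - 1/T) ^ c`, so that the expected welfare is the potential up to a factor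
`1 + 2/T`. This holds for *every* family of rows and every `v`, whence the comparison with `v'`.

The potential is a concave function of the numbers `demand`, so that a family of rows that no
exchange of a single row improves (by more than the accuracy) is nearly a global optimum
(`potential_le_of_local_opt`). The best exchange is a knapsack
problem with small integral profits, solved exactly by dynamic programming over the profit
(`knapDP`); every accepted exchange raises the potential by at least `m / T`, and `potential` is at
most `m * levels`, so the local search (`search`) is polynomial. Repeating each set of an optimal
allocation in all `T` rows of its bin gives the potential `1 - (1 - 1/T) ^ T ≥ 1 - 1/e` times its
value, which yields the approximation factor.

For the running time, `Triple` is a Hoare logic with a built-in polynomial bound: if all numbers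
written have at most `L` bits and every loop runs at most `Z` times, a fixed program takes time
`O((Z + 1) ^ depth * (L + 1))`. The bit lengths are bounded through common denominators: the powers
of `1 - 1/T` have denominator a power of `T`, and the knapsack table and the payments have the
product of the input denominators.
-/


open Finset

namespace GAP

/-! ### Bit lengths and the cost of expressions -/

lemma size_mul_le (a b : ℕ) : (a * b).size ≤ a.size + b.size := by
  rw [Nat.size_le, pow_add]
  exact Nat.mul_lt_mul'' (Nat.lt_size_self a) (Nat.lt_size_self b)

lemma size_add_le (a b : ℕ) : (a + b).size ≤ a.size + b.size + 1 := by
  rw [Nat.size_le, pow_add, pow_add]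
  have ha := Nat.lt_size_self a
  have hb := Nat.lt_size_self b
  nlinarith

lemma size_prod_le {ι : Type*} (s : Finset ι) (f : ι → ℕ) :
    (∏ i ∈ s, f i).size ≤ 1 + ∑ i ∈ s, (f i).size := by
  classical
  induction s using Finset.induction_on with
  | empty => simp
  | insert a s ha ih =>
    rw [prod_insert ha, sum_insert ha]
    have := size_mul_le (f a) (∏ i ∈ s, f i)
    omega

lemma size_le_self (a : ℕ) : a.size ≤ a := by
  rw [Nat.size_le]; exact Nat.lt_two_pow_self

lemma size_pow_le (a k : ℕ) : (a ^ k).size ≤ 1 + k * a.size := by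
  have := size_prod_le (range k) fun _ => a
  simpa using this

lemma bitSize_natCast (x : ℕ) : bitSize (x : ℚ) ≤ x + 1 := by
  have := size_le_self x
  simp [bitSize]; omega

/-- A rational number that is a multiple of `1 / D` and at most `M` in absolute value. -/
lemma bitSize_le_of_mul_eq {q : ℚ} {D M : ℕ} (hD : 0 < D) (hz : ∃ z : ℤ, q * D = z)
    (hM : |q| ≤ M) : bitSize q ≤ M.size + 2 * D.size := by
  obtain ⟨z, hz⟩ := hz
  have hD' : (D : ℚ) ≠ 0 := by positivity
  have hq : q = (z : ℚ) / (D : ℤ) := by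
    rw [eq_div_iff (by exact_mod_cast hD')]; exact_mod_cast hz
  have hden : q.den ∣ D := by
    have := Rat.den_dvd z (D : ℤ)
    rw [← Int.natCast_dvd_natCast, hq]
    simpa [Rat.divInt_eq_div] using this
  have hdle : q.den ≤ D := Nat.le_of_dvd hD hden
  have hnum : q.num.natAbs ≤ M * D := by
    have h1 : |q| * q.den = (q.num.natAbs : ℚ) := by
      have : q * q.den = q.num := Rat.mul_den_eq_num q
      rw [Nat.cast_natAbs, Int.cast_abs, ← this, abs_mul, Nat.abs_cast]
    have h2 : (q.num.natAbs : ℚ) ≤ (M * D : ℕ) := by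
      rw [← h1, Nat.cast_mul]
      have : (q.den : ℚ) ≤ D := by exact_mod_cast hdle
      gcongr
    exact_mod_cast h2
  have h1 := Nat.size_le_size hnum
  have h2 := Nat.size_le_size hdle
  have h3 := size_mul_le M D
  unfold bitSize
  omega

lemma bitSize_add_le (a b : ℚ) : bitSize (a + b) ≤ 2 * (bitSize a + bitSize b) + 1 := by
  have hn : (a + b).num.natAbs ≤ a.num.natAbs * b.den + b.num.natAbs * a.den := by
    have h := Rat.add_num_den' a b
    have hd : (a + b).den ≤ a.den * b.den :=
      Nat.le_of_dvd (Nat.mul_pos a.pos b.pos) (Rat.add_den_dvd a b)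
    have h2 : (a + b).num.natAbs * (a.den * b.den) ≤
        (a.num.natAbs * b.den + b.num.natAbs * a.den) * (a.den * b.den) := by
      have e : (a + b).num.natAbs * (a.den * b.den) =
          (a.num * b.den + b.num * a.den).natAbs * (a + b).den := by
        have := congrArg Int.natAbs h
        simp only [Int.natAbs_mul, Int.natAbs_natCast] at this
        rw [← this]; ring
      rw [e]
      refine Nat.mul_le_mul ?_ hd
      refine (Int.natAbs_add_le _ _).trans ?_
      simp only [Int.natAbs_mul, Int.natAbs_natCast, le_refl]
    exact Nat.le_of_mul_le_mul_right h2 (Nat.mul_pos a.pos b.pos)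
  have hd : (a + b).den ≤ a.den * b.den :=
    Nat.le_of_dvd (Nat.mul_pos a.pos b.pos) (Rat.add_den_dvd a b)
  have h1 := Nat.size_le_size hn
  have h2 := Nat.size_le_size hd
  have h3 := size_mul_le a.den b.den
  have h4 := size_add_le (a.num.natAbs * b.den) (b.num.natAbs * a.den)
  have h5 := size_mul_le a.num.natAbs b.den
  have h6 := size_mul_le b.num.natAbs a.den
  unfold bitSize
  omega

lemma bitSize_neg (a : ℚ) : bitSize (-a) = bitSize a := by
  simp [bitSize]

lemma bitSize_mul_le (a b : ℚ) : bitSize (a * b) ≤ bitSize a + bitSize b := by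
  have hd : (a * b).den ≤ a.den * b.den :=
    Nat.le_of_dvd (Nat.mul_pos a.pos b.pos) (Rat.mul_den_dvd a b)
  have hn : (a * b).num.natAbs ≤ a.num.natAbs * b.num.natAbs := by
    rw [Rat.mul_num, ← Int.natAbs_mul]
    exact Int.natAbs_ediv_le_natAbs _ _
  have h1 := Nat.size_le_size hn
  have h2 := Nat.size_le_size hd
  have h3 := size_mul_le a.den b.den
  have h4 := size_mul_le a.num.natAbs b.num.natAbs
  unfold bitSize
  omega

lemma bitSize_inv_le (a : ℚ) : bitSize a⁻¹ ≤ bitSize a := by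
  rcases eq_or_ne a 0 with rfl | h
  · simp
  · have h1 : a⁻¹.num.natAbs = a.den := by
      rw [Rat.num_inv, Int.natAbs_mul, Int.natAbs_natCast,
        Int.natAbs_sign_of_ne_zero (Rat.num_ne_zero.mpr h), one_mul]
    have h2 : a⁻¹.den = a.num.natAbs := Rat.den_inv_of_ne_zero h
    rw [bitSize, bitSize, h1, h2, add_comm]

lemma bitSize_floor_le (a : ℚ) : bitSize (⌊a⌋ : ℚ) ≤ bitSize a := by
  have h1 : ⌊a⌋.natAbs ≤ a.num.natAbs := by
    rw [Rat.floor_def']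
    exact Int.natAbs_ediv_le_natAbs _ _
  have h2 := Nat.size_le_size h1
  have h3 := Nat.size_le_size (Nat.succ_le_of_lt a.pos)
  simp only [bitSize, Rat.num_intCast, Rat.den_intCast]
  exact Nat.add_le_add h2 h3

/-- Every cell of the store holds a number of at most `L` bits. -/
def Store.BitsLe (L : ℕ) (s : Store) : Prop := ∀ a i j, bitSize (s a i j) ≤ L

/-- A factor `e.wt` such that evaluating `e` on numbers of at most `L` bits costs at most
`e.wt * (L + 1)`. -/
def Expr.wt : Expr → ℕ
  | const q => 1 + bitSize q
  | cell _ i j => i.wt + j.wt + 1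
  | add e f => 3 * (e.wt + f.wt) + 2
  | sub e f => 3 * (e.wt + f.wt) + 2
  | mul e f => 3 * (e.wt + f.wt) + 2
  | div e f => 3 * (e.wt + f.wt) + 2
  | floor e => 3 * e.wt + 2

lemma Expr.bitSize_eval_lt_cost (s : Store) (e : Expr) : bitSize (e.eval s) < e.cost s := by
  cases e <;> simp only [Expr.cost, Expr.eval] <;> omega

lemma Expr.cost_le {L : ℕ} {s : Store} (hs : s.BitsLe L) (e : Expr) :
    e.cost s ≤ e.wt * (L + 1) := by
  have key : ∀ {c₁ c₂ w₁ w₂ b : ℕ}, c₁ ≤ w₁ * (L + 1) → c₂ ≤ w₂ * (L + 1) →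
      b ≤ 2 * (c₁ + c₂) + 1 → c₁ + c₂ + (1 + b) ≤ (3 * (w₁ + w₂) + 2) * (L + 1) := by
    intro c₁ c₂ w₁ w₂ b h₁ h₂ hb
    nlinarith
  induction e with
  | const q => simp only [cost, wt]; nlinarith
  | cell a i j hi hj =>
    have := hs a ⌊i.eval s⌋₊ ⌊j.eval s⌋₊
    simp only [cost, wt, Expr.eval]; nlinarith
  | add e f he hf =>
    refine key he hf ?_
    have := bitSize_add_le (e.eval s) (f.eval s)
    have h1 := e.bitSize_eval_lt_cost s
    have h2 := f.bitSize_eval_lt_cost s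
    simp only [Expr.eval]; omega
  | sub e f he hf =>
    refine key he hf ?_
    have := bitSize_add_le (e.eval s) (-f.eval s)
    rw [bitSize_neg, ← sub_eq_add_neg] at this
    have h1 := e.bitSize_eval_lt_cost s
    have h2 := f.bitSize_eval_lt_cost s
    simp only [Expr.eval]; omega
  | mul e f he hf =>
    refine key he hf ?_
    have := bitSize_mul_le (e.eval s) (f.eval s)
    have h1 := e.bitSize_eval_lt_cost s
    have h2 := f.bitSize_eval_lt_cost s
    simp only [Expr.eval]; omega
  | div e f he hf =>
    refine key he hf ?_
    have := bitSize_mul_le (e.eval s) (f.eval s)⁻¹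
    have h3 := bitSize_inv_le (f.eval s)
    rw [← div_eq_mul_inv] at this
    have h1 := e.bitSize_eval_lt_cost s
    have h2 := f.bitSize_eval_lt_cost s
    simp only [Expr.eval]; omega
  | floor e he =>
    have := bitSize_floor_le (e.eval s)
    have h1 := e.bitSize_eval_lt_cost s
    simp only [cost, wt, Expr.eval]
    nlinarith

/-! ### Hoare triples with a polynomial time bound -/

/-- The arrays that a program may write to. -/
def Prog.mods : Prog → ℕ → Bool
  | .skip, _ => false
  | .assign b _ _ _, a => b == a
  | .seq p q, a => p.mods a || q.mods a
  | .ifLe _ _ p q, a => p.mods a || q.mods a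
  | .whileLe _ _ p, a => p.mods a

/-- The loop-free part of the running time, see `Triple`. -/
def Prog.wt : Prog → ℕ
  | .skip => 1
  | .assign _ i j e => i.wt + j.wt + e.wt + 1
  | .seq p q => p.wt + q.wt
  | .ifLe e f p q => e.wt + f.wt + 1 + p.wt + q.wt
  | .whileLe e f p => e.wt + f.wt + 1 + p.wt

/-- The nesting depth of the loops of a program. -/
def Prog.depth : Prog → ℕ
  | .skip => 0
  | .assign _ _ _ _ => 0
  | .seq p q => max p.depth q.depth
  | .ifLe _ _ p q => max p.depth q.depth
  | .whileLe _ _ p => p.depth + 1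

lemma Exec.frame {p : Prog} {s s' : Store} {t : ℕ} (h : Exec p s s' t) {a : ℕ}
    (ha : p.mods a = false) : s' a = s a := by
  induction h with
  | skip s => rfl
  | assign s b i j e =>
    funext k l
    have : ¬ a = b := fun h => by simp [Prog.mods, h] at ha
    exact if_neg fun h => this h.1
  | seq _ _ ih1 ih2 =>
    simp only [Prog.mods, Bool.or_eq_false_iff] at ha
    rw [ih2 ha.2, ih1 ha.1]
  | ifTrue _ _ ih =>
    simp only [Prog.mods, Bool.or_eq_false_iff] at ha
    exact ih ha.1
  | ifFalse _ _ ih =>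
    simp only [Prog.mods, Bool.or_eq_false_iff] at ha
    exact ih ha.2
  | whileTrue _ _ _ ih1 ih2 => rw [ih2 ha, ih1 ha]
  | whileFalse _ => rfl

/-- Started in `s`, if all cells of `s` hold at most `L` bits, the program `p` halts in a store that
satisfies `Q` and has at most `L` bits per cell, within the time allowed when every loop is
iterated at most `Z` times. -/
def Triple (L Z : ℕ) (p : Prog) (s : Store) (Q : Store → Prop) : Prop :=
  s.BitsLe L → ∃ s' t, Exec p s s' t ∧ t ≤ p.wt * ((Z + 1) ^ p.depth * (L + 1)) ∧
    s'.BitsLe L ∧ Q s'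

section Rules

variable {L Z : ℕ} {p q : Prog} {s : Store} {Q R : Store → Prop}

lemma Triple.mono (h : Triple L Z p s Q) (hQ : ∀ s', Q s' → R s') : Triple L Z p s R := by
  intro hs
  obtain ⟨s', t, h1, h2, h3, h4⟩ := h hs
  exact ⟨s', t, h1, h2, h3, hQ _ h4⟩

/-- A triple gives the values of the unmodified arrays for free. -/
lemma Triple.frame (h : Triple L Z p s Q) :
    Triple L Z p s fun s' => Q s' ∧ ∀ a, p.mods a = false → s' a = s a := by
  intro hs
  obtain ⟨s', t, h1, h2, h3, h4⟩ := h hs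
  exact ⟨s', t, h1, h2, h3, h4, fun a ha => h1.frame ha⟩

lemma Triple.mono' (h : Triple L Z p s Q)
    (hQ : ∀ s', Q s' → (∀ a, p.mods a = false → s' a = s a) → R s') : Triple L Z p s R :=
  h.frame.mono fun s' h => hQ s' h.1 h.2

lemma Triple.skip (h : Q s) : Triple L Z .skip s Q := by
  intro hs
  refine ⟨s, 1, .skip s, ?_, hs, h⟩
  simp [Prog.wt, Prog.depth]

lemma Triple.assign {a : ℕ} {i j e : Expr} (hb : bitSize (e.eval s) ≤ L)
    (h : Q (s.write a ⌊i.eval s⌋₊ ⌊j.eval s⌋₊ (e.eval s))) :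
    Triple L Z (.assign a i j e) s Q := by
  intro hs
  refine ⟨_, _, .assign s a i j e, ?_, ?_, h⟩
  · have h1 := i.cost_le hs
    have h2 := j.cost_le hs
    have h3 := e.cost_le hs
    simp only [Prog.wt, Prog.depth, pow_zero, one_mul]
    nlinarith
  · intro b k l
    unfold Store.write
    split_ifs
    · exact hb
    · exact hs b k l

lemma wt_mono {w d d' : ℕ} (h : d ≤ d') :
    w * ((Z + 1) ^ d * (L + 1)) ≤ w * ((Z + 1) ^ d' * (L + 1)) := by
  have := Nat.pow_le_pow_right (Nat.succ_pos Z) h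
  gcongr

lemma Triple.seq (h : Triple L Z p s fun s' => Triple L Z q s' Q) :
    Triple L Z (.seq p q) s Q := by
  intro hs
  obtain ⟨s', t, h1, h2, h3, h4⟩ := h hs
  obtain ⟨s'', t', k1, k2, k3, k4⟩ := h4 h3
  refine ⟨s'', _, .seq h1 k1, ?_, k3, k4⟩
  have e1 := h2.trans (wt_mono (le_max_left p.depth q.depth))
  have e2 := k2.trans (wt_mono (le_max_right p.depth q.depth))
  simp only [Prog.wt, Prog.depth, add_mul]
  omega

lemma Triple.ifLe {e f : Expr} (h1 : e.eval s ≤ f.eval s → Triple L Z p s Q)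
    (h2 : f.eval s < e.eval s → Triple L Z q s Q) : Triple L Z (.ifLe e f p q) s Q := by
  intro hs
  have c1 := e.cost_le hs
  have c2 := f.cost_le hs
  have hle : (e.wt + f.wt + 1) * (L + 1) ≤
      (e.wt + f.wt + 1) * ((Z + 1) ^ max p.depth q.depth * (L + 1)) := by
    have : 1 ≤ (Z + 1) ^ max p.depth q.depth := Nat.one_le_pow _ _ (Nat.succ_pos Z)
    gcongr
    nlinarith
  rcases le_or_gt (e.eval s) (f.eval s) with h | h
  · obtain ⟨s', t, k1, k2, k3, k4⟩ := h1 h hs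
    refine ⟨s', _, .ifTrue h k1, ?_, k3, k4⟩
    have e1 := k2.trans (wt_mono (le_max_left p.depth q.depth))
    simp only [Prog.wt, Prog.depth]
    nlinarith
  · obtain ⟨s', t, k1, k2, k3, k4⟩ := h2 h hs
    refine ⟨s', _, .ifFalse h k1, ?_, k3, k4⟩
    have e1 := k2.trans (wt_mono (le_max_right p.depth q.depth))
    simp only [Prog.wt, Prog.depth]
    nlinarith

/-- A loop that is iterated `N` times, with the invariant `I k` after `k` iterations. -/
lemma Triple.whileLe {e f : Expr} (N : ℕ) (hN : N ≤ Z) (I : ℕ → Store → Prop) (h0 : I 0 s)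
    (htest : ∀ k s', k < N → I k s' → e.eval s' ≤ f.eval s')
    (hend : ∀ s', I N s' → f.eval s' < e.eval s')
    (hstep : ∀ k s', k < N → I k s' → (∀ a, p.mods a = false → s' a = s a) →
      Triple L Z p s' (I (k + 1)))
    (hQ : ∀ s', I N s' → (∀ a, p.mods a = false → s' a = s a) → Q s') :
    Triple L Z (.whileLe e f p) s Q := by
  set W := (Z + 1) ^ p.depth * (L + 1) with hW
  have main : ∀ d k s', k + d = N → I k s' → s'.BitsLe L →
      (∀ a, p.mods a = false → s' a = s a) →
      ∃ s'' t, Exec (.whileLe e f p) s' s'' t ∧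
        t ≤ (d + 1) * ((e.wt + f.wt + 1) * (L + 1)) + d * (p.wt * W) ∧
        s''.BitsLe L ∧ Q s'' := by
    intro d
    induction d with
    | zero =>
      intro k s' hk hI hs' hfr
      obtain rfl : k = N := by omega
      refine ⟨s', _, .whileFalse (hend _ hI), ?_, hs', hQ _ hI hfr⟩
      have c1 := e.cost_le hs'
      have c2 := f.cost_le hs'
      nlinarith
    | succ d ih =>
      intro k s' hk hI hs' hfr
      obtain ⟨s₁, t₁, k1, k2, k3, k4⟩ := hstep k s' (by omega) hI hfr hs'
      obtain ⟨s₂, t₂, l1, l2, l3, l4⟩ := ih (k + 1) s₁ (by omega) k4 k3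
        (fun a ha => (k1.frame ha).trans (hfr a ha))
      refine ⟨s₂, _, .whileTrue (htest k s' (by omega) hI) k1 l1, ?_, l3, l4⟩
      have c1 := e.cost_le hs'
      have c2 := f.cost_le hs'
      rw [← hW] at k2
      nlinarith
  intro hs
  obtain ⟨s'', t, k1, k2, k3, k4⟩ := main N 0 s (by omega) h0 hs (fun _ _ => rfl)
  refine ⟨s'', t, k1, k2.trans ?_, k3, k4⟩
  have e1 : (Z + 1) ^ (p.depth + 1) * (L + 1) = (Z + 1) * W := by rw [hW]; ring
  simp only [Prog.wt, Prog.depth]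
  rw [e1, add_mul (e.wt + f.wt + 1)]
  have hWL : L + 1 ≤ W := by
    have : 1 ≤ (Z + 1) ^ p.depth := Nat.one_le_pow _ _ (Nat.succ_pos Z)
    rw [hW]; nlinarith
  refine Nat.add_le_add ?_ ?_
  · calc (N + 1) * ((e.wt + f.wt + 1) * (L + 1))
        ≤ (Z + 1) * ((e.wt + f.wt + 1) * W) := by gcongr
      _ = _ := by ring
  · calc N * (p.wt * W) ≤ (Z + 1) * (p.wt * W) := by gcongr; omega
      _ = _ := by ring

end Rules

/-! ### Programming notation -/

/-- The natural number `k` as an expression. -/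
abbrev Expr.nat (k : ℕ) : Expr := .const k

/-- The scalar variable kept in the cell `(0, 0)` of the array `a`. -/
abbrev Expr.var (a : ℕ) : Expr := .cell a (.nat 0) (.nat 0)

/-- Assignment to a scalar variable. -/
abbrev Prog.set (a : ℕ) (e : Expr) : Prog := .assign a (.nat 0) (.nat 0) e

/-- `p` is executed for the values `0, 1, …, e - 1` of the variable `x`. -/
def Prog.for (x : ℕ) (e : Expr) (p : Prog) : Prog :=
  .seq (.set x (.nat 0))
    (.whileLe (.add (.var x) (.nat 1)) e (.seq p (.set x (.add (.var x) (.nat 1)))))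

@[simp] lemma Store.write_of_ne (s : Store) {a b : ℕ} (h : b ≠ a) (i j : ℕ) (x : ℚ) :
    s.write a i j x b = s b := by
  funext k l; simp [Store.write, h]

@[simp] lemma Store.write_self (s : Store) (a i j k l : ℕ) (x : ℚ) :
    s.write a i j x a k l = if k = i ∧ l = j then x else s a k l := by
  simp [Store.write]

@[simp] lemma Expr.eval_const (s : Store) (q : ℚ) : (Expr.const q).eval s = q := rfl
@[simp] lemma Expr.eval_cell (s : Store) (a : ℕ) (i j : Expr) :
    (Expr.cell a i j).eval s = s a ⌊i.eval s⌋₊ ⌊j.eval s⌋₊ := rfl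
@[simp] lemma Expr.eval_add (s : Store) (e f : Expr) :
    (Expr.add e f).eval s = e.eval s + f.eval s := rfl
@[simp] lemma Expr.eval_sub (s : Store) (e f : Expr) :
    (Expr.sub e f).eval s = e.eval s - f.eval s := rfl
@[simp] lemma Expr.eval_mul (s : Store) (e f : Expr) :
    (Expr.mul e f).eval s = e.eval s * f.eval s := rfl
@[simp] lemma Expr.eval_div (s : Store) (e f : Expr) :
    (Expr.div e f).eval s = e.eval s / f.eval s := rfl
@[simp] lemma Expr.eval_floor (s : Store) (e : Expr) :
    (Expr.floor e).eval s = (⌊e.eval s⌋ : ℚ) := rfl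

/-- The rule for `Prog.for`: the invariant `I k` holds before the iteration with loop variable `k`;
it must not depend on the loop variable. -/
lemma Triple.for {L Z : ℕ} {p : Prog} {s : Store} {Q : Store → Prop} {x : ℕ} {e : Expr}
    (N : ℕ) (hN : N ≤ Z) (hL : Z < L) (I : ℕ → Store → Prop)
    (hx : ∀ k s' y, I k s' → I k (s'.write x 0 0 y)) (hxp : p.mods x = false)
    (h0 : I 0 s)
    (he : ∀ k s', k ≤ N → I k s' → s' x 0 0 = k →
      (∀ a, (Prog.for x e p).mods a = false → s' a = s a) → e.eval s' = N)
    (hstep : ∀ k s', k < N → I k s' → s' x 0 0 = k →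
      (∀ a, (Prog.for x e p).mods a = false → s' a = s a) → Triple L Z p s' (I (k + 1)))
    (hQ : ∀ s', I N s' → (∀ a, (Prog.for x e p).mods a = false → s' a = s a) → Q s') :
    Triple L Z (.for x e p) s Q := by
  have hm : ∀ a, (Prog.for x e p).mods a = false →
      x ≠ a ∧ p.mods a = false ∧
        (Prog.seq p (.set x (.add (.var x) (.nat 1)))).mods a = false := by
    intro a ha
    simp [Prog.for, Prog.mods] at ha ⊢
    tauto
  have hnat : ∀ k : ℕ, k ≤ N → bitSize (k : ℚ) ≤ L := fun k hk =>
    (bitSize_natCast k).trans (by omega)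
  refine Triple.seq (Triple.assign (by simpa using hnat 0 (Nat.zero_le _)) ?_)
  refine Triple.whileLe N hN
    (fun k s' => I k s' ∧ s' x 0 0 = k ∧
      (∀ a, (Prog.for x e p).mods a = false → s' a = s a)) ?_ ?_ ?_ ?_ ?_
  · refine ⟨by simpa using hx _ _ _ h0, by simp, fun a ha => ?_⟩
    rw [Store.write_of_ne _ (hm a ha).1.symm]
  · rintro k s' hk ⟨h1, h2, h3⟩
    rw [he k s' hk.le h1 h2 h3]
    simp only [Expr.eval_add, Expr.eval_cell, Expr.eval_const, Nat.cast_zero, Nat.floor_zero,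
      h2, Nat.cast_one]
    exact_mod_cast hk
  · rintro s' ⟨h1, h2, h3⟩
    rw [he N s' le_rfl h1 h2 h3]
    simp [h2]
  · rintro k s' hk ⟨h1, h2, h3⟩ -
    refine Triple.seq ((hstep k s' hk h1 h2 h3).mono' fun s'' h4 h5 => ?_)
    have h6 : s'' x 0 0 = k := by rw [h5 x hxp, h2]
    have h7 := hnat (k + 1) hk
    push_cast at h7
    refine Triple.assign (by simpa [h6] using h7) ⟨hx _ _ _ h4, by simp [h6], fun a ha => ?_⟩
    rw [Store.write_of_ne _ (hm a ha).1.symm, h5 a (hm a ha).2.1, h3 a ha]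
  · rintro s' ⟨h1, h2, h3⟩ -
    exact hQ s' h1 h3

/-- The `d`-th power of an expression. -/
def Expr.pow (e : Expr) : ℕ → Expr
  | 0 => .nat 1
  | d + 1 => .mul (e.pow d) e

@[simp] lemma Expr.eval_pow (s : Store) (e : Expr) (d : ℕ) :
    (e.pow d).eval s = e.eval s ^ d := by
  induction d with
  | zero => simp [Expr.pow]
  | succ d ih => simp [Expr.pow, ih, pow_succ]

/-! ### Exact knapsack by dynamic programming over integral profits -/

section Knapsack

/-- `knapDP b w C j q` is the largest capacity that a set of items `< j` of weight at most `C` and of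
profit exactly `q` leaves free, and `-1` if there is no such set. -/
def knapDP (b : ℕ → ℕ) (w : ℕ → ℚ) (C : ℚ) : ℕ → ℕ → ℚ
  | 0, q => if q = 0 then C else -1
  | j + 1, q =>
    if b j ≤ q ∧ 0 ≤ knapDP b w C j (q - b j) - w j ∧
        knapDP b w C j q < knapDP b w C j (q - b j) - w j then
      knapDP b w C j (q - b j) - w j
    else knapDP b w C j q

/-- A set that attains `knapDP b w C j q`, found by tracing the table back. -/
def knapSet (b : ℕ → ℕ) (w : ℕ → ℚ) (C : ℚ) : ℕ → ℕ → Finset ℕ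
  | 0, _ => ∅
  | j + 1, q =>
    if knapDP b w C j q < knapDP b w C (j + 1) q then insert j (knapSet b w C j (q - b j))
    else knapSet b w C j q

/-- The largest profit, up to the bound `B`, of a set of items `< m` of weight at most `C`. -/
def knapOpt (b : ℕ → ℕ) (w : ℕ → ℚ) (C : ℚ) (m B : ℕ) : ℕ :=
  Nat.findGreatest (fun q => 0 ≤ knapDP b w C m q) B

variable {b : ℕ → ℕ} {w : ℕ → ℚ} {C : ℚ}

lemma knapDP_bounds (hw : ∀ j, 0 ≤ w j) (hC : 0 ≤ C) (j q : ℕ) :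
    -1 ≤ knapDP b w C j q ∧ knapDP b w C j q ≤ C := by
  induction j generalizing q with
  | zero => unfold knapDP; split_ifs <;> constructor <;> linarith
  | succ j ih =>
    unfold knapDP
    split_ifs with h
    · exact ⟨by linarith [h.2.1], by linarith [hw j, (ih (q - b j)).2]⟩
    · exact ih q

lemma knapDP_mul_int {D : ℕ} {m : ℕ} (hw : ∀ j < m, ∃ z : ℤ, w j * D = z)
    (hC : ∃ z : ℤ, C * D = z) {j : ℕ} (hj : j ≤ m) (q : ℕ) :
    ∃ z : ℤ, knapDP b w C j q * D = z := by
  induction j generalizing q with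
  | zero =>
    unfold knapDP; split_ifs
    · exact hC
    · exact ⟨-D, by simp⟩
  | succ j ih =>
    unfold knapDP
    split_ifs with h
    · obtain ⟨z, hz⟩ := ih (by omega) (q - b j)
      obtain ⟨y, hy⟩ := hw j (by omega)
      exact ⟨z - y, by rw [sub_mul, hz, hy]; push_cast; ring⟩
    · exact ih (by omega) q

/-- Soundness of the table. -/
lemma knapSet_spec (hw : ∀ j, 0 ≤ w j) (j q : ℕ) (h : 0 ≤ knapDP b w C j q) :
    knapSet b w C j q ⊆ range j ∧ ∑ l ∈ knapSet b w C j q, b l = q ∧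
      ∑ l ∈ knapSet b w C j q, w l = C - knapDP b w C j q := by
  induction j generalizing q with
  | zero =>
    unfold knapDP at h ⊢
    split_ifs at h ⊢ with h0
    · simp [knapSet, h0]
    · norm_num at h
  | succ j ih =>
    by_cases hc : b j ≤ q ∧ 0 ≤ knapDP b w C j (q - b j) - w j ∧
        knapDP b w C j q < knapDP b w C j (q - b j) - w j
    · have e : knapDP b w C (j + 1) q = knapDP b w C j (q - b j) - w j := by
        rw [knapDP, if_pos hc]
      obtain ⟨h1, h2, h3⟩ := ih (q - b j) (by linarith [hw j, hc.2.1])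
      have hnot : j ∉ knapSet b w C j (q - b j) := fun hj => by simpa using h1 hj
      rw [knapSet, e, if_pos hc.2.2, sum_insert hnot, sum_insert hnot, h2, h3]
      refine ⟨?_, by omega, by ring⟩
      intro l hl
      rcases mem_insert.1 hl with rfl | hl
      · simp
      · have := mem_range.1 (h1 hl)
        exact mem_range.2 (by omega)
    · have e : knapDP b w C (j + 1) q = knapDP b w C j q := by
        rw [knapDP, if_neg hc]
      obtain ⟨h1, h2, h3⟩ := ih q (e ▸ h)
      rw [knapSet, e, if_neg (lt_irrefl _)]
      exact ⟨h1.trans (range_subset_range.2 (by omega)), h2, h3⟩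

/-- Completeness of the table. -/
lemma le_knapDP (hw : ∀ j, 0 ≤ w j) (j : ℕ) (S : Finset ℕ) (hS : S ⊆ range j)
    (hfit : ∑ l ∈ S, w l ≤ C) : C - ∑ l ∈ S, w l ≤ knapDP b w C j (∑ l ∈ S, b l) := by
  induction j generalizing S with
  | zero =>
    obtain rfl : S = ∅ := by simpa using hS
    simp [knapDP]
  | succ j ih =>
    have mono : ∀ q, knapDP b w C j q ≤ knapDP b w C (j + 1) q := by
      intro q
      rw [knapDP]
      split_ifs with h
      · exact h.2.2.le
      · exact le_rfl
    by_cases hj : j ∈ S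
    · have hsub : S.erase j ⊆ range j := by
        intro l hl
        have h1 := mem_range.1 (hS (mem_of_mem_erase hl))
        have h2 := ne_of_mem_erase hl
        exact mem_range.2 (by omega)
      have eb := add_sum_erase S b hj
      have ew := add_sum_erase S w hj
      have := ih _ hsub (by linarith [hw j])
      set q := ∑ l ∈ S, b l
      have e : ∑ l ∈ S.erase j, b l = q - b j := by omega
      rw [e] at this
      rw [knapDP]
      split_ifs with h
      · linarith
      · by_contra hlt
        exact h ⟨by omega, by linarith, by linarith⟩
    · refine (ih S ?_ hfit).trans (mono _)
      intro l hl
      have h1 := mem_range.1 (hS hl)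
      have h2 : l ≠ j := fun h => hj (h ▸ hl)
      exact mem_range.2 (by omega)

lemma knapDP_knapOpt_nonneg (hw : ∀ j, 0 ≤ w j) (hC : 0 ≤ C) (m B : ℕ) :
    0 ≤ knapDP b w C m (knapOpt b w C m B) := by
  have h0 : 0 ≤ knapDP b w C m 0 := by
    simpa using hC.trans (by simpa using le_knapDP (b := b) (C := C) hw m ∅ (by simp) (by simpa))
  exact Nat.findGreatest_spec (P := fun q => 0 ≤ knapDP b w C m q) (Nat.zero_le B) h0

lemma le_knapOpt (hw : ∀ j, 0 ≤ w j) {m B : ℕ} {S : Finset ℕ} (hS : S ⊆ range m)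
    (hfit : ∑ l ∈ S, w l ≤ C) (hB : ∑ l ∈ S, b l ≤ B) :
    ∑ l ∈ S, b l ≤ knapOpt b w C m B :=
  Nat.le_findGreatest (P := fun q => 0 ≤ knapDP b w C m q) hB
    (by linarith [le_knapDP (b := b) hw m S hS hfit])

end Knapsack

/-! ### The concave relaxation and its local search -/

section LocalSearch

variable (n m T : ℕ) (vt : ℕ → ℕ → ℕ)

/-- A state assigns to each of the `n * T` rows a set of items; the rows `i * T + t` with `t < T` are
the candidate sets of bin `i`. `demand n T vt A j θ` is the number of rows that contain the item `j`
and whose bin has a value above `θ` for it. -/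
def demand (A : ℕ → Finset ℕ) (j θ : ℕ) : ℕ :=
  ∑ r ∈ range (n * T), if θ < vt (r / T) j ∧ j ∈ A r then 1 else 0

/-- The probability that a bin with a single row is not using it. -/
def decay : ℚ := 1 - 1 / T

/-- The concave relaxation of the welfare: the item `j` contributes the expectation of the largest
`θ ≤ N` such that some row of value at least `θ` claims it, when each row makes its claims with
probability `1 / T`. -/
def potential (N : ℕ) (A : ℕ → Finset ℕ) : ℚ :=
  ∑ j ∈ range m, ∑ θ ∈ range N, (1 - decay T ^ demand n T vt A j θ)

/-- `T` times the increase of the potential when the item `j` is put into the row `r`, from which it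
was removed beforehand. -/
def gain (A : ℕ → Finset ℕ) (r j : ℕ) : ℚ :=
  ∑ θ ∈ range (vt (r / T) j), decay T ^ (demand n T vt A j θ - if j ∈ A r then 1 else 0)

/-- The integral profits of the knapsack problem solved for the row `r`. -/
def profit (A : ℕ → Finset ℕ) (r j : ℕ) : ℕ := ⌊gain n T vt A r j⌋₊

/-- The set with the largest profit for the row `r`. -/
def bestResponse (N : ℕ) (w : ℕ → ℕ → ℚ) (C : ℕ → ℚ) (A : ℕ → Finset ℕ) (r : ℕ) : Finset ℕ :=
  knapSet (profit n T vt A r) (w (r / T)) (C (r / T)) m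
    (knapOpt (profit n T vt A r) (w (r / T)) (C (r / T)) m (m * N))

/-- One step of the local search: the row `r` is replaced by its best response if this gains at
least `2 * m` units of profit. -/
def improve (N : ℕ) (w : ℕ → ℕ → ℚ) (C : ℕ → ℚ) (A : ℕ → Finset ℕ) (r : ℕ) : ℕ → Finset ℕ :=
  if ∑ j ∈ A r, profit n T vt A r j + 2 * m ≤
      knapOpt (profit n T vt A r) (w (r / T)) (C (r / T)) m (m * N) then
    Function.update A r (bestResponse n m T vt N w C A r)
  else A

/-- A pass of the local search over the rows `0, …, r - 1`. -/
def pass (N : ℕ) (w : ℕ → ℕ → ℚ) (C : ℕ → ℚ) (A : ℕ → Finset ℕ) : ℕ → ℕ → Finset ℕ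
  | 0 => A
  | r + 1 => improve n m T vt N w C (pass N w C A r) r

/-- The state after `p` passes of the local search, starting with empty sets. -/
def search (N : ℕ) (w : ℕ → ℕ → ℚ) (C : ℕ → ℚ) : ℕ → ℕ → Finset ℕ
  | 0 => fun _ => ∅
  | p + 1 => pass n m T vt N w C (search N w C p) (n * T)

variable {n m T vt} {N : ℕ} {w : ℕ → ℕ → ℚ} {C : ℕ → ℚ} {A O : ℕ → Finset ℕ}

lemma decay_nonneg (T : ℕ) : 0 ≤ decay T := by
  unfold decay
  rcases Nat.eq_zero_or_pos T with rfl | hT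
  · simp
  · have : (1 : ℚ) / T ≤ 1 := by
      rw [div_le_one (by positivity)]; exact_mod_cast hT
    linarith

lemma decay_le_one (T : ℕ) : decay T ≤ 1 := by
  unfold decay
  have : (0 : ℚ) ≤ 1 / T := by positivity
  linarith

lemma mul_one_sub_decay (hT : 0 < T) : T * (1 - decay T) = 1 := by
  unfold decay
  have : (T : ℚ) ≠ 0 := by positivity
  field_simp; ring

lemma decay_pow_le_one (k : ℕ) : decay T ^ k ≤ 1 :=
  pow_le_one₀ (decay_nonneg T) (decay_le_one T)

lemma gain_nonneg (A : ℕ → Finset ℕ) (r j : ℕ) : 0 ≤ gain n T vt A r j :=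
  sum_nonneg fun _ _ => pow_nonneg (decay_nonneg T) _

lemma gain_le (A : ℕ → Finset ℕ) (r j : ℕ) : gain n T vt A r j ≤ vt (r / T) j := by
  unfold gain
  refine (sum_le_sum fun _ _ => decay_pow_le_one _).trans ?_
  simp

lemma profit_le (A : ℕ → Finset ℕ) (r j : ℕ) : profit n T vt A r j ≤ vt (r / T) j := by
  unfold profit
  exact Nat.floor_le_of_le (gain_le A r j)

lemma profit_le_gain (A : ℕ → Finset ℕ) (r j : ℕ) :
    (profit n T vt A r j : ℚ) ≤ gain n T vt A r j :=
  Nat.floor_le (gain_nonneg A r j)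

lemma gain_le_profit (A : ℕ → Finset ℕ) (r j : ℕ) :
    gain n T vt A r j ≤ profit n T vt A r j + 1 :=
  (Nat.lt_floor_add_one _).le

lemma potential_nonneg (A : ℕ → Finset ℕ) : 0 ≤ potential n m T vt N A :=
  sum_nonneg fun _ _ => sum_nonneg fun _ _ => sub_nonneg.2 (decay_pow_le_one _)

lemma potential_le (A : ℕ → Finset ℕ) : potential n m T vt N A ≤ m * N := by
  unfold potential
  have : ∀ j ∈ range m, ∑ θ ∈ range N, (1 - decay T ^ demand n T vt A j θ) ≤ N := by
    intro j _
    refine (sum_le_sum fun θ _ => sub_le_self 1 (pow_nonneg (decay_nonneg T) _)).trans ?_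
    simp
  refine (sum_le_sum this).trans ?_
  simp

lemma demand_update {r : ℕ} (hr : r < n * T) (S : Finset ℕ) (j θ : ℕ) :
    demand n T vt (Function.update A r S) j θ + (if θ < vt (r / T) j ∧ j ∈ A r then 1 else 0) =
      demand n T vt A j θ + (if θ < vt (r / T) j ∧ j ∈ S then 1 else 0) := by
  have hr' := mem_range.2 hr
  unfold demand
  rw [← add_sum_erase _ _ hr', ← add_sum_erase (a := r) (range (n * T))
    (fun r => if θ < vt (r / T) j ∧ j ∈ A r then 1 else 0) hr']
  have : ∀ l ∈ (range (n * T)).erase r,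
      (if θ < vt (l / T) j ∧ j ∈ Function.update A r S l then 1 else 0) =
        (if θ < vt (l / T) j ∧ j ∈ A l then 1 else 0) := by
    intro l hl
    rw [Function.update_of_ne (ne_of_mem_erase hl)]
  rw [sum_congr rfl this, Function.update_self]
  omega

/-- The potential changes by the difference of the gains. -/
lemma potential_update (hT : 0 < T) (hN : ∀ i j, vt i j ≤ N) {r : ℕ} (hr : r < n * T)
    {S : Finset ℕ} (hA : A r ⊆ range m) (hS : S ⊆ range m) :
    T * potential n m T vt N (Function.update A r S) =
      T * potential n m T vt N A + ∑ j ∈ S, gain n T vt A r j - ∑ j ∈ A r, gain n T vt A r j := by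
  have key : ∀ j θ, (T : ℚ) * decay T ^ demand n T vt (Function.update A r S) j θ =
      T * decay T ^ demand n T vt A j θ +
        ((if j ∈ A r then 1 else 0) - (if j ∈ S then 1 else 0)) *
        (if θ < vt (r / T) j then
          decay T ^ (demand n T vt A j θ - if j ∈ A r then 1 else 0) else 0) := by
    intro j θ
    have h := demand_update (A := A) (vt := vt) hr S j θ
    have hb := mul_one_sub_decay hT
    by_cases h1 : θ < vt (r / T) j <;> by_cases h2 : j ∈ A r <;> by_cases h3 : j ∈ S <;>
      simp only [h1, h2, h3, and_self, and_true, and_false, if_true, if_false] at h ⊢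
    · rw [show demand n T vt (Function.update A r S) j θ = demand n T vt A j θ by omega]; ring
    · have hpos : 0 < demand n T vt A j θ := by omega
      rw [show demand n T vt (Function.update A r S) j θ = demand n T vt A j θ - 1 by omega]
      obtain ⟨k, hk⟩ : ∃ k, demand n T vt A j θ = k + 1 := ⟨demand n T vt A j θ - 1, by omega⟩
      rw [hk, Nat.add_sub_cancel, pow_succ]
      linear_combination (decay T ^ k) * hb
    · rw [show demand n T vt (Function.update A r S) j θ = demand n T vt A j θ + 1 by omega,
        pow_succ, Nat.sub_zero]
      linear_combination (-(decay T ^ demand n T vt A j θ)) * hb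
    · rw [show demand n T vt (Function.update A r S) j θ = demand n T vt A j θ by omega]; ring
    all_goals
      rw [show demand n T vt (Function.update A r S) j θ = demand n T vt A j θ by omega]; ring
  have hgain : ∀ j, gain n T vt A r j = ∑ θ ∈ range N, (if θ < vt (r / T) j then
      decay T ^ (demand n T vt A j θ - if j ∈ A r then 1 else 0) else 0) := by
    intro j
    rw [← sum_filter, gain]
    refine sum_congr ?_ fun _ _ => rfl
    ext θ
    have := hN (r / T) j
    simp only [mem_range, mem_filter]
    omega
  have hsum : ∀ S : Finset ℕ, S ⊆ range m → ∑ j ∈ S, gain n T vt A r j =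
      ∑ j ∈ range m, (if j ∈ S then 1 else 0) * gain n T vt A r j := by
    intro S hS
    simp only [ite_mul, one_mul, zero_mul]
    rw [← sum_filter, filter_mem_eq_inter, inter_eq_right.2 hS]
  rw [hsum _ hA, hsum _ hS, potential, potential, mul_sum, mul_sum, ← sum_add_distrib,
    ← sum_sub_distrib]
  refine sum_congr rfl fun j _ => ?_
  rw [mul_sum, mul_sum, hgain j, mul_sum, mul_sum, ← sum_add_distrib, ← sum_sub_distrib]
  refine sum_congr rfl fun θ _ => ?_
  linear_combination -(key j θ)

/-- The discrete tangent inequality for the concave sequence `k ↦ 1 - β ^ k`. -/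
lemma decay_tangent (hT : 0 < T) (c d : ℕ) :
    T * (decay T ^ c - decay T ^ d) ≤ (d - c) * decay T ^ c := by
  have hb := mul_one_sub_decay hT
  have b0 := decay_nonneg T
  have b1 := decay_le_one T
  have hT' : (0 : ℚ) < T := by positivity
  rcases le_total c d with h | h
  · obtain ⟨k, rfl⟩ := Nat.exists_eq_add_of_le h
    have h1 := one_add_mul_le_pow (a := -(1 - decay T)) (by linarith) k
    have h2 : 1 + -(1 - decay T) = decay T := by ring
    rw [h2] at h1
    rw [pow_add]
    have h3 : (T : ℚ) * (1 - decay T ^ k) ≤ k := by nlinarith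
    have := mul_le_mul_of_nonneg_right h3 (pow_nonneg b0 c)
    push_cast
    nlinarith
  · obtain ⟨k, rfl⟩ := Nat.exists_eq_add_of_le h
    have h3 : (k : ℚ) * decay T ^ k ≤ T * (1 - decay T ^ k) := by
      clear h
      induction k with
      | zero => simp
      | succ k ih =>
        have h4 : decay T ^ (k + 1) ≤ decay T ^ k := pow_le_pow_of_le_one b0 b1 (Nat.le_succ k)
        have h5 : (T : ℚ) * decay T ^ (k + 1) = T * decay T ^ k - decay T ^ k := by
          rw [pow_succ]; linear_combination (-(decay T ^ k)) * hb
        push_cast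
        nlinarith [Nat.cast_nonneg (α := ℚ) k]
    have := mul_le_mul_of_nonneg_right h3 (pow_nonneg b0 d)
    rw [pow_add]
    push_cast
    nlinarith

lemma mul_decay_pow_pred_le (hT : 0 < T) (c : ℕ) :
    (c : ℚ) * decay T ^ (c - 1) - c * decay T ^ c ≤ 1 - decay T ^ c := by
  have hb := mul_one_sub_decay hT
  have b0 := decay_nonneg T
  have b1 := decay_le_one T
  have hT' : (0 : ℚ) < T := by positivity
  rcases c with _ | c
  · simp
  · have h := decay_tangent hT c 0
    have h1 : decay T ^ (c + 1) = decay T ^ c * decay T := pow_succ _ _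
    rw [Nat.add_sub_cancel]
    -- after multiplication by `T` this is the tangent inequality between `c` and `0`
    have : (T : ℚ) * (((c + 1 : ℕ) : ℚ) * decay T ^ c - (c + 1 : ℕ) * decay T ^ (c + 1)) ≤
        T * (1 - decay T ^ (c + 1)) := by
      rw [h1]
      push_cast at h ⊢
      simp only [pow_zero] at h
      have e1 : (T : ℚ) * (decay T ^ c * decay T) = T * decay T ^ c - decay T ^ c := by
        linear_combination (-(decay T ^ c)) * hb
      nlinarith
    exact le_of_mul_le_mul_left this hT'

/-- A state in which no row can gain more than `3 * m` is almost optimal. -/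
lemma potential_le_of_local_opt (hT : 0 < T) (hN : ∀ i j, vt i j ≤ N)
    (hA : ∀ r < n * T, A r ⊆ range m) (hO : ∀ r < n * T, O r ⊆ range m)
    (h : ∀ r < n * T, ∑ j ∈ O r, gain n T vt A r j ≤ ∑ j ∈ A r, gain n T vt A r j + 3 * m) :
    T * potential n m T vt N O ≤ (T + 1) * potential n m T vt N A + 3 * m * (n * T) := by
  have hgain : ∀ (e : ℕ → ℕ → ℕ → ℕ) (S : ℕ → Finset ℕ), (∀ r < n * T, S r ⊆ range m) →
      ∑ r ∈ range (n * T), ∑ j ∈ S r, ∑ θ ∈ range (vt (r / T) j), decay T ^ e r j θ =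
      ∑ j ∈ range m, ∑ θ ∈ range N, ∑ r ∈ range (n * T),
        if θ < vt (r / T) j ∧ j ∈ S r then decay T ^ e r j θ else 0 := by
    intro e S hS
    have : ∀ r ∈ range (n * T), ∑ j ∈ S r, ∑ θ ∈ range (vt (r / T) j), decay T ^ e r j θ =
        ∑ j ∈ range m, ∑ θ ∈ range N,
          if θ < vt (r / T) j ∧ j ∈ S r then decay T ^ e r j θ else 0 := by
      intro r hr
      rw [← inter_eq_right.2 (hS r (mem_range.1 hr)), ← filter_mem_eq_inter, sum_filter]
      refine sum_congr rfl fun j hj => ?_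
      have hjm := mem_range.1 hj
      by_cases hjS : j ∈ S r
      · simp only [hjS, hjm, mem_range, if_true, and_true, mem_filter]
        rw [← sum_filter]
        refine sum_congr ?_ fun _ _ => rfl
        ext θ
        have := hN (r / T) j
        simp only [mem_range, mem_filter]
        omega
      · simp [hjS]
    rw [sum_congr rfl this, sum_comm]
    refine sum_congr rfl fun j _ => ?_
    rw [sum_comm]
  have h1 : ∑ r ∈ range (n * T), ∑ j ∈ A r, gain n T vt A r j =
      ∑ j ∈ range m, ∑ θ ∈ range N,
        (demand n T vt A j θ : ℚ) * decay T ^ (demand n T vt A j θ - 1) := by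
    unfold gain
    rw [hgain _ A hA]
    refine sum_congr rfl fun j _ => sum_congr rfl fun θ _ => ?_
    have hd : (demand n T vt A j θ : ℚ) =
        ∑ r ∈ range (n * T), if θ < vt (r / T) j ∧ j ∈ A r then (1 : ℚ) else 0 := by
      unfold demand; push_cast; rfl
    conv_rhs => rw [hd, sum_mul]
    refine sum_congr rfl fun r _ => ?_
    by_cases hc : θ < vt (r / T) j ∧ j ∈ A r
    · rw [if_pos hc, if_pos hc, if_pos hc.2, one_mul]
    · rw [if_neg hc, if_neg hc, zero_mul]
  have h2 : ∑ j ∈ range m, ∑ θ ∈ range N,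
        (demand n T vt O j θ : ℚ) * decay T ^ demand n T vt A j θ ≤
      ∑ r ∈ range (n * T), ∑ j ∈ O r, gain n T vt A r j := by
    unfold gain
    rw [hgain _ O hO]
    refine sum_le_sum fun j _ => sum_le_sum fun θ _ => ?_
    have hd : (demand n T vt O j θ : ℚ) =
        ∑ r ∈ range (n * T), if θ < vt (r / T) j ∧ j ∈ O r then (1 : ℚ) else 0 := by
      unfold demand; push_cast; rfl
    conv_lhs => rw [hd, sum_mul]
    refine sum_le_sum fun r _ => ?_
    by_cases hc : θ < vt (r / T) j ∧ j ∈ O r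
    · rw [if_pos hc, if_pos hc, one_mul]
      exact pow_le_pow_of_le_one (decay_nonneg T) (decay_le_one T) (Nat.sub_le _ _)
    · rw [if_neg hc, if_neg hc, zero_mul]
  have h3 : ∑ r ∈ range (n * T), ∑ j ∈ O r, gain n T vt A r j ≤
      ∑ r ∈ range (n * T), ∑ j ∈ A r, gain n T vt A r j + 3 * m * (n * T) := by
    refine (sum_le_sum fun r hr => h r (mem_range.1 hr)).trans ?_
    rw [sum_add_distrib]
    simp only [sum_const, card_range, nsmul_eq_mul]
    push_cast
    linarith
  have h4 : T * potential n m T vt N O - T * potential n m T vt N A ≤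
      ∑ j ∈ range m, ∑ θ ∈ range N,
        ((demand n T vt O j θ : ℚ) * decay T ^ demand n T vt A j θ -
          demand n T vt A j θ * decay T ^ demand n T vt A j θ) := by
    rw [potential, potential, mul_sum, mul_sum, ← sum_sub_distrib]
    refine sum_le_sum fun j _ => ?_
    rw [mul_sum, mul_sum, ← sum_sub_distrib]
    refine sum_le_sum fun θ _ => ?_
    have := decay_tangent hT (demand n T vt A j θ) (demand n T vt O j θ)
    linarith
  have h5 : ∑ j ∈ range m, ∑ θ ∈ range N,
        ((demand n T vt A j θ : ℚ) * decay T ^ (demand n T vt A j θ - 1) -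
          demand n T vt A j θ * decay T ^ demand n T vt A j θ) ≤ potential n m T vt N A :=
    sum_le_sum fun j _ => sum_le_sum fun θ _ => mul_decay_pow_pred_le hT _
  simp only [sum_sub_distrib] at h4 h5
  linarith

/-- All rows hold sets of items that fit into their bin. -/
def RowsFit (n m T : ℕ) (w : ℕ → ℕ → ℚ) (C : ℕ → ℚ) (A : ℕ → Finset ℕ) : Prop :=
  ∀ r < n * T, A r ⊆ range m ∧ ∑ j ∈ A r, w (r / T) j ≤ C (r / T)

/-- A step raises `T` times the potential by at least `m`, or changes nothing because the row is nearly
a best response. Rounding the gains down to profits costs at most `m`. -/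
lemma improve_spec (hT : 0 < T) (hN : ∀ i j, vt i j ≤ N) (hw : ∀ i j, 0 ≤ w i j)
    (hC : ∀ i, 0 ≤ C i) {r : ℕ} (hr : r < n * T) (hA : RowsFit n m T w C A) :
    RowsFit n m T w C (improve n m T vt N w C A r) ∧
      (T * potential n m T vt N A + m ≤
          T * potential n m T vt N (improve n m T vt N w C A r) ∨
        improve n m T vt N w C A r = A ∧
          ∀ S ⊆ range m, ∑ j ∈ S, w (r / T) j ≤ C (r / T) →
            ∑ j ∈ S, gain n T vt A r j ≤ ∑ j ∈ A r, gain n T vt A r j + 3 * m) := by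
  have hdp := knapDP_knapOpt_nonneg (b := profit n T vt A r) (hw (r / T)) (hC (r / T)) m (m * N)
  obtain ⟨h1, h2, h3⟩ := knapSet_spec (hw (r / T)) _ _ hdp
  have hcard : ∀ S ⊆ range m, ∑ j ∈ S, gain n T vt A r j ≤
      ((∑ j ∈ S, profit n T vt A r j : ℕ) : ℚ) + m := by
    intro S hS
    refine (sum_le_sum fun j _ => gain_le_profit A r j).trans ?_
    rw [sum_add_distrib]
    have : S.card ≤ m := by simpa using card_le_card hS
    push_cast
    simp only [sum_const, nsmul_eq_mul, mul_one]
    gcongr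
  have hprof : ∀ S : Finset ℕ, ((∑ j ∈ S, profit n T vt A r j : ℕ) : ℚ) ≤
      ∑ j ∈ S, gain n T vt A r j := by
    intro S
    push_cast
    exact sum_le_sum fun j _ => profit_le_gain A r j
  unfold improve
  split_ifs with hacc
  · constructor
    · intro l hl
      rcases eq_or_ne l r with rfl | hne
      · rw [Function.update_self, bestResponse, h3]
        exact ⟨h1, by linarith⟩
      · rw [Function.update_of_ne hne]
        exact hA l hl
    · left
      rw [potential_update (S := bestResponse n m T vt N w C A r) hT hN hr (hA r hr).1 h1]
      have e1 := hcard _ (hA r hr).1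
      have e2 := hprof (bestResponse n m T vt N w C A r)
      rw [bestResponse, h2] at e2
      rw [bestResponse]
      have e3 : ((∑ j ∈ A r, profit n T vt A r j + 2 * m : ℕ) : ℚ) ≤
        (knapOpt (profit n T vt A r) (w (r / T)) (C (r / T)) m (m * N) : ℕ) := by
          exact_mod_cast hacc
      push_cast at e1 e3
      linarith
  · refine ⟨hA, Or.inr ⟨rfl, fun S hS hfit => ?_⟩⟩
    have hB : ∑ j ∈ S, profit n T vt A r j ≤ m * N := by
      calc ∑ j ∈ S, profit n T vt A r j ≤ ∑ j ∈ range m, profit n T vt A r j :=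
            sum_le_sum_of_subset hS
        _ ≤ ∑ j ∈ range m, N := sum_le_sum fun j _ => (profit_le A r j).trans (hN _ _)
        _ = m * N := by simp
    have e0 := le_knapOpt (b := profit n T vt A r) (hw (r / T)) hS hfit hB
    have e1 := hcard S hS
    have e2 := hprof (A r)
    have e3 : ((∑ j ∈ S, profit n T vt A r j : ℕ) : ℚ) ≤
        ((∑ j ∈ A r, profit n T vt A r j + 2 * m : ℕ) : ℚ) := by
      exact_mod_cast e0.trans (not_le.1 hacc).le
    push_cast at e1 e2 e3
    linarith

lemma pass_spec (hT : 0 < T) (hN : ∀ i j, vt i j ≤ N) (hw : ∀ i j, 0 ≤ w i j)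
    (hC : ∀ i, 0 ≤ C i) (hA : RowsFit n m T w C A) {r : ℕ} (hr : r ≤ n * T) :
    RowsFit n m T w C (pass n m T vt N w C A r) ∧
      (T * potential n m T vt N A + m ≤ T * potential n m T vt N (pass n m T vt N w C A r) ∨
        pass n m T vt N w C A r = A ∧
          ∀ l < r, ∀ S ⊆ range m, ∑ j ∈ S, w (l / T) j ≤ C (l / T) →
            ∑ j ∈ S, gain n T vt A l j ≤ ∑ j ∈ A l, gain n T vt A l j + 3 * m) := by
  induction r with
  | zero => exact ⟨hA, Or.inr ⟨rfl, fun l hl => absurd hl (Nat.not_lt_zero l)⟩⟩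
  | succ r ih =>
    obtain ⟨h1, h2⟩ := ih (by omega)
    obtain ⟨h3, h4⟩ := improve_spec hT hN hw hC (by omega : r < n * T) h1
    refine ⟨h3, ?_⟩
    rw [pass]
    rcases h4 with h4 | ⟨h4, h5⟩
    · left
      rcases h2 with h2 | ⟨h2, -⟩
      · have : (0 : ℚ) ≤ m := by positivity
        linarith
      · rwa [h2] at h4 ⊢
    · rw [h4]
      rcases h2 with h2 | ⟨h2, h6⟩
      · exact Or.inl h2
      · rw [h2] at h5
        refine Or.inr ⟨h2, fun l hl => ?_⟩
        rcases Nat.lt_succ_iff_lt_or_eq.1 hl with hl | rfl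
        · exact h6 l hl
        · exact h5

lemma rowsFit_search (hT : 0 < T) (hN : ∀ i j, vt i j ≤ N) (hw : ∀ i j, 0 ≤ w i j)
    (hC : ∀ i, 0 ≤ C i) (p : ℕ) : RowsFit n m T w C (search n m T vt N w C p) := by
  induction p with
  | zero => exact fun r _ => by simpa [search] using hC (r / T)
  | succ p ih => exact (pass_spec hT hN hw hC ih le_rfl).1

/-- After `N * T + 1` passes the local search is almost optimal: every pass before that either
increases the potential by `m / T` or starts in a local optimum. -/
theorem potential_search (hT : 0 < T) (hN : ∀ i j, vt i j ≤ N) (hw : ∀ i j, 0 ≤ w i j)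
    (hC : ∀ i, 0 ≤ C i) (hO : RowsFit n m T w C O) :
    T * potential n m T vt N O ≤
      (T + 1) * potential n m T vt N (search n m T vt N w C (N * T + 1)) + 3 * m * (n * T) := by
  have hT' : (0 : ℚ) < T := by positivity
  have main : ∀ p : ℕ,
      T * potential n m T vt N O ≤
        (T + 1) * potential n m T vt N (search n m T vt N w C p) + 3 * m * (n * T) ∨
      (p * m : ℚ) ≤ T * potential n m T vt N (search n m T vt N w C p) := by
    intro p
    induction p with
    | zero =>
      right
      simpa using mul_nonneg hT'.le (potential_nonneg _)
    | succ p ih =>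
      obtain ⟨-, h | ⟨h, hloc⟩⟩ := pass_spec hT hN hw hC
        (rowsFit_search (n := n) (m := m) hT hN hw hC p) le_rfl
      · have hle : potential n m T vt N (search n m T vt N w C p) ≤
            potential n m T vt N (search n m T vt N w C (p + 1)) := by
          rw [search]
          have : (0 : ℚ) ≤ m := by positivity
          exact le_of_mul_le_mul_left (by linarith) hT'
        rcases ih with ih | ih
        · left
          refine ih.trans ?_
          gcongr
        · right
          rw [search]
          push_cast
          linarith
      · left
        rw [search, h]
        exact potential_le_of_local_opt hT hN
          (fun r hr => (rowsFit_search hT hN hw hC p r hr).1) (fun r hr => (hO r hr).1)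
          (fun r hr => hloc r hr _ (hO r hr).1 (hO r hr).2)
  rcases main (N * T + 1) with h | h
  · exact h
  · have h1 := potential_le (n := n) (m := m) (T := T) (vt := vt) (N := N)
      (search n m T vt N w C (N * T + 1))
    have h2 := mul_le_mul_of_nonneg_left h1 hT'.le
    have hm : (m : ℚ) ≤ 0 := by
      push_cast at h
      nlinarith
    have hm0 : m = 0 := by
      have : m ≤ 0 := by exact_mod_cast hm
      omega
    subst hm0
    simp [potential]

end LocalSearch

/-! ### Uniform numbers from coin flips -/

section Coins

/-- Restricting a uniform family of coins to some of them gives a uniform family. -/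
lemma expect_comp_injective {ι : Type*} [Fintype ι] [DecidableEq ι] {k : ℕ} (e : ι → Fin k)
    (he : Function.Injective e) (F : (ι → Bool) → ℝ) :
    expect k (fun r => F (r ∘ e)) = (∑ g, F g) / 2 ^ Fintype.card ι := by
  classical
  let E := Equiv.piEquivPiSubtypeProd (fun x => x ∈ Set.range e) fun _ : Fin k => Bool
  have h1 : ∑ r : Fin k → Bool, F (r ∘ e) =
      ∑ y : ({x // x ∈ Set.range e} → Bool) × ({x // ¬ x ∈ Set.range e} → Bool), F ((fun x : Set.range e => y.1 x) ∘ Equiv.ofInjective e he) := by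
    refine Fintype.sum_equiv E _ _ fun r => ?_
    congr 1
  have h2 : ∑ x : {x // x ∈ Set.range e} → Bool,
      F ((fun x' : Set.range e => x x') ∘ Equiv.ofInjective e he) = ∑ g, F g := by
    refine Fintype.sum_equiv ((Equiv.ofInjective e he).arrowCongr (Equiv.refl Bool)).symm _ _
      fun g => ?_
    congr 1
  have hcard : Fintype.card {x // ¬ x ∈ Set.range e} + Fintype.card ι = k := by
    rw [Fintype.card_subtype_compl, Fintype.card_fin,
      Fintype.card_congr (Equiv.ofInjective e he)]
    have := Fintype.card_subtype_le (fun x => x ∈ Set.range e)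
    rw [Fintype.card_fin] at this
    exact Nat.sub_add_cancel this
  rw [expect, h1, Fintype.sum_prod_type]
  simp only [sum_const, nsmul_eq_mul, ← mul_sum, card_univ]
  rw [h2, Fintype.card_fun, Fintype.card_bool]
  have : (2 : ℝ) ^ k = 2 ^ Fintype.card {x // ¬ x ∈ Set.range e} * 2 ^ Fintype.card ι := by
    rw [← pow_add, hcard]
  rw [this]
  push_cast
  rw [mul_div_mul_left _ _ (by positivity)]

/-- The results of the coin flips as an infinite sequence of bits. -/
def coinSeq {k : ℕ} (r : Fin k → Bool) (l : ℕ) : ℕ :=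
  if h : l < k then if r ⟨l, h⟩ then 1 else 0 else 0

/-- The number with the binary digits `c (x * τ), …, c (x * τ + τ - 1)`, lowest digit first. -/
def draw (τ : ℕ) (c : ℕ → ℕ) (x : ℕ) : ℕ := ∑ l ∈ range τ, 2 ^ l * c (x * τ + l)

lemma coinSeq_le_one {k : ℕ} (r : Fin k → Bool) (l : ℕ) : coinSeq r l ≤ 1 := by
  unfold coinSeq; split_ifs <;> omega

lemma sum_two_pow_lt (f : ℕ → ℕ) (hf : ∀ l, f l ≤ 1) (τ : ℕ) :
    ∑ l ∈ range τ, 2 ^ l * f l < 2 ^ τ := by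
  induction τ with
  | zero => simp
  | succ τ ih =>
    rw [sum_range_succ, pow_succ]
    have := Nat.mul_le_mul_left (2 ^ τ) (hf τ)
    omega

lemma draw_lt {τ : ℕ} {c : ℕ → ℕ} (hc : ∀ l, c l ≤ 1) (x : ℕ) : draw τ c x < 2 ^ τ :=
  sum_two_pow_lt _ (fun _ => hc _) τ

/-- Binary digits determine a number and vice versa. -/
def bitsEquiv (τ : ℕ) : (Fin τ → Bool) ≃ Fin (2 ^ τ) :=
  ((Equiv.refl (Fin τ)).arrowCongr finTwoEquiv.symm).trans finFunctionFinEquiv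

lemma bitsEquiv_val (τ : ℕ) (g : Fin τ → Bool) :
    (bitsEquiv τ g : ℕ) = ∑ l : Fin τ, 2 ^ (l : ℕ) * if g l then 1 else 0 := by
  simp only [bitsEquiv, Equiv.trans_apply, finFunctionFinEquiv_apply, Equiv.arrowCongr_apply,
    Equiv.coe_refl, Equiv.refl_symm, Function.comp_apply, id]
  refine sum_congr rfl fun l _ => ?_
  rw [mul_comm]
  congr 1
  cases g l <;> rfl

/-- The pairs of numbers drawn for the `n` bins are independent and uniform. -/
lemma expect_draw {n τ k : ℕ} (hk : 2 * n * τ ≤ k)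
    (F : (Fin n → Fin (2 ^ τ) × Fin (2 ^ τ)) → ℝ) :
    expect k (fun r => F fun i =>
      (⟨draw τ (coinSeq r) (2 * i), draw_lt (coinSeq_le_one r) _⟩,
        ⟨draw τ (coinSeq r) (2 * i + 1), draw_lt (coinSeq_le_one r) _⟩)) =
    (∑ z, F z) / ((2 ^ τ : ℝ) * 2 ^ τ) ^ n := by
  have hlt : ∀ x : Fin n × Fin 2 × Fin τ, (2 * (x.1 : ℕ) + x.2.1) * τ + x.2.2 < k := by
    rintro ⟨i, b, l⟩
    have h1 : 2 * (i : ℕ) + b + 1 ≤ 2 * n := by have := i.2; have := b.2; omega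
    have h2 := Nat.mul_le_mul_right τ h1
    have h3 := l.2
    simp only
    rw [add_mul, one_mul] at h2
    omega
  let e : Fin n × Fin 2 × Fin τ → Fin k := fun x => ⟨_, hlt x⟩
  have he : Function.Injective e := by
    rintro ⟨i, b, l⟩ ⟨i', b', l'⟩ h
    have h : (2 * (i : ℕ) + b) * τ + l = (2 * (i' : ℕ) + b') * τ + l' := congrArg Fin.val h
    have hτ : 0 < τ := by have := l.2; omega
    have h1 := congrArg (· / τ) h
    have h2 := congrArg (· % τ) h
    simp only [add_comm _ (l : ℕ), add_comm _ (l' : ℕ), Nat.add_mul_div_right _ _ hτ,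
      Nat.div_eq_of_lt l.2, Nat.div_eq_of_lt l'.2, Nat.add_mul_mod_self_right,
      Nat.mod_eq_of_lt l.2, Nat.mod_eq_of_lt l'.2] at h1 h2
    have := b.2
    have := b'.2
    have e1 : (i : ℕ) = i' := by omega
    have e2 : (b : ℕ) = b' := by omega
    simp only [Prod.mk.injEq, Fin.ext_iff]
    exact ⟨e1, e2, h2⟩
  let Φ : (Fin n × Fin 2 × Fin τ → Bool) → (Fin n → Fin (2 ^ τ) × Fin (2 ^ τ)) := fun g i =>
    (bitsEquiv τ fun l => g (i, 0, l), bitsEquiv τ fun l => g (i, 1, l))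
  have hΦ : Function.Bijective Φ := by
    rw [Fintype.bijective_iff_injective_and_card]
    constructor
    · intro g g' h
      funext ⟨i, b, l⟩
      have h1 := congrFun h i
      simp only [Φ, Prod.mk.injEq, EmbeddingLike.apply_eq_iff_eq] at h1
      fin_cases b
      · exact congrFun h1.1 l
      · exact congrFun h1.2 l
    · simp only [Fintype.card_fun, Fintype.card_bool, Fintype.card_prod, Fintype.card_fin,
        ← pow_add, ← pow_mul]
      congr 1
      ring
  have hdraw : ∀ (r : Fin k → Bool) (i : Fin n) (b : Fin 2),
      draw τ (coinSeq r) (2 * i + b) = bitsEquiv τ fun l => (r ∘ e) (i, b, l) := by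
    intro r i b
    rw [bitsEquiv_val, draw, Finset.sum_range]
    refine sum_congr rfl fun l _ => ?_
    rw [coinSeq, dif_pos (hlt (i, b, l))]
    rfl
  have hF : ∀ r : Fin k → Bool, (F fun i =>
      (⟨draw τ (coinSeq r) (2 * i), draw_lt (coinSeq_le_one r) _⟩,
        ⟨draw τ (coinSeq r) (2 * i + 1), draw_lt (coinSeq_le_one r) _⟩)) = F (Φ (r ∘ e)) := by
    intro r
    congr 1
    funext i
    exact Prod.ext (Fin.ext (hdraw r i 0)) (Fin.ext (hdraw r i 1))
  simp only [hF]
  rw [expect_comp_injective e he fun g => F (Φ g)]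
  rw [Fintype.sum_bijective Φ hΦ _ F fun _ => rfl]
  congr 1
  simp only [Fintype.card_prod, Fintype.card_fin, ← pow_add, ← pow_mul]
  congr 1
  ring

end Coins

/-! ### The claimant with the largest value -/

section Top

/-- The largest value `x i` over the `i < k` that satisfy `cl`, and `0` if there is none. -/
def topVal (cl : ℕ → Prop) [DecidablePred cl] (x : ℕ → ℕ) : ℕ → ℕ
  | 0 => 0
  | k + 1 => if cl k ∧ topVal cl x k < x k then x k else topVal cl x k

/-- `i + 1` for the first `i < k` of the largest positive value `x i` among those that satisfy `cl`,
and `0` if there is none. -/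
def topIdx (cl : ℕ → Prop) [DecidablePred cl] (x : ℕ → ℕ) : ℕ → ℕ
  | 0 => 0
  | k + 1 => if cl k ∧ topVal cl x k < x k then k + 1 else topIdx cl x k

variable {cl : ℕ → Prop} [DecidablePred cl] {x : ℕ → ℕ}

lemma lt_topVal_iff (k θ : ℕ) : θ < topVal cl x k ↔ ∃ i < k, cl i ∧ θ < x i := by
  induction k with
  | zero => simp [topVal]
  | succ k ih =>
    have step : (∃ i < k + 1, cl i ∧ θ < x i) ↔ (∃ i < k, cl i ∧ θ < x i) ∨ cl k ∧ θ < x k := by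
      constructor
      · rintro ⟨i, h1, h2⟩
        rcases Nat.lt_succ_iff_lt_or_eq.1 h1 with h | rfl
        · exact Or.inl ⟨i, h, h2⟩
        · exact Or.inr h2
      · rintro (⟨i, h1, h2⟩ | h)
        · exact ⟨i, by omega, h2⟩
        · exact ⟨k, by omega, h⟩
    rw [step, ← ih, topVal]
    split_ifs with h
    · constructor
      · exact fun h1 => Or.inr ⟨h.1, h1⟩
      · rintro (h1 | h1)
        · exact h1.trans h.2
        · exact h1.2
    · constructor
      · exact Or.inl
      · rintro (h1 | h1)
        · exact h1
        · by_contra h2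
          exact h ⟨h1.1, by omega⟩

lemma topIdx_eq_succ {k i : ℕ} (h : topIdx cl x k = i + 1) :
    i < k ∧ cl i ∧ topVal cl x k = x i := by
  induction k with
  | zero => simp [topIdx] at h
  | succ k ih =>
    rw [topIdx] at h
    rw [topVal]
    split_ifs at h ⊢ with hc
    · obtain rfl : k = i := by omega
      exact ⟨by omega, hc.1, rfl⟩
    · obtain ⟨h1, h2, h3⟩ := ih h
      exact ⟨by omega, h2, h3⟩

lemma topVal_eq_zero {k : ℕ} (h : topIdx cl x k = 0) : topVal cl x k = 0 := by
  induction k with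
  | zero => rfl
  | succ k ih =>
    rw [topIdx] at h
    rw [topVal]
    split_ifs at h ⊢
    exact ih h

lemma topVal_le {N : ℕ} (hx : ∀ i, x i ≤ N) (k : ℕ) : topVal cl x k ≤ N := by
  induction k with
  | zero => simp [topVal]
  | succ k ih => rw [topVal]; split_ifs <;> simp [*]

/-- A value split into its levels. -/
lemma topVal_eq_sum {N : ℕ} (hx : ∀ i, x i ≤ N) (k : ℕ) :
    topVal cl x k = ∑ θ ∈ range N, if ∃ i < k, cl i ∧ θ < x i then 1 else 0 := by
  have h : ∀ θ ∈ range N, (if ∃ i < k, cl i ∧ θ < x i then 1 else 0) =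
      if θ < topVal cl x k then 1 else 0 := fun θ _ => by rw [if_congr (lt_topVal_iff k θ) rfl rfl]
  rw [sum_congr rfl h, ← card_filter]
  have : filter (fun θ => θ < topVal cl x k) (range N) = range (topVal cl x k) := by
    ext θ
    have := topVal_le (cl := cl) hx k
    simp only [mem_filter, mem_range]
    omega
  rw [this, card_range]

end Top

/-! ### Randomized rounding -/

section Rounding

/-- The number of rows of bin `i` that contain the item `j`. -/
def rowCount (T : ℕ) (A : ℕ → Finset ℕ) (i j : ℕ) : ℕ :=
  ∑ t ∈ range T, if j ∈ A (i * T + t) then 1 else 0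

/-- Bin `i` draws a row `t` and a number `u` below `T`. It claims those items `j` of the row for
which `u` is below a threshold; the threshold thins the probability of a claim from
`rowCount / T` to about `1 - decay T ^ rowCount`. -/
def Claims (T : ℕ) (A : ℕ → Finset ℕ) (i j t u : ℕ) : Prop :=
  j ∈ A (i * T + t) ∧ (u : ℚ) * rowCount T A i j < T * T * (1 - decay T ^ rowCount T A i j)

instance (T : ℕ) (A : ℕ → Finset ℕ) (i j t u : ℕ) : Decidable (Claims T A i j t u) :=
  inferInstanceAs (Decidable (_ ∧ _))

lemma sum_range_mul (n T : ℕ) (f : ℕ → ℕ) :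
    ∑ r ∈ range (n * T), f r = ∑ i ∈ range n, ∑ t ∈ range T, f (i * T + t) := by
  induction n with
  | zero => simp
  | succ n ih => rw [add_mul, one_mul, sum_range_add, ih, sum_range_succ]

lemma demand_eq (n T : ℕ) (vt : ℕ → ℕ → ℕ) (A : ℕ → Finset ℕ) (j θ : ℕ) :
    demand n T vt A j θ = ∑ i ∈ range n, if θ < vt i j then rowCount T A i j else 0 := by
  rw [demand, sum_range_mul]
  refine sum_congr rfl fun i _ => ?_
  have h : ∀ t ∈ range T, (if θ < vt ((i * T + t) / T) j ∧ j ∈ A (i * T + t) then 1 else 0) =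
      if θ < vt i j ∧ j ∈ A (i * T + t) then 1 else 0 := by
    intro t ht
    have ht := mem_range.1 ht
    rw [mul_comm i T, Nat.mul_add_div (by omega), Nat.div_eq_of_lt ht, add_zero]
  rw [sum_congr rfl h]
  split_ifs with h1
  · simp [h1, rowCount]
  · simp [h1]

/-- The probability that bin `i` claims the item `j`. -/
noncomputable def claimProb (T : ℕ) (A : ℕ → Finset ℕ) (i j : ℕ) : ℝ :=
  (#{y : Fin T × Fin T | Claims T A i j y.1 y.2} : ℝ) / (T * T)

lemma rowCount_le (T : ℕ) (A : ℕ → Finset ℕ) (i j : ℕ) : rowCount T A i j ≤ T := by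
  unfold rowCount
  rw [← card_filter]
  exact (card_filter_le _ _).trans (by simp)

variable {T : ℕ} {A : ℕ → Finset ℕ}

lemma card_claims (i j : ℕ) :
    #{y : Fin T × Fin T | Claims T A i j y.1 y.2} = rowCount T A i j *
      #{u ∈ range T | ((u : ℕ) : ℚ) * rowCount T A i j <
        T * T * (1 - decay T ^ rowCount T A i j)} := by
  have h1 : filter (fun y : Fin T × Fin T => Claims T A i j y.1 y.2) univ =
      filter (fun t : Fin T => j ∈ A (i * T + t)) univ ×ˢ
        filter (fun u : Fin T => ((u : ℕ) : ℚ) * rowCount T A i j <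
          T * T * (1 - decay T ^ rowCount T A i j)) univ := by
    ext y
    rw [mem_filter, mem_product, mem_filter, mem_filter]
    simp only [mem_univ, true_and]
    rfl
  rw [h1, card_product, rowCount, card_filter, card_filter, card_filter, Finset.sum_range,
    Finset.sum_range]

/-- The threshold makes the probability of a claim `1 - decay T ^ rowCount`, up to a factor
`1 + 2 / T` that comes from rounding it up to an integer. -/
lemma claimProb_bounds (hT : 0 < T) (i j : ℕ) :
    (((1 - decay T ^ rowCount T A i j : ℚ) : ℝ) ≤ claimProb T A i j) ∧
      claimProb T A i j ≤ (1 + 2 / T) * ((1 - decay T ^ rowCount T A i j : ℚ) : ℝ) := by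
  rw [claimProb, card_claims]
  set c := rowCount T A i j with hc
  have hcT : c ≤ T := rowCount_le T A i j
  set x := 1 - decay T ^ c with hx
  have hT' : (0 : ℚ) < T := by positivity
  have hx0 : 0 ≤ x := sub_nonneg.2 (decay_pow_le_one c)
  set κ := #{u ∈ range T | ((u : ℕ) : ℚ) * c < T * T * x} with hκ
  suffices h : T * T * x ≤ c * κ ∧ (c * κ : ℚ) ≤ (T + 2) * T * x by
    have hTr : (0 : ℝ) < T := by positivity
    have h1 : (T * T * x : ℝ) ≤ c * κ := by exact_mod_cast h.1
    have h2 : (c * κ : ℝ) ≤ (T + 2) * T * x := by exact_mod_cast h.2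
    push_cast
    constructor
    · rw [le_div_iff₀ (by positivity)]; linarith
    · rw [div_le_iff₀ (by positivity)]
      calc (c * κ : ℝ) ≤ (T + 2) * T * x := h2
        _ = (1 + 2 / T) * x * (T * T) := by field_simp
  rcases Nat.eq_zero_or_pos c with h0 | hcpos
  · simp [hx, h0]
  have hc' : (0 : ℚ) < c := by positivity
  have t1 := decay_tangent hT 0 c
  have t2 := decay_tangent hT c 0
  simp only [pow_zero, Nat.cast_zero, sub_zero, mul_one, zero_sub] at t1 t2
  have hpow : decay T ^ c = 1 - x := by rw [hx]; ring
  rw [hpow] at t1 t2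
  -- `c ≤ 2 * T * x`, since `c * (1 - x) ≤ T * x` and `c ≤ T`
  have hcx : (c : ℚ) ≤ 2 * T * x := by
    have : (c : ℚ) ≤ T := by exact_mod_cast hcT
    nlinarith
  set y := T * T * x / c with hy
  have hyT : y ≤ T := by
    rw [hy, div_le_iff₀ hc']; nlinarith
  have hy0 : 0 ≤ y := by positivity
  have hκ' : κ = ⌈y⌉₊ := by
    have : filter (fun u : ℕ => (u : ℚ) * c < T * T * x) (range T) = range ⌈y⌉₊ := by
      ext u
      have hiff : (u : ℚ) * c < T * T * x ↔ u < ⌈y⌉₊ := by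
        rw [Nat.lt_ceil, hy, lt_div_iff₀ hc']
      have hle : ⌈y⌉₊ ≤ T := Nat.ceil_le.2 hyT
      rw [mem_filter, hiff, mem_range, mem_range]
      omega
    rw [hκ, this, card_range]
  have hcy : c * y = T * T * x := by rw [hy]; field_simp
  have k1 := Nat.le_ceil y
  have k2 := (Nat.ceil_lt_add_one hy0).le
  rw [hκ']
  constructor
  · nlinarith
  · nlinarith

lemma claimProb_le_one (hT : 0 < T) (i j : ℕ) : claimProb T A i j ≤ 1 := by
  have hTr : (0 : ℝ) < T := by positivity
  rw [claimProb, div_le_one (by positivity)]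
  have := card_filter_le (univ : Finset (Fin T × Fin T)) fun y => Claims T A i j y.1 y.2
  simp only [card_univ, Fintype.card_prod, Fintype.card_fin] at this
  exact_mod_cast this

/-- Raising probabilities of independent events by at most a factor `a` raises the probability of
their union by at most a factor `a`. -/
lemma one_sub_prod_le {ι : Type*} (s : Finset ι) {p q : ι → ℝ} {a : ℝ}
    (hq : ∀ i, 0 ≤ q i) (hqp : ∀ i, q i ≤ p i) (hpq : ∀ i, p i ≤ a * q i) (hp : ∀ i, p i ≤ 1) :
    0 ≤ ∏ i ∈ s, (1 - p i) ∧ ∏ i ∈ s, (1 - p i) ≤ ∏ i ∈ s, (1 - q i) ∧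
      ∏ i ∈ s, (1 - q i) ≤ 1 ∧ 1 - ∏ i ∈ s, (1 - p i) ≤ a * (1 - ∏ i ∈ s, (1 - q i)) := by
  classical
  induction s using Finset.induction_on with
  | empty => simp
  | insert i s hi ih =>
    obtain ⟨h1, h2, h3, h4⟩ := ih
    rw [prod_insert hi, prod_insert hi]
    have e1 := hq i
    have e2 := hqp i
    have e3 := hpq i
    have e4 := hp i
    refine ⟨mul_nonneg (by linarith) h1, ?_, ?_, ?_⟩
    · exact mul_le_mul (by linarith) h2 h1 (by linarith)
    · nlinarith
    · set P := ∏ i ∈ s, (1 - p i)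
      set R := ∏ i ∈ s, (1 - q i)
      have f1 : (1 - p i) * (1 - P) ≤ (1 - q i) * (a * (1 - R)) :=
        mul_le_mul (by linarith) h4 (by linarith) (by linarith)
      nlinarith

variable {n m N : ℕ} {vt : ℕ → ℕ → ℕ}

/-- The sum over the items of the largest value of a claimant, written as a sum over the levels. -/
noncomputable def claimedLevels (n m T N : ℕ) (vt : ℕ → ℕ → ℕ) (A : ℕ → Finset ℕ)
    (z : Fin n → Fin T × Fin T) : ℝ :=
  ∑ j ∈ range m, ∑ θ ∈ range N,
    if ∃ i : Fin n, Claims T A i j (z i).1 (z i).2 ∧ θ < vt i j then 1 else 0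

lemma sum_exists_claim (hT : 0 < T) (j θ : ℕ) :
    (∑ z : Fin n → Fin T × Fin T,
      if ∃ i : Fin n, Claims T A i j (z i).1 (z i).2 ∧ θ < vt i j then (1 : ℝ) else 0) =
    (T * T : ℝ) ^ n * (1 - ∏ i : Fin n, (1 - if θ < vt i j then claimProb T A i j else 0)) := by
  have hTr : (T : ℝ) ≠ 0 := by positivity
  let g : Fin n → Fin T × Fin T → ℝ := fun i y =>
    if Claims T A i j y.1 y.2 ∧ θ < vt i j then 0 else 1
  have h1 : ∀ z : Fin n → Fin T × Fin T,
      (if ∃ i : Fin n, Claims T A i j (z i).1 (z i).2 ∧ θ < vt i j then (1 : ℝ) else 0) =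
        1 - ∏ i, g i (z i) := by
    intro z
    split_ifs with h
    · obtain ⟨i, hi⟩ := h
      have h0 : ∏ i, g i (z i) = 0 := prod_eq_zero (mem_univ i) (if_pos hi)
      rw [h0, sub_zero]
    · push Not at h
      rw [prod_eq_one, sub_self]
      intro i _
      exact if_neg fun hc => absurd hc.2 (not_lt.2 (h i hc.1))
  have h2 : ∀ i : Fin n, ∑ y, g i y =
      (T * T : ℝ) * (1 - if θ < vt i j then claimProb T A i j else 0) := by
    intro i
    have h3 : ∑ y : Fin T × Fin T, g i y = (T * T : ℝ) -
        if θ < vt i j then (#{y : Fin T × Fin T | Claims T A i j y.1 y.2} : ℝ) else 0 := by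
      have : ∀ y, g i y = 1 - if Claims T A i j y.1 y.2 ∧ θ < vt i j then 1 else 0 := by
        intro y; simp only [g]; split_ifs <;> simp
      simp only [this, sum_sub_distrib]
      congr 1
      · simp
      · split_ifs with h <;> simp [h]
    rw [h3]
    split_ifs
    · rw [claimProb]; field_simp
    · simp
  simp only [h1, sum_sub_distrib]
  have h4 := Finset.prod_univ_sum (fun _ : Fin n => (univ : Finset (Fin T × Fin T))) g
  rw [Fintype.piFinset_univ] at h4
  rw [← h4]
  simp only [h2, prod_mul_distrib, prod_const, card_univ, Fintype.card_fin, sum_const,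
    Fintype.card_fun, Fintype.card_prod, nsmul_eq_mul]
  push_cast
  ring

/-- The expected value of the rounded solution is the potential, up to a factor `1 + 2 / T`. -/
theorem claimedLevels_bounds (hT : 0 < T) :
    ((potential n m T vt N A : ℚ) : ℝ) ≤
        (∑ z, claimedLevels n m T N vt A z) / (T * T : ℝ) ^ n ∧
      (∑ z, claimedLevels n m T N vt A z) / (T * T : ℝ) ^ n ≤
        (1 + 2 / T) * ((potential n m T vt N A : ℚ) : ℝ) := by
  have hTr : (0 : ℝ) < T := by positivity
  have key : ∀ j θ : ℕ,
      ((1 - decay T ^ demand n T vt A j θ : ℚ) : ℝ) ≤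
        1 - ∏ i : Fin n, (1 - if θ < vt i j then claimProb T A i j else 0) ∧
      1 - ∏ i : Fin n, (1 - if θ < vt i j then claimProb T A i j else 0) ≤
        (1 + 2 / T) * ((1 - decay T ^ demand n T vt A j θ : ℚ) : ℝ) := by
    intro j θ
    have hd : ((1 - decay T ^ demand n T vt A j θ : ℚ) : ℝ) =
        1 - ∏ i : Fin n, (1 - if θ < vt i j then
          ((1 - decay T ^ rowCount T A i j : ℚ) : ℝ) else 0) := by
      rw [demand_eq, Finset.sum_range, ← prod_pow_eq_pow_sum]
      push_cast
      congr 1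
      refine prod_congr rfl fun i _ => ?_
      split_ifs <;> simp
    have := one_sub_prod_le (univ : Finset (Fin n))
      (p := fun i => if θ < vt i j then claimProb T A i j else 0)
      (q := fun i => if θ < vt i j then ((1 - decay T ^ rowCount T A i j : ℚ) : ℝ) else 0)
      (a := 1 + 2 / T) ?_ ?_ ?_ ?_
    · rw [hd]
      exact ⟨by linarith [this.2.1], this.2.2.2⟩
    · intro i
      split_ifs
      · exact_mod_cast sub_nonneg.2 (decay_pow_le_one _)
      · exact le_rfl
    · intro i
      split_ifs
      · exact (claimProb_bounds hT i j).1
      · exact le_rfl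
    · intro i
      split_ifs
      · exact (claimProb_bounds hT i j).2
      · simp
    · intro i
      split_ifs
      · exact claimProb_le_one hT i j
      · exact zero_le_one
  have hsum : (∑ z, claimedLevels n m T N vt A z) / (T * T : ℝ) ^ n =
      ∑ j ∈ range m, ∑ θ ∈ range N,
        (1 - ∏ i : Fin n, (1 - if θ < vt i j then claimProb T A i j else 0)) := by
    unfold claimedLevels
    rw [sum_comm]
    have : ∀ j ∈ range m, (∑ z : Fin n → Fin T × Fin T, ∑ θ ∈ range N,
        if ∃ i : Fin n, Claims T A i j (z i).1 (z i).2 ∧ θ < vt i j then (1 : ℝ) else 0) =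
        ∑ θ ∈ range N, (T * T : ℝ) ^ n *
          (1 - ∏ i : Fin n, (1 - if θ < vt i j then claimProb T A i j else 0)) := by
      intro j _
      rw [sum_comm]
      exact sum_congr rfl fun θ _ => sum_exists_claim hT j θ
    rw [sum_congr rfl this]
    simp only [← mul_sum]
    rw [mul_div_cancel_left₀ _ (by positivity)]
  rw [hsum, potential]
  push_cast
  constructor
  · refine sum_le_sum fun j _ => sum_le_sum fun θ _ => ?_
    have := (key j θ).1
    push_cast at this
    exact this
  · rw [mul_sum]
    refine sum_le_sum fun j _ => ?_
    rw [mul_sum]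
    refine sum_le_sum fun θ _ => ?_
    have := (key j θ).2
    push_cast at this
    exact this

end Rounding

/-! ### The mechanism -/

section MechanismDef

/-- The accuracy parameter: all errors are of the order of its inverse. -/
def accuracy (d n m : ℕ) : ℕ := 5 * (n + m) ^ d

/-- The number of coins for a uniform number below `slots d n m`. -/
def logSlots (d n m : ℕ) : ℕ := Nat.clog 2 (accuracy d n m)

/-- The number of candidate sets per bin, a power of two. -/
def slots (d n m : ℕ) : ℕ := 2 ^ logSlots d n m

/-- The values are rounded to the integers `0, …, levels d n m`. -/
def levels (d n m : ℕ) : ℕ := 6 * n * m * accuracy d n m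

variable {n m : ℕ}

/-- The weights, `0` outside of the range of the indices. -/
def weightAt (G : Instance n m) (i j : ℕ) : ℚ :=
  if h : i < n ∧ j < m then (G.weight ⟨i, h.1⟩ ⟨j, h.2⟩ : ℚ) else 0

/-- The capacities, `0` outside of the range of the index. -/
def capAt (G : Instance n m) (i : ℕ) : ℚ :=
  if h : i < n then (G.capacity ⟨i, h⟩ : ℚ) else 0

/-- The value of an item for a bin, `0` if the item alone does not fit into the bin. -/
def fitValue (G : Instance n m) (v : Values n m) (i j : ℕ) : NNRat :=
  if h : i < n ∧ j < m then
    if G.weight ⟨i, h.1⟩ ⟨j, h.2⟩ ≤ G.capacity ⟨i, h.1⟩ then v ⟨i, h.1⟩ ⟨j, h.2⟩ else 0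
  else 0

/-- The largest value of an item for a bin into which it fits. -/
def maxValue (G : Instance n m) (v : Values n m) : NNRat :=
  (range n).sup fun i => (range m).sup fun j => fitValue G v i j

/-- The values in units of `maxValue / levels`, rounded down; they are all `0` if `maxValue` is. -/
def roundedValue (d : ℕ) (G : Instance n m) (v : Values n m) (i j : ℕ) : ℕ :=
  ⌊(levels d n m : ℚ) * (fitValue G v i j : ℚ) / (maxValue G v : ℚ)⌋₊

/-- The candidate sets that the local search finds. -/
def finalState (d : ℕ) (G : Instance n m) (v : Values n m) : ℕ → Finset ℕ :=
  search n m (slots d n m) (roundedValue d G v) (levels d n m) (weightAt G) (capAt G)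
    (levels d n m * slots d n m + 1)

/-- `i + 1` if the item `j` goes to bin `i`, and `0` if it remains unassigned, when the results of
the coin flips are `c`. -/
def owner (d : ℕ) (G : Instance n m) (v : Values n m) (c : ℕ → ℕ) (j : ℕ) : ℕ :=
  topIdx (fun i => Claims (slots d n m) (finalState d G v) i j
    (draw (logSlots d n m) c (2 * i)) (draw (logSlots d n m) c (2 * i + 1)))
    (fun i => roundedValue d G v i j) n

/-- The allocation chosen by the mechanism. -/
def allocation (d : ℕ) (G : Instance n m) (v : Values n m) (c : ℕ → ℕ) : Allocation n m :=
  fun i => univ.filter fun j => owner d G v c j = i + 1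

/-- The reported value of bidder `i` for the set that it receives. -/
def ownValue (d : ℕ) (G : Instance n m) (v : Values n m) (c : ℕ → ℕ) (i : Fin n) : ℚ :=
  ∑ j ∈ allocation d G v c i, (v i j : ℚ)

/-- The Groves mechanism for the rounded solution of the concave relaxation: every bidder is paid the
reported value of the others. -/
noncomputable def groves (d : ℕ) : Mechanism where
  coins G v := (10 * Polynomial.X ^ (d + 1) : Polynomial ℕ).eval (inputSize G v)
  alloc G v r := allocation d G v (coinSeq r)
  pay G v r i := ownValue d G v (coinSeq r) i - ∑ k, ownValue d G v (coinSeq r) k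

end MechanismDef

/-! ### Feasibility and the value of the rounded solution -/

section Value

variable {n m d : ℕ} {G : Instance n m} {v v' : Values n m}

lemma weightAt_nonneg (i j : ℕ) : 0 ≤ weightAt G i j := by
  unfold weightAt; split_ifs
  · exact NNRat.coe_nonneg _
  · exact le_rfl

lemma capAt_nonneg (i : ℕ) : 0 ≤ capAt G i := by
  unfold capAt; split_ifs
  · exact NNRat.coe_nonneg _
  · exact le_rfl

lemma weightAt_fin (i : Fin n) (j : Fin m) : weightAt G i j = G.weight i j := by
  simp [weightAt]

lemma capAt_fin (i : Fin n) : capAt G i = G.capacity i := by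
  simp [capAt]

lemma slots_pos : 0 < slots d n m := by unfold slots; positivity

lemma accuracy_le_slots : accuracy d n m ≤ slots d n m := Nat.le_pow_clog (by norm_num) _

lemma fitValue_le_maxValue (i j : ℕ) : fitValue G v i j ≤ maxValue G v := by
  by_cases h : i < n ∧ j < m
  · exact (le_sup (f := fun j => fitValue G v i j) (mem_range.2 h.2)).trans
      (le_sup (f := fun i => (range m).sup fun j => fitValue G v i j) (mem_range.2 h.1))
  · rw [fitValue, dif_neg h]; exact zero_le

lemma fitValue_le (i : Fin n) (j : Fin m) : fitValue G v i j ≤ v i j := by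
  rw [fitValue, dif_pos ⟨i.2, j.2⟩]
  split_ifs
  · exact le_rfl
  · exact zero_le

lemma fitValue_of_fits {i : Fin n} {j : Fin m} (h : G.weight i j ≤ G.capacity i) :
    fitValue G v i j = v i j := by
  rw [fitValue, dif_pos ⟨i.2, j.2⟩, if_pos h]

lemma roundedValue_le (i j : ℕ) : roundedValue d G v i j ≤ levels d n m := by
  unfold roundedValue
  refine Nat.floor_le_of_le ?_
  have h : (fitValue G v i j : ℚ) ≤ maxValue G v := by exact_mod_cast fitValue_le_maxValue i j
  refine div_le_of_le_mul₀ (NNRat.coe_nonneg _) (by positivity) ?_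
  exact mul_le_mul_of_nonneg_left h (by positivity)

/-- The unit in which values are rounded. -/
noncomputable def valueUnit (d : ℕ) (G : Instance n m) (v : Values n m) : ℝ :=
  (maxValue G v : ℝ) / levels d n m

lemma valueUnit_nonneg : 0 ≤ valueUnit d G v := by unfold valueUnit; positivity

lemma unit_mul_roundedValue_le (i j : ℕ) :
    valueUnit d G v * roundedValue d G v i j ≤ fitValue G v i j := by
  have h : (roundedValue d G v i j : ℚ) ≤
      (levels d n m : ℚ) * (fitValue G v i j : ℚ) / (maxValue G v : ℚ) :=
    Nat.floor_le (by positivity)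
  have h' : (roundedValue d G v i j : ℝ) ≤
      (levels d n m : ℝ) * (fitValue G v i j : ℝ) / (maxValue G v : ℝ) := by
    exact_mod_cast h
  refine (mul_le_mul_of_nonneg_left h' valueUnit_nonneg).trans ?_
  unfold valueUnit
  rcases eq_or_ne (maxValue G v) 0 with h0 | h0
  · simpa [h0] using NNRat.cast_nonneg _
  rcases Nat.eq_zero_or_pos (levels d n m) with h1 | h1
  · simpa [h1] using NNRat.cast_nonneg _
  have : (maxValue G v : ℝ) ≠ 0 := by exact_mod_cast h0
  have : (levels d n m : ℝ) ≠ 0 := by positivity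
  apply le_of_eq
  field_simp

lemma fitValue_le_unit_mul (hN : 0 < levels d n m) (i j : ℕ) :
    (fitValue G v i j : ℝ) ≤ valueUnit d G v * (roundedValue d G v i j + 1) := by
  rcases eq_or_ne (maxValue G v) 0 with h0 | h0
  · have := fitValue_le_maxValue (G := G) (v := v) i j
    rw [h0] at this
    have h1 : fitValue G v i j = 0 := le_antisymm this zero_le
    simp [valueUnit, h0, h1]
  have h : (levels d n m : ℚ) * (fitValue G v i j : ℚ) / (maxValue G v : ℚ) ≤
      roundedValue d G v i j + 1 := (Nat.lt_floor_add_one _).le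
  have h' : (levels d n m : ℝ) * (fitValue G v i j : ℝ) / (maxValue G v : ℝ) ≤
      roundedValue d G v i j + 1 := by exact_mod_cast h
  refine le_trans ?_ (mul_le_mul_of_nonneg_left h' valueUnit_nonneg)
  unfold valueUnit
  have : (maxValue G v : ℝ) ≠ 0 := by exact_mod_cast h0
  have : (levels d n m : ℝ) ≠ 0 := by positivity
  apply le_of_eq
  field_simp

lemma rowsFit_finalState :
    RowsFit n m (slots d n m) (weightAt G) (capAt G) (finalState d G v) :=
  rowsFit_search slots_pos roundedValue_le weightAt_nonneg capAt_nonneg _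

/-- The row `i * T + t` belongs to bin `i`. -/
lemma row_div {T i t : ℕ} (ht : t < T) : (i * T + t) / T = i := by
  rw [mul_comm, Nat.mul_add_div (by omega), Nat.div_eq_of_lt ht, add_zero]

lemma row_lt {T i t : ℕ} (hi : i < n) (ht : t < T) : i * T + t < n * T := by
  have := Nat.mul_le_mul_right T hi
  rw [Nat.succ_mul] at this
  omega

lemma finalState_fits {i : Fin n} {t : ℕ} (ht : t < slots d n m) {S : Finset (Fin m)}
    (hS : ∀ j ∈ S, (j : ℕ) ∈ finalState d G v (i * slots d n m + t)) : G.Fits i S := by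
  have h := (rowsFit_finalState (G := G) (v := v) (d := d) _ (row_lt i.2 ht)).2
  rw [row_div ht, capAt_fin] at h
  have h1 : ∑ j ∈ S, (G.weight i j : ℚ) = ∑ j ∈ S.map Fin.valEmbedding, weightAt G i j := by
    rw [sum_map]
    exact sum_congr rfl fun j _ => (weightAt_fin i j).symm
  have h2 : ∑ j ∈ S, (G.weight i j : ℚ) ≤ G.capacity i := by
    rw [h1]
    refine (sum_le_sum_of_subset_of_nonneg ?_ fun j _ _ => weightAt_nonneg _ _).trans h
    intro l hl
    obtain ⟨j, hj, rfl⟩ := mem_map.1 hl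
    exact hS j hj
  unfold Instance.Fits
  exact_mod_cast h2

lemma feasible_allocation {c : ℕ → ℕ} (hc : ∀ l, c l ≤ 1) :
    G.Feasible (allocation d G v c) := by
  constructor
  · intro i
    refine finalState_fits (d := d) (v := v)
      (draw_lt (τ := logSlots d n m) hc (2 * i)) fun j hj => ?_
    exact (topIdx_eq_succ (mem_filter.1 hj).2).2.1.1
  · intro i k hik
    refine Finset.disjoint_left.2 fun j h1 h2 => hik (Fin.ext ?_)
    have e1 := (mem_filter.1 h1).2
    have e2 := (mem_filter.1 h2).2
    omega

lemma welfare_of_feasible {S : Allocation n m} (hS : G.Feasible S) :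
    G.welfare v S = ∑ i, ∑ j ∈ S i, (v i j : ℝ) := by
  unfold Instance.welfare Instance.valuation
  exact sum_congr rfl fun i _ => if_pos (hS.1 i)

/-- The pairs of numbers drawn from the coins `r` for the `n` bins. -/
def drawPair (d : ℕ) (n m : ℕ) {k : ℕ} (r : Fin k → Bool) (i : Fin n) :
    Fin (slots d n m) × Fin (slots d n m) :=
  (⟨draw (logSlots d n m) (coinSeq r) (2 * i), draw_lt (coinSeq_le_one r) _⟩,
    ⟨draw (logSlots d n m) (coinSeq r) (2 * i + 1), draw_lt (coinSeq_le_one r) _⟩)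

lemma claimedLevels_drawPair {k : ℕ} (r : Fin k → Bool) (A : ℕ → Finset ℕ) :
    claimedLevels n m (slots d n m) (levels d n m) (roundedValue d G v) A (drawPair d n m r) =
      ∑ j : Fin m, (topVal (fun i => Claims (slots d n m) A i j
        (draw (logSlots d n m) (coinSeq r) (2 * i)) (draw (logSlots d n m) (coinSeq r) (2 * i + 1)))
        (fun i => roundedValue d G v i j) n : ℝ) := by
  unfold claimedLevels
  rw [Finset.sum_range]
  refine sum_congr rfl fun j _ => ?_
  rw [topVal_eq_sum fun i => roundedValue_le i j]
  push_cast
  refine sum_congr rfl fun θ _ => if_congr ?_ rfl rfl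
  constructor
  · rintro ⟨i, h1, h2⟩
    exact ⟨i, i.2, h1, h2⟩
  · rintro ⟨i, h0, h1, h2⟩
    exact ⟨⟨i, h0⟩, h1, h2⟩

lemma welfare_allocation {c : ℕ → ℕ} (hc : ∀ l, c l ≤ 1) :
    G.welfare v (allocation d G v' c) =
      ∑ j : Fin m, ∑ i : Fin n, if owner d G v' c j = i + 1 then (v i j : ℝ) else 0 := by
  rw [welfare_of_feasible (feasible_allocation hc), sum_comm]
  refine sum_congr rfl fun i _ => ?_
  rw [allocation, sum_filter]

lemma sum_owner {o : ℕ} {i : Fin n} (ho : o = i + 1) (f : Fin n → ℝ) :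
    (∑ k : Fin n, if o = k + 1 then f k else 0) = f i := by
  rw [sum_eq_single i]
  · rw [if_pos ho]
  · intro k _ hk
    rw [if_neg fun h => hk (Fin.ext (by omega))]
  · exact fun h => absurd (mem_univ i) h

/-- The rounded value of the owner of an item is the largest one of a claimant. -/
lemma unit_mul_claimedLevels_le {k : ℕ} (r : Fin k → Bool) :
    valueUnit d G v * claimedLevels n m (slots d n m) (levels d n m) (roundedValue d G v)
      (finalState d G v) (drawPair d n m r) ≤
    G.welfare v (allocation d G v (coinSeq r)) := by
  rw [claimedLevels_drawPair, welfare_allocation (coinSeq_le_one r), mul_sum]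
  refine sum_le_sum fun j _ => ?_
  rcases Nat.eq_zero_or_pos (owner d G v (coinSeq r) j) with h | h
  · rw [topVal_eq_zero h, Nat.cast_zero, mul_zero]
    exact sum_nonneg fun i _ => by split_ifs <;> positivity
  · obtain ⟨i, hi⟩ : ∃ i, owner d G v (coinSeq r) j = i + 1 := ⟨_, (Nat.succ_pred_eq_of_pos h).symm⟩
    obtain ⟨h1, -, h3⟩ := topIdx_eq_succ hi
    rw [sum_owner (i := ⟨i, h1⟩) hi, h3]
    refine (unit_mul_roundedValue_le i j).trans ?_
    exact_mod_cast fitValue_le (G := G) (v := v) ⟨i, h1⟩ j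

/-- Whatever the reports `v'`, the welfare with respect to `v` is at most what the relaxation for `v`
gives for the rows chosen for `v'`, up to one unit per item. -/
lemma welfare_le_unit_mul {k : ℕ} (hN : 0 < levels d n m) (r : Fin k → Bool) :
    G.welfare v (allocation d G v' (coinSeq r)) ≤
      valueUnit d G v * (claimedLevels n m (slots d n m) (levels d n m) (roundedValue d G v)
        (finalState d G v') (drawPair d n m r) + m) := by
  have hm : (m : ℝ) = ∑ _j : Fin m, (1 : ℝ) := by simp
  rw [claimedLevels_drawPair, welfare_allocation (coinSeq_le_one r), hm, ← sum_add_distrib, mul_sum]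
  refine sum_le_sum fun j _ => ?_
  rcases Nat.eq_zero_or_pos (owner d G v' (coinSeq r) j) with h | h
  · refine le_trans (le_of_eq (sum_eq_zero fun i _ => if_neg (by omega))) ?_
    exact mul_nonneg valueUnit_nonneg (by positivity)
  · obtain ⟨i, hi⟩ : ∃ i, owner d G v' (coinSeq r) j = i + 1 :=
      ⟨_, (Nat.succ_pred_eq_of_pos h).symm⟩
    obtain ⟨h1, h2, -⟩ := topIdx_eq_succ hi
    rw [sum_owner (i := ⟨i, h1⟩) hi]
    have hfit : G.weight ⟨i, h1⟩ j ≤ G.capacity ⟨i, h1⟩ := by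
      have := finalState_fits (G := G) (v := v') (d := d) (i := ⟨i, h1⟩) (S := {j})
        (draw_lt (τ := logSlots d n m) (coinSeq_le_one r) (2 * i)) (by simpa using h2.1)
      simpa [Instance.Fits] using this
    have e1 := fitValue_le_unit_mul (G := G) (v := v) hN i j
    rw [show fitValue G v i j = v ⟨i, h1⟩ j from fitValue_of_fits hfit] at e1
    refine e1.trans (mul_le_mul_of_nonneg_left ?_ valueUnit_nonneg)
    have e2 : roundedValue d G v i j ≤ topVal (fun i => Claims (slots d n m) (finalState d G v') i j
        (draw (logSlots d n m) (coinSeq r) (2 * i)) (draw (logSlots d n m) (coinSeq r) (2 * i + 1)))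
        (fun i => roundedValue d G v i j) n := by
      by_contra hlt
      exact absurd ((lt_topVal_iff (x := fun i => roundedValue d G v i j) n _).2 ⟨i, h1, h2, not_le.1 hlt⟩) (lt_irrefl _)
    have e3 : (roundedValue d G v i j : ℝ) ≤ _ := Nat.cast_le.2 e2
    linarith

/-- All rows of bin `i` hold the set `S i`. -/
def constantRows (T : ℕ) (S : Allocation n m) (r : ℕ) : Finset ℕ :=
  if h : r / T < n then (S ⟨r / T, h⟩).map Fin.valEmbedding else ∅

lemma rowsFit_constantRows {T : ℕ} {S : Allocation n m} (hS : G.Feasible S) :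
    RowsFit n m T (weightAt G) (capAt G) (constantRows T S) := by
  intro r hr
  have h : r / T < n := Nat.div_lt_of_lt_mul (by rwa [mul_comm])
  rw [constantRows, dif_pos h]
  constructor
  · intro l hl
    obtain ⟨j, -, rfl⟩ := mem_map.1 hl
    exact mem_range.2 j.2
  · rw [sum_map]
    have h1 := hS.1 ⟨r / T, h⟩
    unfold Instance.Fits at h1
    have h2 : ∑ j ∈ S ⟨r / T, h⟩, (G.weight ⟨r / T, h⟩ j : ℚ) ≤ G.capacity ⟨r / T, h⟩ := by
      exact_mod_cast h1
    rw [show capAt G (r / T) = G.capacity ⟨r / T, h⟩ from capAt_fin ⟨r / T, h⟩]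
    refine le_trans (le_of_eq (sum_congr rfl fun j _ => ?_)) h2
    exact weightAt_fin ⟨r / T, h⟩ j

/-- A feasible allocation is worth at least a `1 - decay T ^ T` fraction in the relaxation. -/
lemma mul_le_potential_constantRows {T N : ℕ} {vt : ℕ → ℕ → ℕ}
    (hN : ∀ i j, vt i j ≤ N) {S : Allocation n m} (hS : Pairwise fun i k => Disjoint (S i) (S k)) :
    (1 - decay T ^ T) * (∑ i, ∑ j ∈ S i, (vt i j : ℚ)) ≤
      potential n m T vt N (constantRows T S) := by
  have hcount : ∀ (i : Fin n) (j : Fin m), j ∈ S i → rowCount T (constantRows T S) i j = T := by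
    intro i j hj
    unfold rowCount
    have : ∀ t ∈ range T, (if (j : ℕ) ∈ constantRows T S (i * T + t) then 1 else 0) = 1 := by
      intro t ht
      have e : ((i : ℕ) * T + t) / T = i := row_div (mem_range.1 ht)
      rw [if_pos]
      rw [constantRows, dif_pos (by rw [e]; exact i.2)]
      simp only [e]
      exact mem_map.2 ⟨j, hj, rfl⟩
    rw [sum_congr rfl this]
    simp
  have hx : 0 ≤ 1 - decay T ^ T := sub_nonneg.2 (decay_pow_le_one T)
  have hswap : ∑ i, ∑ j ∈ S i, (vt i j : ℚ) =
      ∑ j : Fin m, ∑ i : Fin n, if j ∈ S i then (vt i j : ℚ) else 0 := by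
    rw [sum_comm]
    refine sum_congr rfl fun i _ => ?_
    rw [← sum_filter, filter_mem_eq_inter, univ_inter]
  rw [hswap, potential, Finset.sum_range, mul_sum]
  refine sum_le_sum fun j _ => ?_
  by_cases hj : ∃ i, j ∈ S i
  · obtain ⟨i, hi⟩ := hj
    rw [sum_eq_single i, if_pos hi]
    · have h1 : ∀ θ ∈ range (vt i j), 1 - decay T ^ T ≤
          1 - decay T ^ demand n T vt (constantRows T S) j θ := by
        intro θ hθ
        refine sub_le_sub_left (pow_le_pow_of_le_one (decay_nonneg T) (decay_le_one T) ?_) 1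
        rw [demand_eq]
        have := single_le_sum (f := fun i => if θ < vt i j then
          rowCount T (constantRows T S) i j else 0) (fun _ _ => Nat.zero_le _) (mem_range.2 i.2)
        rw [if_pos (mem_range.1 hθ), hcount i j hi] at this
        exact this
      calc (1 - decay T ^ T) * (vt i j : ℚ) = ∑ θ ∈ range (vt i j), (1 - decay T ^ T) := by
            rw [sum_const, card_range, nsmul_eq_mul, mul_comm]
        _ ≤ ∑ θ ∈ range (vt i j), (1 - decay T ^ demand n T vt (constantRows T S) j θ) :=
            sum_le_sum h1
        _ ≤ _ := sum_le_sum_of_subset_of_nonneg (range_subset_range.2 (hN i j))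
            fun _ _ _ => sub_nonneg.2 (decay_pow_le_one _)
    · intro k _ hk
      exact if_neg fun h => Finset.disjoint_left.1 (hS hk) h hi
    · exact fun h => absurd (mem_univ i) h
  · push Not at hj
    rw [sum_eq_zero fun i _ => if_neg (hj i), mul_zero]
    exact sum_nonneg fun _ _ => sub_nonneg.2 (decay_pow_le_one _)

lemma one_sub_exp_le {T : ℕ} (hT : 0 < T) : 1 - 1 / Real.exp 1 ≤ ((1 - decay T ^ T : ℚ) : ℝ) := by
  have hTr : (0 : ℝ) < T := by positivity
  have h1 : (1 - 1 / (T : ℝ)) ≤ Real.exp (-(1 / T)) := by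
    have := Real.add_one_le_exp (-(1 / (T : ℝ)))
    linarith
  have h0 : 0 ≤ (1 - 1 / (T : ℝ)) := by
    rw [sub_nonneg, div_le_one hTr]
    exact_mod_cast hT
  have h2 := pow_le_pow_left₀ h0 h1 T
  rw [← Real.exp_nat_mul] at h2
  have h3 : (T : ℝ) * -(1 / T) = -1 := by field_simp
  rw [h3, Real.exp_neg, inv_eq_one_div] at h2
  unfold decay
  push_cast
  linarith

end Value

/-! ### Approximate truthfulness and the approximation guarantee -/

section Guarantee

variable {n m d : ℕ} {G : Instance n m} {v v' : Values n m}

/-- The potential of the state computed for the reports `v'`, measured with the values `v`. -/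
noncomputable def crossPotential (d : ℕ) (G : Instance n m) (v v' : Values n m) : ℝ :=
  ((potential n m (slots d n m) (roundedValue d G v) (levels d n m) (finalState d G v') : ℚ) : ℝ)

/-- The expected welfare with respect to `v` when `v'` is reported. -/
noncomputable def crossWelfare (d : ℕ) (G : Instance n m) (v v' : Values n m) : ℝ :=
  expect ((groves d).coins G v') fun r => G.welfare v ((groves d).alloc G v' r)

lemma expect_mono {k : ℕ} {X Y : (Fin k → Bool) → ℝ} (h : ∀ r, X r ≤ Y r) :
    expect k X ≤ expect k Y := by
  unfold expect
  gcongr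
  exact h _

lemma expect_const_mul {k : ℕ} (a : ℝ) (X : (Fin k → Bool) → ℝ) :
    expect k (fun r => a * X r) = a * expect k X := by
  unfold expect
  rw [← mul_sum, mul_div_assoc]

lemma expect_add_const {k : ℕ} (X : (Fin k → Bool) → ℝ) (a : ℝ) :
    expect k (fun r => X r + a) = expect k X + a := by
  unfold expect
  rw [sum_add_distrib, add_div]
  simp

lemma logSlots_le : logSlots d n m ≤ accuracy d n m := by
  unfold logSlots
  exact Nat.clog_le_of_le_pow Nat.lt_two_pow_self.le

lemma coins_enough : 2 * n * logSlots d n m ≤ (groves d).coins G v := by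
  have h1 : n + m ≤ inputSize G v := by unfold inputSize; omega
  have h2 : logSlots d n m ≤ 5 * inputSize G v ^ d :=
    logSlots_le.trans (Nat.mul_le_mul_left 5 (Nat.pow_le_pow_left h1 d))
  have h3 : (groves d).coins G v = 10 * inputSize G v ^ (d + 1) := by
    simp [groves]
  rw [h3]
  calc 2 * n * logSlots d n m ≤ 2 * inputSize G v * (5 * inputSize G v ^ d) :=
        Nat.mul_le_mul (by omega) h2
    _ = _ := by ring

lemma expect_claimedLevels (A : ℕ → Finset ℕ) (vt : ℕ → ℕ → ℕ) (N : ℕ) :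
    expect ((groves d).coins G v')
      (fun r => claimedLevels n m (slots d n m) N vt A (drawPair d n m r)) =
    (∑ z, claimedLevels n m (slots d n m) N vt A z) / ((slots d n m : ℝ) * slots d n m) ^ n := by
  have := expect_draw (n := n) (τ := logSlots d n m) (coins_enough (G := G) (v := v'))
    fun z => claimedLevels n m (slots d n m) N vt A z
  have hs : (slots d n m : ℝ) = 2 ^ logSlots d n m := by simp [slots]
  rw [hs]
  exact this

lemma crossWelfare_nonneg : 0 ≤ crossWelfare d G v v' := by
  unfold crossWelfare expect
  refine div_nonneg (sum_nonneg fun r _ => ?_) (by positivity)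
  refine sum_nonneg fun i _ => ?_
  unfold Instance.valuation
  split_ifs
  · positivity
  · exact le_rfl

lemma unit_mul_le_crossWelfare :
    valueUnit d G v * crossPotential d G v v ≤ crossWelfare d G v v := by
  have h1 := (claimedLevels_bounds (n := n) (m := m) (N := levels d n m)
    (vt := roundedValue d G v) (A := finalState d G v) (slots_pos (d := d) (n := n) (m := m))).1
  rw [← expect_claimedLevels (G := G) (v' := v)] at h1
  refine (mul_le_mul_of_nonneg_left h1 valueUnit_nonneg).trans ?_
  rw [← expect_const_mul]
  exact expect_mono fun r => unit_mul_claimedLevels_le r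

lemma crossWelfare_le (hN : 0 < levels d n m) :
    crossWelfare d G v v' ≤
      valueUnit d G v * ((1 + 2 / slots d n m) * crossPotential d G v v' + m) := by
  have h1 := (claimedLevels_bounds (n := n) (m := m) (N := levels d n m)
    (vt := roundedValue d G v) (A := finalState d G v') (slots_pos (d := d) (n := n) (m := m))).2
  rw [← expect_claimedLevels (G := G) (v' := v')] at h1
  have h2 := mul_le_mul_of_nonneg_left (add_le_add_left h1 (m : ℝ))
    (valueUnit_nonneg (d := d) (G := G) (v := v))
  refine le_trans ?_ h2
  rw [← expect_add_const, ← expect_const_mul]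
  exact expect_mono fun r => welfare_le_unit_mul hN r

/-- The local search in real numbers: no state with fitting rows is much better than the final
one. -/
lemma potential_le_crossPotential {O : ℕ → Finset ℕ}
    (hO : RowsFit n m (slots d n m) (weightAt G) (capAt G) O) :
    ((potential n m (slots d n m) (roundedValue d G v) (levels d n m) O : ℚ) : ℝ) ≤
      (1 + 1 / slots d n m) * crossPotential d G v v + 3 * n * m := by
  have hT : 0 < slots d n m := slots_pos
  have h := potential_search (vt := roundedValue d G v) (N := levels d n m) hT roundedValue_le
    weightAt_nonneg capAt_nonneg hO
  have hTr : (0 : ℝ) < slots d n m := by exact_mod_cast hT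
  have h' : (slots d n m : ℝ) *
      ((potential n m (slots d n m) (roundedValue d G v) (levels d n m) O : ℚ) : ℝ) ≤
      (slots d n m + 1) * crossPotential d G v v + 3 * m * (n * slots d n m) := by
    unfold crossPotential finalState
    exact_mod_cast h
  refine le_of_mul_le_mul_left (h'.trans (le_of_eq ?_)) hTr
  field_simp

lemma sum_roundedValue_le {S : Allocation n m} (hS : G.Feasible S) :
    (1 - 1 / Real.exp 1) * (∑ i, ∑ j ∈ S i, (roundedValue d G v i j : ℝ)) ≤
      (1 + 1 / slots d n m) * crossPotential d G v v + 3 * n * m := by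
  refine le_trans ?_ (potential_le_crossPotential (rowsFit_constantRows hS))
  have h1 := mul_le_potential_constantRows (T := slots d n m)
    (vt := roundedValue d G v) (N := levels d n m) roundedValue_le hS.2
  have h2 : (((1 - decay (slots d n m) ^ slots d n m : ℚ) : ℝ)) *
      (∑ i, ∑ j ∈ S i, (roundedValue d G v i j : ℝ)) ≤
      ((potential n m (slots d n m) (roundedValue d G v) (levels d n m)
        (constantRows (slots d n m) S) : ℚ) : ℝ) := by
    exact_mod_cast h1
  refine le_trans (mul_le_mul_of_nonneg_right (one_sub_exp_le slots_pos) ?_) h2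
  positivity

/-- The best single item is an allocation. -/
lemma exists_feasible_maxValue (hn : 0 < n) (hm : 0 < m) : ∃ i : Fin n, ∃ j : Fin m,
    fitValue G v i j = maxValue G v ∧ (maxValue G v ≠ 0 → G.weight i j ≤ G.capacity i) := by
  obtain ⟨i, hi, h1⟩ := exists_mem_eq_sup (range n) ⟨0, mem_range.2 hn⟩
    fun i => (range m).sup fun j => fitValue G v i j
  obtain ⟨j, hj, h2⟩ := exists_mem_eq_sup (range m) ⟨0, mem_range.2 hm⟩ fun j => fitValue G v i j
  have h3 : fitValue G v i j = maxValue G v := by rw [maxValue, h1, h2]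
  refine ⟨⟨i, mem_range.1 hi⟩, ⟨j, mem_range.1 hj⟩, h3, fun h0 => ?_⟩
  rw [← h3, fitValue, dif_pos ⟨mem_range.1 hi, mem_range.1 hj⟩] at h0
  by_contra hlt
  exact h0 (if_neg hlt)

/-- Bin `i` gets the item `j`, and nothing else is assigned. -/
def singleItem (i : Fin n) (j : Fin m) : Allocation n m := fun k => if k = i then {j} else ∅

lemma feasible_singleItem {i : Fin n} {j : Fin m} (h : G.weight i j ≤ G.capacity i) :
    G.Feasible (singleItem i j) := by
  constructor
  · intro k
    unfold singleItem Instance.Fits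
    split_ifs with hk
    · subst hk; simpa using h
    · simp
  · intro k l hkl
    unfold singleItem
    split_ifs with h1 h2
    · exact absurd (h1.trans h2.symm) hkl
    all_goals simp

lemma sum_singleItem (i : Fin n) (j : Fin m) (f : Fin n → Fin m → ℝ) :
    ∑ k, ∑ l ∈ singleItem i j k, f k l = f i j := by
  rw [sum_eq_single i]
  · simp [singleItem]
  · intro k _ hk; simp [singleItem, hk]
  · exact fun h => absurd (mem_univ i) h

lemma one_half_le : (1 : ℝ) / 2 ≤ 1 - 1 / Real.exp 1 := by
  have h1 := Real.add_one_le_exp (1 : ℝ)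
  have : 1 / Real.exp 1 ≤ 1 / 2 := one_div_le_one_div_of_le (by norm_num) (by linarith)
  linarith

/-- If not all relevant values are `0`, the potential is not small. -/
lemma half_levels_le (hn : 0 < n) (hm : 0 < m) (hV : maxValue G v ≠ 0) :
    (levels d n m : ℝ) / 2 ≤ (1 + 1 / slots d n m) * crossPotential d G v v + 3 * n * m := by
  obtain ⟨i, j, h1, h2⟩ := exists_feasible_maxValue (G := G) (v := v) hn hm
  have h3 := sum_roundedValue_le (d := d) (v := v) (feasible_singleItem (h2 hV))
  rw [sum_singleItem i j fun i j => (roundedValue d G v i j : ℝ)] at h3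
  have h4 : roundedValue d G v i j = levels d n m := by
    unfold roundedValue
    have : (maxValue G v : ℚ) ≠ 0 := by exact_mod_cast hV
    rw [h1, mul_div_assoc, div_self this, mul_one, Nat.floor_natCast]
  rw [h4] at h3
  refine le_trans ?_ h3
  have := mul_le_mul_of_nonneg_right one_half_le (Nat.cast_nonneg (α := ℝ) (levels d n m))
  linarith

lemma welfare_le_opt {S : Allocation n m} (hS : G.Feasible S) : G.welfare v S ≤ G.opt v := by
  refine le_csSup ?_ ⟨S, hS, rfl⟩
  refine (Set.Finite.subset (Set.finite_range (G.welfare v)) ?_).bddAbove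
  rintro x ⟨S, -, rfl⟩
  exact ⟨S, rfl⟩

lemma opt_le {b : ℝ} (h : ∀ S, G.Feasible S → G.welfare v S ≤ b) : G.opt v ≤ b := by
  refine csSup_le ⟨_, fun _ => ∅, ⟨fun i => ?_, fun i k _ => ?_⟩, rfl⟩ ?_
  · simp [Instance.Fits]
  · simp
  · rintro x ⟨S, hS, rfl⟩
    exact h S hS

lemma maxValue_le_opt (hn : 0 < n) (hm : 0 < m) : (maxValue G v : ℝ) ≤ G.opt v := by
  obtain ⟨i, j, h1, h2⟩ := exists_feasible_maxValue (G := G) (v := v) hn hm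
  rcases eq_or_ne (maxValue G v) 0 with h0 | h0
  · have hemp : G.Feasible fun _ => ∅ := ⟨fun i => by simp [Instance.Fits], fun i k _ => by simp⟩
    have := welfare_le_opt (v := v) hemp
    rw [welfare_of_feasible hemp] at this
    simpa [h0] using this
  · have hS := feasible_singleItem (h2 h0)
    have := welfare_le_opt (v := v) hS
    rw [welfare_of_feasible hS, sum_singleItem i j fun i j => (v i j : ℝ)] at this
    rwa [← h1, fitValue_of_fits (h2 h0)]

lemma opt_le_unit_mul {b : ℝ} (hN : 0 < levels d n m)
    (hb : ∀ S, G.Feasible S → ∑ i, ∑ j ∈ S i, (roundedValue d G v i j : ℝ) ≤ b) :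
    G.opt v ≤ valueUnit d G v * (b + m) := by
  refine opt_le fun S hS => ?_
  refine le_trans ?_ (mul_le_mul_of_nonneg_left (add_le_add_left (hb S hS) (m : ℝ))
    valueUnit_nonneg)
  rw [welfare_of_feasible hS]
  have h1 : ∀ i, ∀ j ∈ S i,
      (v i j : ℝ) ≤ valueUnit d G v * (roundedValue d G v i j + 1) := by
    intro i j hj
    have hfit : G.weight i j ≤ G.capacity i :=
      (single_le_sum (f := fun j => G.weight i j) (fun _ _ => zero_le) hj).trans (hS.1 i)
    have := fitValue_le_unit_mul (G := G) (v := v) hN i j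
    rwa [fitValue_of_fits hfit] at this
  refine (sum_le_sum fun i _ => sum_le_sum (h1 i)).trans ?_
  simp only [← mul_sum, sum_add_distrib]
  refine mul_le_mul_of_nonneg_left (add_le_add_right ?_ _) valueUnit_nonneg
  have h2 : ∑ i, (S i).card ≤ m := by
    rw [← card_biUnion fun i _ k _ hik => hS.2 hik]
    simpa using card_le_univ (univ.biUnion S)
  simp only [sum_const, nsmul_eq_mul, mul_one]
  exact_mod_cast h2

/-- The numerical relations between the parameters. -/
lemma levels_real {Q : ℝ} (hQ : (((n + m) ^ d : ℕ) : ℝ) = Q) :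
    (levels d n m : ℝ) = 30 * (n * m) * Q ∧ 5 * Q ≤ slots d n m := by
  have h1 : (accuracy d n m : ℝ) = 5 * Q := by rw [← hQ, accuracy]; push_cast; ring
  constructor
  · rw [levels]; push_cast; rw [h1]; ring
  · rw [← h1]; exact_mod_cast accuracy_le_slots

/-- The estimate behind approximate truthfulness, in units of `valueUnit`: with `a = 1 / (5 * Q)`,
`s = 1 / slots`, the number `L` of levels, `K = n * m` and `M = m` items, `F` is the potential for
the true reports and `Y` that for a misreport. -/
lemma misreport_numeric {a s F Y K M L : ℝ} (ha0 : 0 ≤ a) (ha1 : a ≤ 1 / 5)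
    (hs : s ≤ a) (hF : 0 ≤ F) (hY : 0 ≤ Y) (hKL : K = a * L / 6) (hMK : M ≤ K)
    (hL : L / 2 ≤ (1 + s) * F + 3 * K) (hYF : Y ≤ (1 + s) * F + 3 * K) :
    (1 - 5 * a) * ((1 + 2 * s) * Y + M) ≤ F := by
  have hsF : s * F ≤ a * F := mul_le_mul_of_nonneg_right hs hF
  have e1 : L / 2 ≤ (1 + a) * F + 3 * K := by linarith
  have hKF : 3 * K * (1 - a) ≤ a * ((1 + a) * F) := by
    have e2 := mul_le_mul_of_nonneg_left e1 ha0
    linarith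
  have e3 : Y ≤ (1 + a) * F + 3 * K := by linarith
  have e4 : (1 + 2 * s) * Y + M ≤ (1 + 2 * a) * ((1 + a) * F + 3 * K) + K := by
    have : (1 + 2 * s) * Y ≤ (1 + 2 * a) * ((1 + a) * F + 3 * K) :=
      mul_le_mul (by linarith) e3 hY (by linarith)
    linarith
  have h5a : 0 ≤ 1 - 5 * a := by linarith
  have h1a : 0 < 1 - a := by linarith
  refine (mul_le_mul_of_nonneg_left e4 h5a).trans (le_of_mul_le_mul_left ?_ h1a)
  have e5 : (1 - a) * ((1 + 2 * a) * ((1 + a) * F + 3 * K) + K) ≤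
      ((1 + 2 * a) * (1 + a) + a * (1 + a) / 3) * F := by
    have := mul_le_mul_of_nonneg_left hKF (by linarith : 0 ≤ (1 + 2 * a) + 1 / 3)
    linarith
  have e6 : (1 - 5 * a) * ((1 + 2 * a) * (1 + a) + a * (1 + a) / 3) ≤ 1 - a := by
    have := mul_nonneg ha0 ha0
    have := mul_nonneg this ha0
    nlinarith
  calc (1 - a) * ((1 - 5 * a) * ((1 + 2 * a) * ((1 + a) * F + 3 * K) + K))
      = (1 - 5 * a) * ((1 - a) * ((1 + 2 * a) * ((1 + a) * F + 3 * K) + K)) := by ring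
    _ ≤ (1 - 5 * a) * (((1 + 2 * a) * (1 + a) + a * (1 + a) / 3) * F) :=
        mul_le_mul_of_nonneg_left e5 h5a
    _ = ((1 - 5 * a) * ((1 + 2 * a) * (1 + a) + a * (1 + a) / 3)) * F := by ring
    _ ≤ (1 - a) * F := mul_le_mul_of_nonneg_right e6 hF

/-- The mechanism nearly maximizes the expected welfare over all reports. -/
theorem crossWelfare_le_crossWelfare (hn : 0 < n) (hm : 0 < m) :
    (1 - 1 / (((n + m) ^ d : ℕ) : ℝ)) * crossWelfare d G v v' ≤ crossWelfare d G v v := by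
  obtain ⟨Q, hQ⟩ : ∃ Q : ℝ, (((n + m) ^ d : ℕ) : ℝ) = Q := ⟨_, rfl⟩
  obtain ⟨hN, hTQ⟩ := levels_real hQ
  have hQ1 : 1 ≤ Q := by
    rw [← hQ]; exact_mod_cast Nat.one_le_pow _ _ (by omega)
  have hNpos : 0 < levels d n m := by
    have : 0 < accuracy d n m := by unfold accuracy; positivity
    unfold levels; positivity
  rw [hQ]
  have hup := crossWelfare_le (d := d) (G := G) (v := v) (v' := v') hNpos
  have hlow := unit_mul_le_crossWelfare (d := d) (G := G) (v := v)
  rcases eq_or_ne (maxValue G v) 0 with h0 | h0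
  · have hu : valueUnit d G v = 0 := by simp [valueUnit, h0]
    rw [hu, zero_mul] at hup hlow
    have h1 : crossWelfare d G v v' = 0 := le_antisymm hup crossWelfare_nonneg
    rw [h1, mul_zero]
    exact hlow
  have hhalf := half_levels_le (d := d) hn hm h0
  have hcross := potential_le_crossPotential (G := G) (v := v)
    (rowsFit_finalState (d := d) (G := G) (v := v'))
  have hX : crossPotential d G v v' ≤
    (1 + 1 / slots d n m) * crossPotential d G v v + 3 * n * m := hcross
  refine le_trans ?_ hlow
  have hF0 : 0 ≤ crossPotential d G v v := by
    unfold crossPotential; exact_mod_cast potential_nonneg _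
  have hY0 : 0 ≤ crossPotential d G v v' := by
    unfold crossPotential; exact_mod_cast potential_nonneg _
  have hnm : (m : ℝ) ≤ n * m := by
    have h1 : (1 : ℝ) ≤ n := by exact_mod_cast hn
    have h2 : (0 : ℝ) ≤ m := by positivity
    nlinarith
  have hc : 0 ≤ 1 - 1 / Q := by
    rw [sub_nonneg, div_le_one (by linarith)]; exact hQ1
  refine (mul_le_mul_of_nonneg_left hup hc).trans ?_
  rw [mul_left_comm]
  refine mul_le_mul_of_nonneg_left ?_ valueUnit_nonneg
  set F := crossPotential d G v v
  set Y := crossPotential d G v v'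
  set a := 1 / (5 * Q) with ha
  have hT1 : 1 / (slots d n m : ℝ) ≤ a := one_div_le_one_div_of_le (by linarith) hTQ
  have hT0 : 0 ≤ 1 / (slots d n m : ℝ) := by positivity
  have haQ : 1 / Q = 5 * a := by rw [ha]; field_simp
  have ha0 : 0 ≤ a := by positivity
  have ha1 : a ≤ 1 / 5 := by
    rw [ha]; exact one_div_le_one_div_of_le (by norm_num) (by linarith)
  -- `K = n * m` is at most a small multiple of `F`
  set K : ℝ := n * m with hK
  have hK0 : 0 ≤ K := by positivity
  have hKN : K = a * levels d n m / 6 := by rw [hN, ha]; field_simp; ring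
  rw [haQ, show 2 / (slots d n m : ℝ) = 2 * (1 / slots d n m) by ring]
  rw [mul_assoc, ← hK] at hhalf hX
  exact misreport_numeric ha0 ha1 hT1 hF0 hY0 hKN hnm hhalf hX

/-- The expected welfare is almost a `1 - 1 / e` fraction of the optimum. -/
theorem mul_opt_le_crossWelfare (hn : 0 < n) (hm : 0 < m) :
    (1 - 1 / Real.exp 1 - 1 / (((n + m) ^ d : ℕ) : ℝ)) * G.opt v ≤ crossWelfare d G v v := by
  obtain ⟨Q, hQ⟩ : ∃ Q : ℝ, (((n + m) ^ d : ℕ) : ℝ) = Q := ⟨_, rfl⟩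
  obtain ⟨hN, hTQ⟩ := levels_real hQ
  have hQ1 : 1 ≤ Q := by
    rw [← hQ]; exact_mod_cast Nat.one_le_pow _ _ (by omega)
  have hNpos : 0 < levels d n m := by
    have : 0 < accuracy d n m := by unfold accuracy; positivity
    unfold levels; positivity
  rw [hQ]
  refine le_trans ?_ (unit_mul_le_crossWelfare (d := d) (G := G) (v := v))
  have hVopt := maxValue_le_opt (G := G) (v := v) hn hm
  have hF0 : 0 ≤ crossPotential d G v v := by
    unfold crossPotential; exact_mod_cast potential_nonneg _
  have hx := one_half_le
  have hx1 : 1 - 1 / Real.exp 1 ≤ 1 := by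
    have := Real.exp_pos 1
    have : 0 ≤ 1 / Real.exp 1 := by positivity
    linarith
  set x := 1 - 1 / Real.exp 1
  set F := crossPotential d G v v with hF
  have hopt := opt_le_unit_mul (G := G) (v := v) (d := d)
    (b := ((1 + 1 / slots d n m) * F + 3 * n * m) / x) hNpos fun S hS => by
      rw [le_div_iff₀ (by linarith), mul_comm]
      exact sum_roundedValue_le hS
  have hu := valueUnit_nonneg (d := d) (G := G) (v := v)
  have hV : valueUnit d G v * levels d n m = maxValue G v := by
    unfold valueUnit
    have : (levels d n m : ℝ) ≠ 0 := by positivity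
    field_simp
  set u := valueUnit d G v
  have hT1 : 1 / (slots d n m : ℝ) ≤ 1 / (5 * Q) := one_div_le_one_div_of_le (by linarith) hTQ
  set a := 1 / (5 * Q) with ha
  have haQ : 1 / Q = 5 * a := by rw [ha]; field_simp
  have ha0 : 0 ≤ a := by positivity
  have ha1 : a ≤ 1 / 5 := by
    rw [ha]; exact one_div_le_one_div_of_le (by norm_num) (by linarith)
  have hnm : (m : ℝ) ≤ n * m := by
    have h1 : (1 : ℝ) ≤ n := by exact_mod_cast hn
    have h2 : (0 : ℝ) ≤ m := by positivity
    nlinarith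
  set K : ℝ := n * m with hK
  have hK0 : 0 ≤ K := by positivity
  have hKN : K = a * levels d n m / 6 := by rw [hN, ha]; field_simp; ring
  have hopt0 : 0 ≤ G.opt v := le_trans (by positivity) hVopt
  -- `x * opt ≤ u * ((1 + a) * F + 4 * K)`, and `u * K ≤ a * opt / 6`
  have e1 : x * G.opt v ≤ u * ((1 + a) * F + 4 * K) := by
    have h1 := mul_le_mul_of_nonneg_left hopt (by linarith : 0 ≤ x)
    refine h1.trans ?_
    have h2 : x * (u * (((1 + 1 / (slots d n m : ℝ)) * F + 3 * n * m) / x + m)) =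
        u * ((1 + 1 / (slots d n m : ℝ)) * F + 3 * n * m + x * m) := by
      have : x ≠ 0 := by linarith
      field_simp
    rw [h2]
    refine mul_le_mul_of_nonneg_left ?_ hu
    have h3 : x * m ≤ K := by
      have : (0 : ℝ) ≤ m := by positivity
      nlinarith
    nlinarith
  have e2 : u * K ≤ a * G.opt v / 6 := by
    rw [hKN]
    have := mul_le_mul_of_nonneg_left hVopt ha0
    rw [← hV] at this
    linarith
  rw [haQ]
  have hpos : 0 < 1 + a := by linarith
  refine le_of_mul_le_mul_left ?_ hpos
  have e3 : (1 + a) * ((x - 5 * a) * G.opt v) ≤ (x - 4 * (a / 6)) * G.opt v := by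
    rw [← mul_assoc]
    refine mul_le_mul_of_nonneg_right ?_ hopt0
    nlinarith
  linarith

/-- The utility of a bidder under Groves payments is the welfare with respect to its true values. -/
lemma welfare_update_eq (i : Fin n) (vi' : Fin m → NNRat) (c : ℕ → ℕ) (hc : ∀ l, c l ≤ 1) :
    G.valuation i (v i) (allocation d G (Function.update v i vi') c i) -
      ((ownValue d G (Function.update v i vi') c i -
        ∑ k, ownValue d G (Function.update v i vi') c k : ℚ) : ℝ) =
    G.welfare v (allocation d G (Function.update v i vi') c) := by
  have hf := feasible_allocation (G := G) (v := Function.update v i vi') (d := d) hc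
  rw [welfare_of_feasible hf,
    ← add_sum_erase univ (fun k => ∑ j ∈ allocation d G (Function.update v i vi') c k, (v k j : ℝ))
      (mem_univ i),
    ← add_sum_erase univ (fun k => ownValue d G (Function.update v i vi') c k) (mem_univ i)]
  have h1 : ∀ k ∈ univ.erase i, (ownValue d G (Function.update v i vi') c k : ℚ) =
      ∑ j ∈ allocation d G (Function.update v i vi') c k, (v k j : ℚ) := by
    intro k hk
    rw [ownValue, Function.update_of_ne (ne_of_mem_erase hk)]
  rw [sum_congr rfl h1, Instance.valuation, if_pos (hf.1 i)]
  push_cast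
  ring

lemma expectedUtility_eq (i : Fin n) (vi' : Fin m → NNRat) :
    (groves d).expectedUtility G i (v i) (Function.update v i vi') =
      crossWelfare d G v (Function.update v i vi') := by
  unfold Mechanism.expectedUtility crossWelfare
  congr 1
  funext r
  exact welfare_update_eq i vi' (coinSeq r) (coinSeq_le_one r)

lemma crossWelfare_of_degenerate (h : n = 0 ∨ m = 0) : crossWelfare d G v v' = 0 := by
  unfold crossWelfare expect
  rw [sum_eq_zero, zero_div]
  intro r _
  refine sum_eq_zero fun i _ => ?_
  rcases h with rfl | rfl
  · exact i.elim0
  · unfold Instance.valuation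
    split_ifs
    · exact sum_eq_zero fun j => j.elim0
    · rfl

theorem groves_truthful {ε : ℝ} (hε : 0 < m → 0 < n → 1 / (((n + m) ^ d : ℕ) : ℝ) ≤ ε) :
    (groves d).IsApproxTruthfulInExpectation G ε := by
  intro i v vi'
  have h1 := expectedUtility_eq (d := d) (G := G) (v := v) i (v i)
  rw [Function.update_eq_self] at h1
  rw [h1, expectedUtility_eq]
  rcases Nat.eq_zero_or_pos m with hm | hm
  · rw [crossWelfare_of_degenerate (Or.inr hm), crossWelfare_of_degenerate (Or.inr hm)]
    simp
  have hn : 0 < n := i.pos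
  refine ge_iff_le.2 (le_trans ?_
    (crossWelfare_le_crossWelfare (d := d) (v' := Function.update v i vi') hn hm))
  exact mul_le_mul_of_nonneg_right (by linarith [hε hm hn]) crossWelfare_nonneg

theorem groves_approximation {ε : ℝ} (hε : 0 < m → 0 < n → 1 / (((n + m) ^ d : ℕ) : ℝ) ≤ ε) :
    (groves d).IsApproximation G (1 - 1 / Real.exp 1 - ε) := by
  intro v
  refine ⟨fun r => feasible_allocation (coinSeq_le_one r), ?_⟩
  change crossWelfare d G v v ≥ _
  by_cases h : n = 0 ∨ m = 0
  · rw [crossWelfare_of_degenerate h]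
    have h0 : G.opt v = 0 := by
      refine le_antisymm (opt_le fun S hS => ?_) ?_
      · rw [welfare_of_feasible hS]
        refine le_of_eq (sum_eq_zero fun i _ => sum_eq_zero fun j _ => ?_)
        rcases h with rfl | rfl
        · exact i.elim0
        · exact j.elim0
      · have hemp : G.Feasible fun _ => ∅ := ⟨fun i => by simp [Instance.Fits], fun i k _ => by simp⟩
        have := welfare_le_opt (v := v) hemp
        rw [welfare_of_feasible hemp] at this
        simpa using this
    rw [h0, mul_zero]
  · push Not at h
    have hn := Nat.pos_of_ne_zero h.1
    have hm := Nat.pos_of_ne_zero h.2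
    have hopt : 0 ≤ G.opt v := le_trans (by positivity) (maxValue_le_opt hn hm)
    refine le_trans ?_ (mul_opt_le_crossWelfare (d := d) hn hm)
    exact mul_le_mul_of_nonneg_right (by linarith [hε hm hn]) hopt

/-- A polynomial with natural coefficients is dominated by a power of the sum of its variables. -/
lemma exists_eval_le_pow (q : MvPolynomial (Fin 2) ℕ) :
    ∃ d : ℕ, ∀ m n : ℕ, 0 < m → 0 < n → MvPolynomial.eval ![m, n] q ≤ (n + m) ^ d := by
  induction q using MvPolynomial.induction_on with
  | C a =>
    refine ⟨a, fun m n hm hn => ?_⟩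
    rw [MvPolynomial.eval_C]
    exact Nat.lt_two_pow_self.le.trans (Nat.pow_le_pow_left (by omega) a)
  | add p q hp hq =>
    obtain ⟨d, hd⟩ := hp
    obtain ⟨e, he⟩ := hq
    refine ⟨max d e + 1, fun m n hm hn => ?_⟩
    rw [map_add, pow_succ]
    have h1 := (hd m n hm hn).trans (Nat.pow_le_pow_right (by omega) (le_max_left d e))
    have h2 := (he m n hm hn).trans (Nat.pow_le_pow_right (by omega) (le_max_right d e))
    have h3 := Nat.mul_le_mul_left ((n + m) ^ max d e) (by omega : 2 ≤ n + m)
    omega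
  | mul_X p i hp =>
    obtain ⟨d, hd⟩ := hp
    refine ⟨d + 1, fun m n hm hn => ?_⟩
    rw [map_mul, MvPolynomial.eval_X, pow_succ]
    refine Nat.mul_le_mul (hd m n hm hn) ?_
    fin_cases i <;> simp

end Guarantee

/-! ### The program: knapsack

The variables and arrays of the program, besides the input in the arrays `0` to `5` and the output in
`6` and `7`: the parameters `slots`, `logSlots`, `levels`, `maxValue` and `accuracy` in the variables
`10` to `14`; the rounded values, the powers of `decay`, the rows, the profits, the knapsack table,
the best response and the numbers drawn in the arrays `20` to `26`; loop counters in the variables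
from `30` on and auxiliary variables from `40` on. -/

section Knap

@[simp] lemma floor_add_one_cast (a : ℕ) : ⌊(a : ℚ) + 1⌋₊ = a + 1 := by
  exact_mod_cast Nat.floor_natCast (R := ℚ) (a + 1)

@[simp] lemma floor_mul_add_cast (a b c : ℕ) : ⌊(a : ℚ) * b + c⌋₊ = a * b + c := by
  exact_mod_cast Nat.floor_natCast (R := ℚ) (a * b + c)

variable {L Z : ℕ} {s : Store} {Q : Store → Prop}

/-- The rule for assignments with the values of the three expressions made explicit. -/
lemma Triple.assign_eq {a : ℕ} {i j e : Expr} (k l : ℕ) (x : ℚ) (hi : i.eval s = k)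
    (hj : j.eval s = l) (he : e.eval s = x) (hb : bitSize x ≤ L) (h : Q (s.write a k l x)) :
    Triple L Z (.assign a i j e) s Q := by
  refine Triple.assign (by rwa [he]) ?_
  rwa [hi, hj, he, Nat.floor_natCast, Nat.floor_natCast]

/-- The rule for assignments to scalar variables. -/
lemma Triple.set_eq {a : ℕ} {e : Expr} (x : ℚ) (he : e.eval s = x) (hb : bitSize x ≤ L)
    (h : Q (s.write a 0 0 x)) : Triple L Z (.set a e) s Q :=
  Triple.assign_eq 0 0 x (by simp) (by simp) he hb h

/-- The rule for conditionals with the values of the two expressions made explicit. -/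
lemma Triple.ifLe_eq {e f : Expr} {p q : Prog} (x y : ℚ) (he : e.eval s = x) (hf : f.eval s = y)
    (h1 : x ≤ y → Triple L Z p s Q) (h2 : y < x → Triple L Z q s Q) :
    Triple L Z (.ifLe e f p q) s Q :=
  Triple.ifLe (fun h => h1 (by rwa [he, hf] at h)) (fun h => h2 (by rwa [he, hf] at h))

lemma bitSize_nat_le (hL : Z < L) {x : ℕ} (hx : x ≤ Z) : bitSize (x : ℚ) ≤ L :=
  (bitSize_natCast x).trans (by omega)

/-- Fills the table `24` with the values `knapDP` for the bin in variable `45` and the profits in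
the array `23`. -/
def knapTableProg : Prog :=
  .seq
    (.for 32 (.add (.mul (.var 1) (.var 12)) (.nat 1))
      (.ifLe (.var 32) (.nat 0)
        (.assign 24 (.nat 0) (.var 32) (.cell 2 (.var 45) (.nat 0)))
        (.assign 24 (.nat 0) (.var 32) (.const (-1)))))
    (.for 31 (.var 1)
      (.for 32 (.add (.mul (.var 1) (.var 12)) (.nat 1))
        (.seq (.assign 24 (.add (.var 31) (.nat 1)) (.var 32) (.cell 24 (.var 31) (.var 32)))
          (.ifLe (.cell 23 (.var 31) (.nat 0)) (.var 32)
            (.seq (.set 40 (.sub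
                (.cell 24 (.var 31) (.sub (.var 32) (.cell 23 (.var 31) (.nat 0))))
                (.cell 3 (.var 45) (.var 31))))
              (.ifLe (.nat 0) (.var 40)
                (.ifLe (.var 40) (.cell 24 (.var 31) (.var 32)) .skip
                  (.assign 24 (.add (.var 31) (.nat 1)) (.var 32) (.var 40)))
                .skip))
            .skip))))

variable {m N i : ℕ} {b : ℕ → ℕ} {w : ℕ → ℚ} {C : ℚ}

lemma knapTableProg_spec (hL : Z < L) (hZ : m * N + 1 ≤ Z) (hmZ : m ≤ Z)
    (hm : s 1 0 0 = m) (hN : s 12 0 0 = N) (hi : s 45 0 0 = i)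
    (hC : s 2 i 0 = C) (hw : ∀ j < m, s 3 i j = w j) (hb : ∀ j < m, s 23 j 0 = b j)
    (hbits : ∀ j ≤ m, ∀ q, bitSize (knapDP b w C j q) ≤ L)
    (hbits' : ∀ j < m, ∀ q, bitSize (knapDP b w C j q - w j) ≤ L) :
    Triple L Z knapTableProg s
      fun s' => ∀ j ≤ m, ∀ q ≤ m * N, s' 24 j q = knapDP b w C j q := by
  refine Triple.seq (Triple.for (m * N + 1) hZ hL
    (fun k s' => ∀ q < k, s' 24 0 q = knapDP b w C 0 q) ?_ rfl ?_ ?_ ?_ ?_)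
  · intro k s' y h; simpa using h
  · simp
  · intro k s' hk h hx fr
    simp [fr 1 rfl, fr 12 rfl, hm, hN]
  · intro k s' hk h hx fr
    refine Triple.ifLe_eq k 0 (by simp [hx]) (by simp) (fun h0 => ?_) (fun h0 => ?_)
    · have h0 : k = 0 := by exact_mod_cast le_antisymm h0 (Nat.cast_nonneg k)
      subst h0
      refine Triple.assign_eq 0 0 C (by simp) (by simp [hx]) (by simp [fr 45 rfl, fr 2 rfl, hi, hC])
        (by simpa [knapDP] using hbits 0 (Nat.zero_le _) 0) ?_
      intro q hq
      obtain rfl : q = 0 := by omega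
      simp [knapDP]
    · have h0 : k ≠ 0 := by rintro rfl; simp at h0
      refine Triple.assign_eq 0 k (-1) (by simp) (by simp [hx]) (by simp)
        (by simpa [knapDP, h0] using hbits 0 (Nat.zero_le _) k) ?_
      intro q hq
      rcases Nat.lt_succ_iff_lt_or_eq.1 hq with hq | rfl
      · simp [hq.ne, h q hq]
      · simp [knapDP, h0]
  intro s₁ h₁ fr₁
  refine Triple.for m hmZ hL
    (fun k s' => ∀ j ≤ k, ∀ q ≤ m * N, s' 24 j q = knapDP b w C j q) ?_ rfl ?_ ?_ ?_ ?_
  · intro k s' y h; simpa using h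
  · intro j hj q hq
    obtain rfl : j = 0 := by omega
    exact h₁ q (by omega)
  · intro k s' hk h hx fr
    simp [fr 1 rfl, fr₁ 1 rfl, hm]
  · intro k s₂ hk h₂ hx₂ fr₂
    refine Triple.for (m * N + 1) hZ hL
      (fun l s' => (∀ j ≤ k, ∀ q ≤ m * N, s' 24 j q = knapDP b w C j q) ∧
        ∀ q < l, s' 24 (k + 1) q = knapDP b w C (k + 1) q) ?_ rfl ⟨h₂, by simp⟩ ?_ ?_ ?_
    · intro k s' y h; simpa using h
    · intro l s' hl h hx fr
      simp [fr 1 rfl, fr 12 rfl, fr₂ 1 rfl, fr₂ 12 rfl, fr₁ 1 rfl, fr₁ 12 rfl, hm, hN]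
    · rintro l s₃ hl ⟨h₃, h₃'⟩ hx₃ fr₃
      have e31 : s₃ 31 0 0 = k := by rw [fr₃ 31 rfl, hx₂]
      have e23 : s₃ 23 k 0 = b k := by rw [fr₃ 23 rfl, fr₂ 23 rfl, fr₁ 23 rfl, hb k hk]
      have e3 : s₃ 3 i k = w k := by rw [fr₃ 3 rfl, fr₂ 3 rfl, fr₁ 3 rfl, hw k hk]
      have e45 : s₃ 45 0 0 = i := by rw [fr₃ 45 rfl, fr₂ 45 rfl, fr₁ 45 rfl, hi]
      have hlm : l ≤ m * N := by omega
      have e24 : s₃ 24 k l = knapDP b w C k l := h₃ k le_rfl l hlm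
      have final : ∀ x, x = knapDP b w C (k + 1) l → ∀ s' : Store,
          (∀ j ≤ k, s' 24 j = s₃ 24 j) → (∀ q < l, s' 24 (k + 1) q = s₃ 24 (k + 1) q) →
          s' 24 (k + 1) l = x →
          (∀ j ≤ k, ∀ q ≤ m * N, s' 24 j q = knapDP b w C j q) ∧
            ∀ q < l + 1, s' 24 (k + 1) q = knapDP b w C (k + 1) q := by
        intro x hx s' g1 g2 g3
        refine ⟨fun j hj q hq => by rw [g1 j hj, h₃ j hj q hq], fun q hq => ?_⟩
        rcases Nat.lt_succ_iff_lt_or_eq.1 hq with hq | rfl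
        · rw [g2 q hq, h₃' q hq]
        · rw [g3, hx]
      refine Triple.seq (Triple.assign_eq (k + 1) l (knapDP b w C k l) (by simp [e31])
        (by simp [hx₃]) (by simp [e31, hx₃, e24]) (hbits k hk.le l) ?_)
      have w1 : ∀ j ≤ k, (s₃.write 24 (k + 1) l (knapDP b w C k l)) 24 j = s₃ 24 j := by
        intro j hj; funext q; simp [show j ≠ k + 1 by omega]
      have w2 : ∀ q < l, (s₃.write 24 (k + 1) l (knapDP b w C k l)) 24 (k + 1) q =
          s₃ 24 (k + 1) q := by
        intro q hq; simp [hq.ne]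
      refine Triple.ifLe_eq (b k) l (by simp [e31, e23]) (by simp [hx₃]) (fun h0 => ?_)
        (fun h0 => ?_)
      · have h0 : b k ≤ l := by exact_mod_cast h0
        have e24' : s₃ 24 k (l - b k) = knapDP b w C k (l - b k) := h₃ k le_rfl _ (by omega)
        have v1 : ∀ a ≠ 24, (s₃.write 24 (k + 1) l (knapDP b w C k l)) a = s₃ a := fun a ha => by
          simp [ha]
        have v2 : (s₃.write 24 (k + 1) l (knapDP b w C k l)) 24 (k + 1) l = knapDP b w C k l := by
          simp
        generalize s₃.write 24 (k + 1) l (knapDP b w C k l) = s₄ at w1 w2 v1 v2 ⊢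
        have u31 := v1 31 (by simp)
        have u32 := v1 32 (by simp)
        have u23 := v1 23 (by simp)
        have u45 := v1 45 (by simp)
        have u3 := v1 3 (by simp)
        have u24 := w1 k le_rfl
        set x := knapDP b w C k (l - b k) - w k with hx
        refine Triple.seq (Triple.set_eq x
          (by simp [u31, u32, u23, u45, u3, u24, e31, e23, e45, e3, hx₃, e24', hx])
          (hbits' k hk _) ?_)
        refine Triple.ifLe_eq 0 x (by simp) (by simp) (fun h1 => ?_) (fun h1 => ?_)
        · refine Triple.ifLe_eq x (knapDP b w C k l) (by simp)
            (by simp [u31, u32, u24, e31, hx₃, e24]) (fun h2 => ?_) (fun h2 => ?_)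
          · refine Triple.skip (final (knapDP b w C k l) ?_ _ ?_ ?_ (by simpa using v2))
            · rw [knapDP, if_neg]
              rintro ⟨-, -, h3⟩
              exact absurd h3 (not_lt.2 h2)
            · intro j hj; simpa using w1 j hj
            · intro q hq; simpa using w2 q hq
          · refine Triple.assign_eq (k + 1) l x (by simp [u31, e31]) (by simp [u32, hx₃]) (by simp)
              (hbits' k hk _) (final x ?_ _ ?_ ?_ (by simp))
            · rw [knapDP, if_pos ⟨h0, h1, h2⟩]
            · intro j hj; funext q; simp [show j ≠ k + 1 by omega, w1 j hj]
            · intro q hq; simp [hq.ne, w2 q hq]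
        · refine Triple.skip (final (knapDP b w C k l) ?_ _ ?_ ?_ (by simpa using v2))
          · rw [knapDP, if_neg]
            rintro ⟨-, h3, -⟩
            exact absurd h3 (not_le.2 h1)
          · intro j hj; simpa using w1 j hj
          · intro q hq; simpa using w2 q hq
      · refine Triple.skip (final (knapDP b w C k l) ?_ _ w1 w2 (by simp))
        rw [knapDP, if_neg]
        rintro ⟨h1, -⟩
        exact absurd (by exact_mod_cast h0 : l < b k) (not_lt.2 h1)
    · rintro s' ⟨h, h'⟩ -
      intro j hj q hq
      rcases Nat.lt_succ_iff_lt_or_eq.1 (Nat.lt_succ_of_le hj) with hj | rfl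
      · exact h j (by omega) q hq
      · exact h' q (by omega)
  · intro s' h _; exact h

end Knap

section KnapSelect

variable {L Z : ℕ} {s : Store} {m N : ℕ} {b : ℕ → ℕ} {w : ℕ → ℚ} {C : ℚ}

/-- Computes the largest profit in the variable `42` and the indicator of a set that attains it in
the array `25` from the table `24`. -/
def knapSelectProg : Prog :=
  .seq (.set 42 (.nat 0)) <| .seq
    (.for 32 (.mul (.var 1) (.var 12))
      (.ifLe (.nat 0) (.cell 24 (.var 1) (.add (.var 32) (.nat 1)))
        (.set 42 (.add (.var 32) (.nat 1))) .skip)) <| .seq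
    (.set 43 (.var 42))
    (.for 31 (.var 1)
      (.seq (.set 46 (.sub (.sub (.var 1) (.nat 1)) (.var 31)))
        (.ifLe (.cell 24 (.add (.var 46) (.nat 1)) (.var 43)) (.cell 24 (.var 46) (.var 43))
          (.assign 25 (.var 46) (.nat 0) (.nat 0))
          (.seq (.assign 25 (.var 46) (.nat 0) (.nat 1))
            (.set 43 (.sub (.var 43) (.cell 23 (.var 46) (.nat 0))))))))

lemma knapSelectProg_spec (hL : Z < L) (hZ : m * N + 1 ≤ Z) (hmZ : m ≤ Z)
    (hm : s 1 0 0 = m) (hN : s 12 0 0 = N) (hb : ∀ j < m, s 23 j 0 = b j)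
    (htab : ∀ j ≤ m, ∀ q ≤ m * N, s 24 j q = knapDP b w C j q) :
    Triple L Z knapSelectProg s fun s' => s' 42 0 0 = knapOpt b w C m (m * N) ∧
      ∀ j < m, s' 25 j 0 = if j ∈ knapSet b w C m (knapOpt b w C m (m * N)) then 1 else 0 := by
  refine Triple.seq (Triple.set_eq 0 (by simp) (by exact_mod_cast bitSize_nat_le hL (Nat.zero_le Z)) ?_)
  refine Triple.seq (Triple.for (m * N) (by omega) hL
    (fun k s' => s' 42 0 0 = (knapOpt b w C m k : ℕ)) ?_ rfl (by simp [knapOpt]) ?_ ?_ ?_)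
  · intro k s' y h; simpa using h
  · intro k s' hk h hx fr
    simp [fr 1 rfl, fr 12 rfl, hm, hN]
  · intro k s' hk h hx fr
    have h24 : s' 24 m (k + 1) = knapDP b w C m (k + 1) := by
      rw [fr 24 rfl, Store.write_of_ne _ (by simp)]; exact htab m le_rfl _ hk
    refine Triple.ifLe_eq 0 (knapDP b w C m (k + 1)) (by simp)
      (by simp [hx, fr 1 rfl, hm, h24]) (fun h0 => ?_) (fun h0 => ?_)
    · refine Triple.set_eq ((k + 1 : ℕ) : ℚ) (by simp [hx])
        (bitSize_nat_le hL (by omega)) ?_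
      rw [knapOpt, Nat.findGreatest_succ, if_pos h0]
      simp
    · refine Triple.skip ?_
      rw [knapOpt, Nat.findGreatest_succ, if_neg (not_le.2 h0)]
      exact h
  intro s₁ h₁ fr₁
  set q₀ := knapOpt b w C m (m * N) with hq₀
  have hq₀le : q₀ ≤ m * N := Nat.findGreatest_le _
  have tab₁ : ∀ j ≤ m, ∀ q ≤ m * N, s₁ 24 j q = knapDP b w C j q := by
    intro j hj q hq
    rw [fr₁ 24 rfl, Store.write_of_ne _ (by simp)]; exact htab j hj q hq
  refine Triple.seq (Triple.set_eq (q₀ : ℚ) (by simp [h₁]) (bitSize_nat_le hL (by omega)) ?_)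
  refine Triple.for m hmZ hL (fun k s' => s' 42 0 0 = (q₀ : ℚ) ∧
    (∃ q ≤ m * N, s' 43 0 0 = (q : ℚ) ∧
      ∀ j < m - k, j ∈ knapSet b w C m q₀ ↔ j ∈ knapSet b w C (m - k) q) ∧
    ∀ j < m, m - k ≤ j → s' 25 j 0 = if j ∈ knapSet b w C m q₀ then 1 else 0) ?_ rfl ?_ ?_ ?_ ?_
  · intro k s' y h; simpa using h
  · refine ⟨by simp [h₁], ⟨q₀, hq₀le, by simp, fun j _ => by simp⟩, fun j h1 h2 => by omega⟩
  · intro k s' hk h hx fr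
    simp [fr 1 rfl, fr₁ 1 rfl, hm]
  · rintro k s₂ hk ⟨g42, ⟨q, hq, g43, gset⟩, g25⟩ hx₂ fr₂
    obtain ⟨l, hl⟩ : ∃ l, m - k = l + 1 := ⟨m - k - 1, by omega⟩
    have hl' : m - (k + 1) = l := by omega
    have hlm : l < m := by omega
    have hval : (m : ℚ) - 1 - k = l := by
      have : m = l + 1 + k := by omega
      rw [this]; push_cast; ring
    rw [hl] at gset g25
    rw [hl']
    refine Triple.seq (Triple.set_eq (l : ℚ)
      (by simp [fr₂ 1 rfl, fr₁ 1 rfl, hm, hx₂, hval]) (bitSize_nat_le hL (by omega)) ?_)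
    have h24 : ∀ j ≤ m, ∀ q ≤ m * N, s₂ 24 j q = knapDP b w C j q := by
      intro j hj q hq
      rw [fr₂ 24 rfl, Store.write_of_ne _ (by simp)]; exact tab₁ j hj q hq
    have h23 : s₂ 23 l 0 = b l := by
      rw [fr₂ 23 rfl, Store.write_of_ne _ (by simp), fr₁ 23 rfl,
        Store.write_of_ne _ (by simp), hb l hlm]
    have hsub : ∀ q, ∀ j < l, (j ∈ insert l (knapSet b w C l q) ↔ j ∈ knapSet b w C l q) := by
      intro q j hj
      simp [hj.ne]
    have hbound : ∀ (j q : ℕ), knapSet b w C j q ⊆ range j := by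
      intro j
      induction j with
      | zero => intro q; simp [knapSet]
      | succ j ih =>
        intro q x hx
        rw [knapSet] at hx
        split_ifs at hx
        · rcases mem_insert.1 hx with rfl | hx
          · simp
          · have := mem_range.1 (ih _ hx); exact mem_range.2 (by omega)
        · have := mem_range.1 (ih _ hx); exact mem_range.2 (by omega)
    refine Triple.ifLe_eq (knapDP b w C (l + 1) q) (knapDP b w C l q)
      (by simp [g43, h24 _ (by omega : l + 1 ≤ m) q hq])
      (by simp [g43, h24 _ hlm.le q hq]) (fun h0 => ?_) (fun h0 => ?_)
    · have hset : knapSet b w C (l + 1) q = knapSet b w C l q := by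
        rw [knapSet, if_neg (not_lt.2 h0)]
      have hnot : l ∉ knapSet b w C m q₀ := by
        rw [gset l (by omega), hset]
        exact fun h => by simpa using hbound _ _ h
      refine Triple.assign_eq l 0 0 (by simp) (by simp) (by simp)
        (by exact_mod_cast bitSize_nat_le hL (Nat.zero_le Z)) ?_
      refine ⟨by simpa using g42, ⟨q, hq, by simpa using g43, fun j hj => ?_⟩, fun j h1 h2 => ?_⟩
      · rw [gset j (by omega), hset]
      · rcases h2.eq_or_lt with rfl | h2
        · simp [hnot]
        · simpa [h2.ne'] using g25 j h1 h2
    · have hset : knapSet b w C (l + 1) q = insert l (knapSet b w C l (q - b l)) := by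
        rw [knapSet, if_pos h0]
      have hbq : b l ≤ q := by
        by_contra hlt
        rw [knapDP, if_neg fun h => hlt h.1] at h0
        exact lt_irrefl _ h0
      have hin : l ∈ knapSet b w C m q₀ := by
        rw [gset l (by omega), hset]
        exact mem_insert_self _ _
      refine Triple.seq (Triple.assign_eq l 0 1 (by simp) (by simp) (by simp)
        (by exact_mod_cast bitSize_nat_le hL (show 1 ≤ Z by omega)) ?_)
      refine Triple.set_eq ((q - b l : ℕ) : ℚ) (by simp [g43, h23, Nat.cast_sub hbq])
        (bitSize_nat_le hL (by omega)) ?_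
      refine ⟨by simpa using g42, ⟨q - b l, by omega, by simp, fun j hj => ?_⟩, fun j h1 h2 => ?_⟩
      · rw [gset j (by omega), hset, hsub _ j hj]
      · rcases h2.eq_or_lt with rfl | h2
        · simp [hin]
        · simpa [h2.ne'] using g25 j h1 h2
  · rintro s' ⟨h1, -, h3⟩ -
    exact ⟨h1, fun j hj => h3 j hj (by omega)⟩

end KnapSelect

/-! ### The program: local search -/

section Search

variable {L Z : ℕ} {s : Store} {n m T N : ℕ} {vt : ℕ → ℕ → ℕ} {A : ℕ → Finset ℕ}

/-- Computes the profits of the items for the row `33` of the bin `45` in the array `23`. -/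
def profitProg : Prog :=
  .for 31 (.var 1)
    (.seq (.set 41 (.nat 0)) <| .seq
      (.for 32 (.cell 20 (.var 45) (.var 31))
        (.seq (.set 40 (.nat 0)) <| .seq
          (.for 34 (.mul (.var 0) (.var 10))
            (.ifLe (.add (.var 32) (.nat 1)) (.cell 20 (.div (.var 34) (.var 10)) (.var 31))
              (.set 40 (.add (.var 40) (.cell 22 (.var 34) (.var 31)))) .skip))
          (.set 41 (.add (.var 41)
            (.cell 21 (.sub (.var 40) (.cell 22 (.var 33) (.var 31))) (.nat 0))))))
      (.assign 23 (.var 31) (.nat 0) (.floor (.var 41))))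

lemma floor_div_cast (a b : ℕ) : ⌊(a : ℚ) / b⌋₊ = a / b := Nat.floor_div_eq_div a b

lemma demand_le (j θ : ℕ) : demand n T vt A j θ ≤ n * T := by
  unfold demand
  rw [← card_filter]
  exact (card_filter_le _ _).trans (by simp)

lemma profitProg_spec {r : ℕ} (hL : Z < L) (hmZ : m ≤ Z) (hTZ : n * T ≤ Z) (hNZ : N ≤ Z)
    (hvt : ∀ i j, vt i j ≤ N) (hr : r < n * T)
    (hn : s 0 0 0 = n) (hm : s 1 0 0 = m) (hT : s 10 0 0 = T) (hrow : s 33 0 0 = r)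
    (hbin : s 45 0 0 = (r / T : ℕ))
    (h20 : ∀ i < n, ∀ j < m, s 20 i j = vt i j)
    (h21 : ∀ c ≤ n * T, s 21 c 0 = decay T ^ c)
    (h22 : ∀ r < n * T, ∀ j < m, s 22 r j = if j ∈ A r then 1 else 0)
    (hbits : ∀ k ≤ N, ∀ e : ℕ → ℕ, (∀ θ, e θ ≤ n * T) →
      bitSize (∑ θ ∈ range k, decay T ^ e θ) ≤ L) :
    Triple L Z profitProg s fun s' => ∀ j < m, s' 23 j 0 = profit n T vt A r j := by
  have hdiv : ∀ l < n * T, l / T < n := fun l hl => Nat.div_lt_of_lt_mul (by rwa [mul_comm])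
  have b0 : bitSize 0 ≤ L := by exact_mod_cast bitSize_nat_le hL (Nat.zero_le Z)
  refine Triple.for m hmZ hL (fun k s' => ∀ j < k, s' 23 j 0 = profit n T vt A r j) ?_ rfl
    (by simp) ?_ ?_ ?_
  · intro k s' y h; simpa using h
  · intro k s' hk h hx fr
    simp [fr 1 rfl, hm]
  · intro j s₁ hj h₁ hx₁ fr₁
    refine Triple.seq (Triple.set_eq 0 (by simp) b0 ?_)
    refine Triple.seq (Triple.for (vt (r / T) j) ((hvt _ _).trans hNZ) hL
      (fun k s' => s' 41 0 0 = ∑ θ ∈ range k,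
        decay T ^ (demand n T vt A j θ - if j ∈ A r then 1 else 0)) ?_ rfl (by simp) ?_ ?_ ?_)
    · intro k s' y h; simpa using h
    · intro k s' hk h hx fr
      simp [fr 45 rfl, fr 31 rfl, fr 20 rfl, fr₁ 45 rfl, fr₁ 20 rfl, hbin, hx₁,
        h20 _ (hdiv r hr) j hj]
    · intro θ s₂ hθ h₂ hx₂ fr₂
      refine Triple.seq (Triple.set_eq 0 (by simp) b0 ?_)
      refine Triple.seq (Triple.for (n * T) hTZ hL
        (fun k s' => s' 40 0 0 = ((∑ l ∈ range k,
          if θ < vt (l / T) j ∧ j ∈ A l then 1 else 0 : ℕ) : ℚ)) ?_ rfl (by simp) ?_ ?_ ?_)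
      · intro k s' y h; simpa using h
      · intro k s' hk h hx fr
        simp [fr 0 rfl, fr 10 rfl, fr₂ 0 rfl, fr₂ 10 rfl, fr₁ 0 rfl, fr₁ 10 rfl, hn, hT]
      · intro l s₃ hl h₃ hx₃ fr₃
        have e31 : s₃ 31 0 0 = j := by
          rw [fr₃ 31 rfl, Store.write_of_ne _ (by simp), fr₂ 31 rfl,
            Store.write_of_ne _ (by simp), hx₁]
        have e32 : s₃ 32 0 0 = θ := by
          rw [fr₃ 32 rfl, Store.write_of_ne _ (by simp), hx₂]
        have e10 : s₃ 10 0 0 = T := by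
          rw [fr₃ 10 rfl, Store.write_of_ne _ (by simp), fr₂ 10 rfl,
            Store.write_of_ne _ (by simp), fr₁ 10 rfl, hT]
        have e20 : s₃ 20 (l / T) j = vt (l / T) j := by
          rw [fr₃ 20 rfl, Store.write_of_ne _ (by simp), fr₂ 20 rfl,
            Store.write_of_ne _ (by simp), fr₁ 20 rfl, h20 _ (hdiv l hl) j hj]
        have e22 : s₃ 22 l j = if j ∈ A l then 1 else 0 := by
          rw [fr₃ 22 rfl, Store.write_of_ne _ (by simp), fr₂ 22 rfl,
            Store.write_of_ne _ (by simp), fr₁ 22 rfl, h22 l hl j hj]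
        have hsum : ∑ l ∈ range (l + 1), (if θ < vt (l / T) j ∧ j ∈ A l then 1 else 0) ≤ Z := by
          rw [← card_filter]
          refine (card_filter_le _ _).trans ?_
          rw [card_range]; omega
        refine Triple.ifLe_eq (θ + 1 : ℕ) (vt (l / T) j) (by simp [e32])
          (by simp [hx₃, e10, e31, floor_div_cast, e20]) (fun h0 => ?_) (fun h0 => ?_)
        · have h0 : θ < vt (l / T) j := by exact_mod_cast h0
          refine Triple.set_eq ((∑ l ∈ range (l + 1),
            if θ < vt (l / T) j ∧ j ∈ A l then 1 else 0 : ℕ) : ℚ) ?_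
            (bitSize_nat_le hL hsum) (by simp)
          rw [sum_range_succ]
          simp [h₃, hx₃, e31, e22, h0]
        · have h0 : ¬ θ < vt (l / T) j := by
            have : vt (l / T) j < θ + 1 := by exact_mod_cast h0
            omega
          refine Triple.skip ?_
          rw [sum_range_succ, h₃]
          simp [h0]
      · intro s₃ h₃ fr₃
        have e40 : s₃ 40 0 0 = demand n T vt A j θ := h₃
        have e31 : s₃ 31 0 0 = j := by
          rw [fr₃ 31 rfl, Store.write_of_ne _ (by simp), fr₂ 31 rfl,
            Store.write_of_ne _ (by simp), hx₁]
        have e33 : s₃ 33 0 0 = r := by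
          rw [fr₃ 33 rfl, Store.write_of_ne _ (by simp), fr₂ 33 rfl,
            Store.write_of_ne _ (by simp), fr₁ 33 rfl, hrow]
        have e22 : s₃ 22 r j = if j ∈ A r then 1 else 0 := by
          rw [fr₃ 22 rfl, Store.write_of_ne _ (by simp), fr₂ 22 rfl,
            Store.write_of_ne _ (by simp), fr₁ 22 rfl, h22 r hr j hj]
        have e41 : s₃ 41 0 0 = ∑ θ ∈ range θ,
            decay T ^ (demand n T vt A j θ - if j ∈ A r then 1 else 0) := by
          rw [fr₃ 41 rfl, Store.write_of_ne _ (by simp), h₂]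
        have hidx : ⌊((demand n T vt A j θ : ℕ) : ℚ) - (if j ∈ A r then 1 else 0)⌋₊ =
            demand n T vt A j θ - if j ∈ A r then 1 else 0 := by
          split_ifs
          · exact_mod_cast Nat.floor_sub_natCast ((demand n T vt A j θ : ℕ) : ℚ) 1 |>.trans
              (by simp)
          · simp
        have e21 : s₃ 21 (demand n T vt A j θ - if j ∈ A r then 1 else 0) 0 =
            decay T ^ (demand n T vt A j θ - if j ∈ A r then 1 else 0) := by
          rw [fr₃ 21 rfl, Store.write_of_ne _ (by simp), fr₂ 21 rfl,
            Store.write_of_ne _ (by simp), fr₁ 21 rfl,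
            h21 _ ((Nat.sub_le _ _).trans (demand_le j θ))]
        refine Triple.set_eq (∑ θ ∈ range (θ + 1),
            decay T ^ (demand n T vt A j θ - if j ∈ A r then 1 else 0)) ?_
          (hbits _ (by have := hvt (r / T) j; omega) _
            fun θ => (Nat.sub_le _ _).trans (demand_le j θ)) (by simp)
        rw [sum_range_succ]
        simp only [Expr.eval_add, Expr.eval_cell, Expr.eval_const, Expr.eval_sub, Nat.cast_zero,
          Nat.floor_zero, e41, e40, e33, e31, Nat.floor_natCast, e22, hidx, e21]
    · intro s₂ h₂ fr₂
      have e31 : s₂ 31 0 0 = j := by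
        rw [fr₂ 31 rfl, Store.write_of_ne _ (by simp), hx₁]
      have e41 : s₂ 41 0 0 = gain n T vt A r j := h₂
      have h23 : ∀ l < j, s₂ 23 l 0 = profit n T vt A r l := by
        intro l hl
        rw [fr₂ 23 rfl, Store.write_of_ne _ (by simp), h₁ l hl]
      refine Triple.assign_eq j 0 (profit n T vt A r j) (by simp [e31]) (by simp) ?_
        (bitSize_nat_le hL ((profit_le A r j).trans ((hvt _ _).trans hNZ))) ?_
      · simp only [Expr.eval_floor, Expr.eval_cell, Expr.eval_const, Nat.cast_zero,
          Nat.floor_zero, e41, profit]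
        rw [← natCast_floor_eq_intCast_floor (gain_nonneg A r j)]
      · intro l hl
        rcases Nat.lt_succ_iff_lt_or_eq.1 hl with hl | rfl
        · simp [hl.ne, h23 l hl]
        · simp
  · intro s' h _; exact h

end Search

section SearchProg

variable {L Z : ℕ} {s s' : Store} {n m T N : ℕ} {vt : ℕ → ℕ → ℕ} {w : ℕ → ℕ → ℚ} {C : ℕ → ℚ}
  {A : ℕ → Finset ℕ}

/-- The data that the local search reads: the sizes, the parameters, the capacities and weights, the
rounded values and the powers of `decay T`. -/
structure SearchEnv (n m T N : ℕ) (vt : ℕ → ℕ → ℕ) (w : ℕ → ℕ → ℚ) (C : ℕ → ℚ) (s : Store) :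
    Prop where
  size_n : s 0 0 0 = n
  size_m : s 1 0 0 = m
  slots : s 10 0 0 = T
  levels : s 12 0 0 = N
  cap : ∀ i < n, s 2 i 0 = C i
  weight : ∀ i < n, ∀ j < m, s 3 i j = w i j
  value : ∀ i < n, ∀ j < m, s 20 i j = vt i j
  power : ∀ c ≤ n * T, s 21 c 0 = decay T ^ c

lemma SearchEnv.congr (h : SearchEnv n m T N vt w C s) (h0 : s' 0 = s 0) (h1 : s' 1 = s 1)
    (h10 : s' 10 = s 10) (h12 : s' 12 = s 12) (h2 : s' 2 = s 2) (h3 : s' 3 = s 3)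
    (h20 : s' 20 = s 20) (h21 : s' 21 = s 21) : SearchEnv n m T N vt w C s' where
  size_n := by rw [h0, h.size_n]
  size_m := by rw [h1, h.size_m]
  slots := by rw [h10, h.slots]
  levels := by rw [h12, h.levels]
  cap := by rw [h2]; exact h.cap
  weight := by rw [h3]; exact h.weight
  value := by rw [h20]; exact h.value
  power := by rw [h21]; exact h.power

/-- The array `22` holds the indicators of the rows of the state `A`. -/
def HoldsRows (n m T : ℕ) (A : ℕ → Finset ℕ) (s : Store) : Prop :=
  ∀ r < n * T, ∀ j < m, s 22 r j = if j ∈ A r then 1 else 0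

/-- The numbers that occur in the local search have at most `L` bits. -/
structure SearchBits (L n m T N : ℕ) (w : ℕ → ℕ → ℚ) (C : ℕ → ℚ) : Prop where
  sum : ∀ k ≤ N, ∀ e : ℕ → ℕ, (∀ θ, e θ ≤ n * T) →
    bitSize (∑ θ ∈ range k, decay T ^ e θ) ≤ L
  table : ∀ i < n, ∀ b, ∀ j ≤ m, ∀ q, bitSize (knapDP b (w i) (C i) j q) ≤ L
  table_sub : ∀ i < n, ∀ b, ∀ j < m, ∀ q, bitSize (knapDP b (w i) (C i) j q - w i j) ≤ L

/-- The program for `improve`, for the row in the variable `33`. -/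
def improveProg : Prog :=
  .seq (.set 45 (.floor (.div (.var 33) (.var 10)))) <| .seq profitProg <| .seq knapTableProg <|
  .seq knapSelectProg <| .seq (.set 44 (.nat 0)) <| .seq
    (.for 31 (.var 1)
      (.set 44 (.add (.var 44)
        (.mul (.cell 23 (.var 31) (.nat 0)) (.cell 22 (.var 33) (.var 31))))))
    (.ifLe (.add (.var 44) (.mul (.nat 2) (.var 1))) (.var 42)
      (.for 31 (.var 1) (.assign 22 (.var 33) (.var 31) (.cell 25 (.var 31) (.nat 0))))
      .skip)

lemma improveProg_spec {r : ℕ} (hL : Z < L) (hmZ : m ≤ Z) (hTZ : n * T ≤ Z)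
    (hZ : m * N + 1 ≤ Z) (hNZ : N ≤ Z) (hvt : ∀ i j, vt i j ≤ N)
    (hbits : SearchBits L n m T N w C) (hr : r < n * T) (henv : SearchEnv n m T N vt w C s)
    (hrow : s 33 0 0 = r) (hA : HoldsRows n m T A s) (hAm : A r ⊆ range m) :
    Triple L Z improveProg s (HoldsRows n m T (improve n m T vt N w C A r)) := by
  have hi : r / T < n := Nat.div_lt_of_lt_mul (by rwa [mul_comm])
  have hfloor : (⌊(r : ℚ) / T⌋ : ℚ) = (r / T : ℕ) := by
    rw [← natCast_floor_eq_intCast_floor (by positivity), floor_div_cast]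
  refine Triple.seq (Triple.set_eq (r / T : ℕ) (by simp [hrow, henv.slots, hfloor])
    (bitSize_nat_le hL ((Nat.div_le_self _ _).trans (by omega))) ?_)
  have env₁ : SearchEnv n m T N vt w C (s.write 45 0 0 (r / T : ℕ)) :=
    henv.congr (by simp) (by simp) (by simp) (by simp) (by simp) (by simp) (by simp) (by simp)
  have rows₁ : HoldsRows n m T A (s.write 45 0 0 (r / T : ℕ)) := by simpa [HoldsRows] using hA
  have bin₁ : (s.write 45 0 0 (r / T : ℕ)) 45 0 0 = (r / T : ℕ) := by simp
  have row₁ : (s.write 45 0 0 (r / T : ℕ)) 33 0 0 = r := by simpa using hrow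
  generalize s.write 45 0 0 (r / T : ℕ) = s₁ at env₁ rows₁ bin₁ row₁ ⊢
  refine Triple.seq ((profitProg_spec (A := A) hL hmZ hTZ hNZ hvt hr env₁.size_n env₁.size_m
    env₁.slots row₁ bin₁ env₁.value env₁.power rows₁ hbits.sum).mono' fun s₂ prof₂ fr => ?_)
  have env₂ := env₁.congr (fr 0 rfl) (fr 1 rfl) (fr 10 rfl) (fr 12 rfl) (fr 2 rfl) (fr 3 rfl)
    (fr 20 rfl) (fr 21 rfl)
  have rows₂ : HoldsRows n m T A s₂ := by unfold HoldsRows; rw [fr 22 rfl]; exact rows₁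
  have bin₂ : s₂ 45 0 0 = (r / T : ℕ) := by rw [fr 45 rfl, bin₁]
  have row₂ : s₂ 33 0 0 = r := by rw [fr 33 rfl, row₁]
  clear fr
  refine Triple.seq ((knapTableProg_spec (b := profit n T vt A r) hL hZ hmZ env₂.size_m
    env₂.levels bin₂ (env₂.cap _ hi) (env₂.weight _ hi) prof₂ (hbits.table _ hi _)
    (hbits.table_sub _ hi _)).mono' fun s₃ tab₃ fr => ?_)
  have env₃ := env₂.congr (fr 0 rfl) (fr 1 rfl) (fr 10 rfl) (fr 12 rfl) (fr 2 rfl) (fr 3 rfl)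
    (fr 20 rfl) (fr 21 rfl)
  have rows₃ : HoldsRows n m T A s₃ := by unfold HoldsRows; rw [fr 22 rfl]; exact rows₂
  have row₃ : s₃ 33 0 0 = r := by rw [fr 33 rfl, row₂]
  have prof₃ : ∀ j < m, s₃ 23 j 0 = profit n T vt A r j := by rw [fr 23 rfl]; exact prof₂
  clear fr
  refine Triple.seq ((knapSelectProg_spec (b := profit n T vt A r) hL hZ hmZ env₃.size_m
    env₃.levels prof₃ tab₃).mono' fun s₄ sel₄ fr => ?_)
  have env₄ := env₃.congr (fr 0 rfl) (fr 1 rfl) (fr 10 rfl) (fr 12 rfl) (fr 2 rfl) (fr 3 rfl)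
    (fr 20 rfl) (fr 21 rfl)
  have rows₄ : HoldsRows n m T A s₄ := by unfold HoldsRows; rw [fr 22 rfl]; exact rows₃
  have row₄ : s₄ 33 0 0 = r := by rw [fr 33 rfl, row₃]
  have prof₄ : ∀ j < m, s₄ 23 j 0 = profit n T vt A r j := by rw [fr 23 rfl]; exact prof₃
  clear fr
  have b0 : bitSize 0 ≤ L := by exact_mod_cast bitSize_nat_le hL (Nat.zero_le Z)
  refine Triple.seq (Triple.set_eq 0 (by simp) b0 ?_)
  have hsum : ∀ k ≤ m, ∑ j ∈ range k, (if j ∈ A r then profit n T vt A r j else 0) ≤ m * N := by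
    intro k hk
    calc ∑ j ∈ range k, (if j ∈ A r then profit n T vt A r j else 0)
        ≤ ∑ j ∈ range k, N := sum_le_sum fun j _ => by
          split_ifs
          · exact (profit_le A r j).trans (hvt _ _)
          · exact Nat.zero_le _
      _ ≤ m * N := by
          rw [sum_const, card_range, smul_eq_mul]
          exact Nat.mul_le_mul_right N hk
  refine Triple.seq (Triple.for m hmZ hL (fun k s' => s' 44 0 0 =
    ((∑ j ∈ range k, if j ∈ A r then profit n T vt A r j else 0 : ℕ) : ℚ)) ?_ rfl (by simp)
      ?_ ?_ ?_)
  · intro k s' y h; simpa using h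
  · intro k s' hk h hx fr
    simp [fr 1 rfl, env₄.size_m]
  · intro j s₅ hj h₅ hx₅ fr
    refine Triple.set_eq ((∑ j ∈ range (j + 1),
      if j ∈ A r then profit n T vt A r j else 0 : ℕ) : ℚ) ?_
      (bitSize_nat_le hL ((hsum _ hj).trans (by omega))) (by simp)
    rw [sum_range_succ]
    simp [h₅, hx₅, fr 23 rfl, fr 22 rfl, fr 33 rfl, prof₄ j hj, rows₄ r hr j hj, row₄]
  intro s₅ h₅ fr
  have env₅ := env₄.congr (s' := s₅) (by simp [fr 0 rfl]) (by simp [fr 1 rfl]) (by simp [fr 10 rfl])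
    (by simp [fr 12 rfl]) (by simp [fr 2 rfl]) (by simp [fr 3 rfl]) (by simp [fr 20 rfl])
    (by simp [fr 21 rfl])
  have rows₅ : HoldsRows n m T A s₅ := by simpa [HoldsRows, fr 22 rfl] using rows₄
  have row₅ : s₅ 33 0 0 = r := by simpa [fr 33 rfl] using row₄
  have h25 : s₅ 25 = s₄ 25 := by simp [fr 25 rfl]
  have h42 : s₅ 42 = s₄ 42 := by simp [fr 42 rfl]
  have hold : ∑ j ∈ range m, (if j ∈ A r then profit n T vt A r j else 0) =
      ∑ j ∈ A r, profit n T vt A r j := by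
    rw [← sum_filter, filter_mem_eq_inter, inter_eq_right.2 hAm]
  rw [hold] at h₅
  clear fr
  refine Triple.ifLe_eq ((∑ j ∈ A r, profit n T vt A r j + 2 * m : ℕ) : ℚ)
    (knapOpt (profit n T vt A r) (w (r / T)) (C (r / T)) m (m * N) : ℕ)
    (by simp [h₅, env₅.size_m]) (by simp [h42, sel₄.1]) (fun h0 => ?_) (fun h0 => ?_)
  · have h0 : ∑ j ∈ A r, profit n T vt A r j + 2 * m ≤
        knapOpt (profit n T vt A r) (w (r / T)) (C (r / T)) m (m * N) := by exact_mod_cast h0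
    have himp : improve n m T vt N w C A r =
        Function.update A r (bestResponse n m T vt N w C A r) := by
      rw [improve, if_pos h0]
    rw [himp]
    refine Triple.for m hmZ hL (fun k s' =>
      (∀ l < n * T, l ≠ r → ∀ j < m, s' 22 l j = if j ∈ A l then 1 else 0) ∧
      ∀ j < k, s' 22 r j = if j ∈ bestResponse n m T vt N w C A r then 1 else 0) ?_ rfl ?_ ?_ ?_ ?_
    · intro k s' y h; simpa using h
    · exact ⟨fun l hl _ => rows₅ l hl, by simp⟩
    · intro k s' hk h hx fr
      simp [fr 1 rfl, env₅.size_m]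
    · rintro j s₆ hj ⟨h₆, h₆'⟩ hx₆ fr
      refine Triple.assign_eq r j (if j ∈ bestResponse n m T vt N w C A r then 1 else 0)
        (by simp [fr 33 rfl, row₅]) (by simp [hx₆]) ?_ ?_ ?_
      · have e25 : s₆ 25 j 0 = if j ∈ bestResponse n m T vt N w C A r then 1 else 0 := by
          rw [fr 25 rfl, h25]; exact sel₄.2 j hj
        simp [hx₆, e25]
      · split_ifs
        · exact_mod_cast bitSize_nat_le hL (show 1 ≤ Z by omega)
        · exact b0
      · constructor
        · intro l hl hlr q hq
          simpa [hlr] using h₆ l hl hlr q hq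
        · intro q hq
          rcases Nat.lt_succ_iff_lt_or_eq.1 hq with hq | rfl
          · simpa [hq.ne] using h₆' q hq
          · simp
    · rintro s' ⟨h1, h2⟩ -
      intro l hl j hj
      rcases eq_or_ne l r with rfl | hlr
      · rw [Function.update_self]; exact h2 j hj
      · rw [Function.update_of_ne hlr]; exact h1 l hl hlr j hj
  · have himp : improve n m T vt N w C A r = A := by
      rw [improve, if_neg]
      exact fun h => absurd h0 (not_lt.2 (by exact_mod_cast h))
    rw [himp]
    exact Triple.skip rows₅

/-- The program for `search`. -/
def searchProg : Prog :=
  .for 35 (.add (.mul (.var 12) (.var 10)) (.nat 1))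
    (.for 33 (.mul (.var 0) (.var 10)) improveProg)

lemma searchProg_spec (hL : Z < L) (hmZ : m ≤ Z) (hTZ : n * T ≤ Z)
    (hZ : m * N + 1 ≤ Z) (hNZ : N ≤ Z) (hPZ : N * T + 1 ≤ Z) (hT : 0 < T)
    (hvt : ∀ i j, vt i j ≤ N) (hw : ∀ i j, 0 ≤ w i j) (hC : ∀ i, 0 ≤ C i)
    (hbits : SearchBits L n m T N w C) (henv : SearchEnv n m T N vt w C s)
    (h22 : ∀ r < n * T, ∀ j < m, s 22 r j = 0) :
    Triple L Z searchProg s (HoldsRows n m T (search n m T vt N w C (N * T + 1))) := by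
  refine Triple.for (N * T + 1) hPZ hL (fun k => HoldsRows n m T (search n m T vt N w C k))
    ?_ rfl ?_ ?_ ?_ ?_
  · intro k s' y h; simpa [HoldsRows] using h
  · intro r hr j hj; simp [search, h22 r hr j hj]
  · intro k s' hk h hx fr
    simp [fr 12 rfl, fr 10 rfl, henv.slots, henv.levels]
  · intro p s₁ hp h₁ hx₁ fr
    have env₁ := henv.congr (fr 0 rfl) (fr 1 rfl) (fr 10 rfl) (fr 12 rfl) (fr 2 rfl) (fr 3 rfl)
      (fr 20 rfl) (fr 21 rfl)
    clear fr
    refine Triple.for (n * T) hTZ hL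
      (fun k => HoldsRows n m T (pass n m T vt N w C (search n m T vt N w C p) k)) ?_ rfl h₁ ?_ ?_ ?_
    · intro k s' y h; simpa [HoldsRows] using h
    · intro k s' hk h hx fr
      simp [fr 0 rfl, fr 10 rfl, env₁.slots, env₁.size_n]
    · intro r s₂ hr h₂ hx₂ fr
      have env₂ := env₁.congr (fr 0 rfl) (fr 1 rfl) (fr 10 rfl) (fr 12 rfl) (fr 2 rfl) (fr 3 rfl)
        (fr 20 rfl) (fr 21 rfl)
      exact improveProg_spec hL hmZ hTZ hZ hNZ hvt hbits hr env₂ hx₂ h₂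
        ((pass_spec hT hvt hw hC (rowsFit_search hT hvt hw hC p) hr.le).1 r hr).1
    · intro s' h _; exact h
  · intro s' h _; exact h

end SearchProg

/-! ### The program: parameters, rounded values and powers -/

section SetupProg

variable {L Z : ℕ} {s s' : Store} {n m d : ℕ} {G : Instance n m} {v : Values n m} {Q : Store → Prop}

/-- The bound on the bits of the cells may be used to verify a program. -/
lemma Triple.of_bitsLe {p : Prog} (h : s.BitsLe L → Triple L Z p s Q) : Triple L Z p s Q :=
  fun hs => h hs hs

/-- The public data and the reported values as they are stored initially. -/
structure InputEnv (G : Instance n m) (v : Values n m) (s : Store) : Prop where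
  size_n : s 0 0 0 = n
  size_m : s 1 0 0 = m
  cap : ∀ i < n, s 2 i 0 = capAt G i
  weight : ∀ i < n, ∀ j < m, s 3 i j = weightAt G i j
  value : ∀ (i : Fin n) (j : Fin m), s 4 i j = v i j

lemma InputEnv.congr (h : InputEnv G v s) (h0 : s' 0 = s 0) (h1 : s' 1 = s 1)
    (h2 : s' 2 = s 2) (h3 : s' 3 = s 3) (h4 : s' 4 = s 4) : InputEnv G v s' where
  size_n := by rw [h0, h.size_n]
  size_m := by rw [h1, h.size_m]
  cap := by rw [h2]; exact h.cap
  weight := by rw [h3]; exact h.weight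
  value := by rw [h4]; exact h.value

/-- Computes `accuracy`, `slots`, `logSlots` and `levels` in the variables `14`, `10`, `11`, `12`. -/
def paramProg (d : ℕ) : Prog :=
  .seq (.set 14 (.mul (.nat 5) ((Expr.add (.var 0) (.var 1)).pow d))) <|
  .seq (.set 10 (.nat 1)) <| .seq (.set 11 (.nat 0)) <| .seq
    (.whileLe (.add (.var 10) (.nat 1)) (.var 14)
      (.seq (.set 10 (.mul (.nat 2) (.var 10))) (.set 11 (.add (.var 11) (.nat 1)))))
    (.set 12 (.mul (.mul (.mul (.nat 6) (.var 0)) (.var 1)) (.var 14)))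

lemma paramProg_spec (hL : Z < L) (hD : accuracy d n m ≤ Z) (hT : slots d n m ≤ Z)
    (hτ : logSlots d n m ≤ Z) (hN : levels d n m ≤ Z) (hn : s 0 0 0 = n) (hm : s 1 0 0 = m) :
    Triple L Z (paramProg d) s fun s' =>
      s' 10 0 0 = slots d n m ∧ s' 11 0 0 = logSlots d n m ∧ s' 12 0 0 = levels d n m := by
  have b0 : bitSize 0 ≤ L := by exact_mod_cast bitSize_nat_le hL (Nat.zero_le Z)
  have b1 : bitSize 1 ≤ L := by
    exact_mod_cast bitSize_nat_le hL (show 1 ≤ Z from (slots_pos (d := d)).trans_le hT)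
  refine Triple.seq (Triple.set_eq (accuracy d n m : ℕ) (by simp [hn, hm, accuracy])
    (bitSize_nat_le hL hD) ?_)
  refine Triple.seq (Triple.set_eq 1 (by simp) b1 ?_)
  refine Triple.seq (Triple.set_eq 0 (by simp) b0 ?_)
  refine Triple.seq (Triple.whileLe (logSlots d n m) hτ
    (fun k s' => s' 10 0 0 = (2 ^ k : ℕ) ∧ s' 11 0 0 = k ∧ s' 14 0 0 = accuracy d n m ∧
      s' 0 0 0 = n ∧ s' 1 0 0 = m) (by simp [hn, hm]) ?_ ?_ ?_ ?_)
  · rintro k s' hk ⟨h10, -, h14, -⟩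
    have := Nat.pow_lt_of_lt_clog hk
    simp only [Expr.eval_add, Expr.eval_cell, Expr.eval_const, Nat.cast_zero, Nat.floor_zero, h10,
      h14, Nat.cast_one]
    exact_mod_cast this
  · rintro s' ⟨h10, -, h14, -⟩
    have : accuracy d n m ≤ 2 ^ logSlots d n m := accuracy_le_slots
    simp only [Expr.eval_add, Expr.eval_cell, Expr.eval_const, Nat.cast_zero, Nat.floor_zero, h10,
      h14, Nat.cast_one]
    exact_mod_cast Nat.lt_succ_of_le this
  · rintro k s' hk ⟨h10, h11, h14, h0, h1⟩ -
    have hle : 2 ^ (k + 1) ≤ Z := (Nat.pow_le_pow_right (by norm_num) hk).trans hT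
    refine Triple.seq (Triple.set_eq (2 ^ (k + 1) : ℕ) (by simp [h10, pow_succ, mul_comm])
      (bitSize_nat_le hL hle) ?_)
    refine Triple.set_eq (k + 1 : ℕ) (by simp [h11]) (bitSize_nat_le hL (by omega)) ?_
    simp [h14, h0, h1]
  · rintro s' ⟨h10, h11, h14, h0, h1⟩ -
    refine Triple.set_eq (levels d n m : ℕ) (by simp [h0, h1, h14, levels]) (bitSize_nat_le hL hN) ?_
    simp [h10, h11, slots]

/-- Computes the rounded values in the array `20`, with the largest value in the variable `13`. -/
def valueProg : Prog :=
  .seq (.set 13 (.nat 0)) <| .seq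
    (.for 30 (.var 0) (.for 31 (.var 1)
      (.seq
        (.ifLe (.cell 3 (.var 30) (.var 31)) (.cell 2 (.var 30) (.nat 0))
          (.assign 20 (.var 30) (.var 31) (.cell 4 (.var 30) (.var 31)))
          (.assign 20 (.var 30) (.var 31) (.nat 0)))
        (.ifLe (.cell 20 (.var 30) (.var 31)) (.var 13) .skip
          (.set 13 (.cell 20 (.var 30) (.var 31)))))))
    (.for 30 (.var 0) (.for 31 (.var 1)
      (.assign 20 (.var 30) (.var 31)
        (.floor (.div (.mul (.var 12) (.cell 20 (.var 30) (.var 31))) (.var 13))))))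

/-- The maximum of `fitValue` over the bins before `i` and the items before `j` for bin `i`. -/
def partialMax (G : Instance n m) (v : Values n m) (i j : ℕ) : NNRat :=
  ((range i).sup fun k => (range m).sup fun l => fitValue G v k l) ⊔
    (range j).sup fun l => fitValue G v i l

lemma valueProg_spec (hL : Z < L) (hn : n ≤ Z) (hm : m ≤ Z) (hN : levels d n m ≤ Z)
    (henv : InputEnv G v s) (h12 : s 12 0 0 = levels d n m) :
    Triple L Z valueProg s fun s' => ∀ i < n, ∀ j < m, s' 20 i j = roundedValue d G v i j := by
  have b0 : bitSize 0 ≤ L := by exact_mod_cast bitSize_nat_le hL (Nat.zero_le Z)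
  refine Triple.seq (Triple.set_eq 0 (by simp) b0 ?_)
  have henv' : InputEnv G v (s.write 13 0 0 0) :=
    henv.congr (by simp) (by simp) (by simp) (by simp) (by simp)
  have h12' : (s.write 13 0 0 0) 12 0 0 = levels d n m := by simpa using h12
  have h13 : (s.write 13 0 0 0) 13 0 0 = 0 := by simp
  generalize s.write 13 0 0 0 = s₁ at henv' h12' h13 ⊢
  refine Triple.seq (Triple.for n hn hL
    (fun i s' => s' 13 0 0 = (partialMax G v i 0 : NNRat) ∧
      ∀ k < i, ∀ l < m, s' 20 k l = (fitValue G v k l : NNRat)) ?_ rfl ?_ ?_ ?_ ?_)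
  · intro k s' y h; simpa using h
  · refine ⟨?_, by simp⟩
    rw [h13]; simp [partialMax]
  · intro k s' hk h hx fr
    simp [fr 0 rfl, henv'.size_n]
  · rintro i s₂ hi ⟨h₂, h₂'⟩ hx₂ fr
    have env₂ := henv'.congr (fr 0 rfl) (fr 1 rfl) (fr 2 rfl) (fr 3 rfl) (fr 4 rfl)
    clear fr
    refine Triple.for m hm hL
      (fun j s' => s' 13 0 0 = (partialMax G v i j : NNRat) ∧
        (∀ k < i, ∀ l < m, s' 20 k l = (fitValue G v k l : NNRat)) ∧
        ∀ l < j, s' 20 i l = (fitValue G v i l : NNRat)) ?_ rfl ⟨h₂, h₂', by simp⟩ ?_ ?_ ?_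
    · intro k s' y h; simpa using h
    · intro k s' hk h hx fr
      simp [fr 1 rfl, env₂.size_m]
    · rintro j s₃ hj ⟨h₃, h₃', h₃''⟩ hx₃ fr
      have env₃ := env₂.congr (fr 0 rfl) (fr 1 rfl) (fr 2 rfl) (fr 3 rfl) (fr 4 rfl)
      have h30 : s₃ 30 0 0 = i := by rw [fr 30 rfl, hx₂]
      clear fr
      have hmax : partialMax G v i (j + 1) = partialMax G v i j ⊔ fitValue G v i j := by
        rw [partialMax, partialMax, range_add_one, sup_insert, sup_assoc,
          sup_comm (fitValue G v i j)]
      have key : bitSize (fitValue G v i j : ℚ) ≤ L → Triple L Z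
          (.ifLe (.cell 20 (.var 30) (.var 31)) (.var 13) .skip
            (.set 13 (.cell 20 (.var 30) (.var 31)))) (s₃.write 20 i j (fitValue G v i j : ℚ))
          (fun s' => s' 13 0 0 = (partialMax G v i (j + 1) : NNRat) ∧
            (∀ k < i, ∀ l < m, s' 20 k l = (fitValue G v k l : NNRat)) ∧
            ∀ l < j + 1, s' 20 i l = (fitValue G v i l : NNRat)) := by
        intro hb
        have hrest : (∀ k < i, ∀ l < m, (s₃.write 20 i j (fitValue G v i j : ℚ)) 20 k l =
              (fitValue G v k l : NNRat)) ∧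
            ∀ l < j + 1, (s₃.write 20 i j (fitValue G v i j : ℚ)) 20 i l =
              (fitValue G v i l : NNRat) := by
          constructor
          · intro k hk l hl
            simp [hk.ne, h₃' k hk l hl]
          · intro l hl
            rcases Nat.lt_succ_iff_lt_or_eq.1 hl with hl | rfl
            · simp [hl.ne, h₃'' l hl]
            · simp
        refine Triple.ifLe_eq (fitValue G v i j : ℚ) (partialMax G v i j : ℚ)
          (by simp [h30, hx₃]) (by simp [h₃]) (fun h0 => ?_) (fun h0 => ?_)
        · have h0 : fitValue G v i j ≤ partialMax G v i j := by exact_mod_cast h0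
          refine Triple.skip ⟨?_, hrest⟩
          rw [hmax, sup_of_le_left h0]
          simpa using h₃
        · have h0 : partialMax G v i j < fitValue G v i j := by exact_mod_cast h0
          refine Triple.set_eq (fitValue G v i j : ℚ) (by simp [h30, hx₃]) hb ⟨?_, ?_⟩
          · rw [hmax, sup_of_le_right h0.le]
            simp
          · simpa using hrest
      refine Triple.of_bitsLe fun hs => ?_
      have hw := env₃.weight i hi j hj
      have hc := env₃.cap i hi
      have hv := env₃.value ⟨i, hi⟩ ⟨j, hj⟩
      refine Triple.seq (Triple.ifLe_eq (weightAt G i j) (capAt G i) (by simp [h30, hx₃, hw])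
        (by simp [h30, hc]) (fun h0 => ?_) (fun h0 => ?_))
      · have hfit : fitValue G v i j = v ⟨i, hi⟩ ⟨j, hj⟩ := by
          refine fitValue_of_fits (i := ⟨i, hi⟩) (j := ⟨j, hj⟩) ?_
          rw [weightAt, dif_pos ⟨hi, hj⟩, capAt, dif_pos hi] at h0
          exact_mod_cast h0
        have e : s₃ 4 i j = fitValue G v i j := by rw [hfit]; exact hv
        have hb : bitSize (fitValue G v i j : ℚ) ≤ L := by rw [← e]; exact hs _ _ _
        exact Triple.assign_eq i j (fitValue G v i j : ℚ) (by simp [h30]) (by simp [hx₃])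
          (by simp [h30, hx₃, e]) hb (key hb)
      · have hfit : fitValue G v i j = 0 := by
          rw [weightAt, dif_pos ⟨hi, hj⟩, capAt, dif_pos hi] at h0
          rw [fitValue, dif_pos ⟨hi, hj⟩, if_neg]
          exact fun h => absurd h0 (not_lt.2 (by exact_mod_cast h))
        have hb : bitSize (fitValue G v i j : ℚ) ≤ L := by rw [hfit]; simpa using b0
        exact Triple.assign_eq i j (fitValue G v i j : ℚ) (by simp [h30]) (by simp [hx₃])
          (by simp [hfit]) hb (key hb)
    · rintro s' ⟨h, h', h''⟩ -
      refine ⟨?_, ?_⟩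
      · rw [h, partialMax, partialMax, range_add_one, sup_insert]
        simp [sup_comm]
      · intro k hk l hl
        rcases Nat.lt_succ_iff_lt_or_eq.1 hk with hk | rfl
        · exact h' k hk l hl
        · exact h'' l hl
  rintro s₂ ⟨h₂, h₂'⟩ fr
  have env₂ := henv'.congr (fr 0 rfl) (fr 1 rfl) (fr 2 rfl) (fr 3 rfl) (fr 4 rfl)
  have e12 : s₂ 12 0 0 = levels d n m := by rw [fr 12 rfl, h12']
  clear fr
  have e13 : s₂ 13 0 0 = (maxValue G v : NNRat) := by rw [h₂]; simp [partialMax, maxValue]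
  refine Triple.for n hn hL
    (fun i s' => (∀ k < i, ∀ l < m, s' 20 k l = roundedValue d G v k l) ∧
      ∀ k < n, i ≤ k → ∀ l < m, s' 20 k l = (fitValue G v k l : NNRat)) ?_ rfl ?_ ?_ ?_ ?_
  · intro k s' y h; simpa using h
  · exact ⟨by simp, fun k hk _ => h₂' k hk⟩
  · intro k s' hk h hx fr
    simp [fr 0 rfl, env₂.size_n]
  · rintro i s₃ hi ⟨h₃, h₃'⟩ hx₃ fr₃
    refine Triple.for m hm hL
      (fun j s' => (∀ k < i, ∀ l < m, s' 20 k l = roundedValue d G v k l) ∧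
        (∀ k < n, i < k → ∀ l < m, s' 20 k l = (fitValue G v k l : NNRat)) ∧
        (∀ l < j, s' 20 i l = roundedValue d G v i l) ∧
        ∀ l < m, j ≤ l → s' 20 i l = (fitValue G v i l : NNRat)) ?_ rfl ?_ ?_ ?_ ?_
    · intro k s' y h; simpa using h
    · exact ⟨h₃, fun k hk hik => h₃' k hk hik.le, by simp, fun l hl _ => h₃' i hi le_rfl l hl⟩
    · intro k s' hk h hx fr
      simp [fr 1 rfl, fr₃ 1 rfl, env₂.size_m]
    · rintro j s₄ hj ⟨h1, h2, h3, h4⟩ hx₄ fr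
      have h30 : s₄ 30 0 0 = i := by rw [fr 30 rfl, hx₃]
      have g12 : s₄ 12 0 0 = levels d n m := by rw [fr 12 rfl, fr₃ 12 rfl, e12]
      have g13 : s₄ 13 0 0 = (maxValue G v : NNRat) := by rw [fr 13 rfl, fr₃ 13 rfl, e13]
      have g20 := h4 j hj le_rfl
      refine Triple.assign_eq i j (roundedValue d G v i j : ℚ) (by simp [h30]) (by simp [hx₄]) ?_
        (bitSize_nat_le hL ((roundedValue_le i j).trans hN)) ⟨?_, ?_, ?_, ?_⟩
      · simp only [Expr.eval_floor, Expr.eval_div, Expr.eval_mul, Expr.eval_cell, Expr.eval_const,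
          Nat.cast_zero, Nat.floor_zero, h30, hx₄, Nat.floor_natCast, g12, g13, g20]
        exact (natCast_floor_eq_intCast_floor (by positivity)).symm
      · intro k hk l hl; simp [hk.ne, h1 k hk l hl]
      · intro k hk hik l hl; simp [hik.ne', h2 k hk hik l hl]
      · intro l hl
        rcases Nat.lt_succ_iff_lt_or_eq.1 hl with hl | rfl
        · simp [hl.ne, h3 l hl]
        · simp
      · intro l hl hjl
        simp [show l ≠ j by omega, h4 l hl (by omega)]
    · rintro s' ⟨h1, h2, h3, h4⟩ -
      refine ⟨fun k hk => ?_, fun k hk hik => h2 k hk hik⟩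
      rcases Nat.lt_succ_iff_lt_or_eq.1 hk with hk | rfl
      · exact h1 k hk
      · exact h3
  · rintro s' ⟨h, -⟩ -
    exact h

/-- Computes the powers of `decay` in the array `21`. -/
def powerProg : Prog :=
  .seq (.assign 21 (.nat 0) (.nat 0) (.nat 1)) <|
    .for 30 (.mul (.var 0) (.var 10))
      (.assign 21 (.add (.var 30) (.nat 1)) (.nat 0)
        (.mul (.cell 21 (.var 30) (.nat 0)) (.sub (.nat 1) (.div (.nat 1) (.var 10)))))

lemma powerProg_spec {T : ℕ} (hL : Z < L) (hT : n * T ≤ Z) (hn : s 0 0 0 = n) (h10 : s 10 0 0 = T)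
    (hb : ∀ c ≤ n * T, bitSize (decay T ^ c) ≤ L) :
    Triple L Z powerProg s fun s' => ∀ c ≤ n * T, s' 21 c 0 = decay T ^ c := by
  refine Triple.seq (Triple.assign_eq 0 0 1 (by simp) (by simp) (by simp)
    (by simpa using hb 0 (Nat.zero_le _)) ?_)
  have hn' : (s.write 21 0 0 1) 0 0 0 = n := by simpa using hn
  have h10' : (s.write 21 0 0 1) 10 0 0 = T := by simpa using h10
  have h21 : (s.write 21 0 0 1) 21 0 0 = 1 := by simp
  generalize s.write 21 0 0 1 = s₁ at hn' h10' h21 ⊢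
  refine Triple.for (n * T) hT hL (fun k s' => ∀ c ≤ k, s' 21 c 0 = decay T ^ c) ?_ rfl ?_ ?_ ?_ ?_
  · intro k s' y h; simpa using h
  · intro c hc
    obtain rfl : c = 0 := by omega
    simpa using h21
  · intro k s' hk h hx fr
    simp [fr 0 rfl, fr 10 rfl, hn', h10']
  · intro k s₂ hk h hx fr
    refine Triple.assign_eq (k + 1) 0 (decay T ^ (k + 1)) (by simp [hx]) (by simp) ?_
      (hb _ hk) ?_
    · simp [hx, h k le_rfl, fr 10 rfl, h10', pow_succ, decay]
    · intro c hc
      rcases Nat.lt_succ_iff_lt_or_eq.1 (Nat.lt_succ_of_le hc) with hc | rfl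
      · simp [hc.ne, h c (by omega)]
      · simp
  · intro s' h _; exact h

/-- The program for `finalState`. -/
def relaxProg (d : ℕ) : Prog :=
  .seq (paramProg d) <| .seq valueProg <| .seq powerProg searchProg

/-- What is known after the local search. -/
structure RelaxEnv (d : ℕ) (G : Instance n m) (v : Values n m) (s : Store) : Prop where
  search : SearchEnv n m (slots d n m) (levels d n m) (roundedValue d G v) (weightAt G) (capAt G) s
  logSlots : s 11 0 0 = logSlots d n m
  rows : HoldsRows n m (slots d n m) (finalState d G v) s

lemma relaxProg_spec (hL : Z < L) (hD : accuracy d n m ≤ Z) (hT : slots d n m ≤ Z)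
    (hτ : logSlots d n m ≤ Z) (hN : levels d n m ≤ Z) (hn : n ≤ Z) (hm : m ≤ Z)
    (hnT : n * slots d n m ≤ Z) (hmN : m * levels d n m + 1 ≤ Z)
    (hNT : levels d n m * slots d n m + 1 ≤ Z)
    (hb : ∀ c ≤ n * slots d n m, bitSize (decay (slots d n m) ^ c) ≤ L)
    (hbits : SearchBits L n m (slots d n m) (levels d n m) (weightAt G) (capAt G))
    (henv : InputEnv G v s)
    (h22 : ∀ r < n * slots d n m, ∀ j < m, s 22 r j = 0) :
    Triple L Z (relaxProg d) s (RelaxEnv d G v) := by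
  refine Triple.seq ((paramProg_spec (d := d) hL hD hT hτ hN henv.size_n henv.size_m).mono' ?_)
  rintro s₁ ⟨h10, h11, h12⟩ fr₁
  have env₁ := henv.congr (fr₁ 0 rfl) (fr₁ 1 rfl) (fr₁ 2 rfl) (fr₁ 3 rfl) (fr₁ 4 rfl)
  refine Triple.seq ((valueProg_spec hL hn hm hN env₁ h12).mono' ?_)
  intro s₂ h20 fr₂
  have env₂ := env₁.congr (fr₂ 0 rfl) (fr₂ 1 rfl) (fr₂ 2 rfl) (fr₂ 3 rfl) (fr₂ 4 rfl)
  have h10' : s₂ 10 0 0 = slots d n m := by rw [fr₂ 10 rfl, h10]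
  refine Triple.seq ((powerProg_spec hL hnT env₂.size_n h10' hb).mono' ?_)
  intro s₃ h21 fr₃
  have env₃ := env₂.congr (fr₃ 0 rfl) (fr₃ 1 rfl) (fr₃ 2 rfl) (fr₃ 3 rfl) (fr₃ 4 rfl)
  have senv : SearchEnv n m (slots d n m) (levels d n m) (roundedValue d G v) (weightAt G)
      (capAt G) s₃ :=
    { size_n := env₃.size_n
      size_m := env₃.size_m
      slots := by rw [fr₃ 10 rfl, h10']
      levels := by rw [fr₃ 12 rfl, fr₂ 12 rfl, h12]
      cap := env₃.cap
      weight := env₃.weight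
      value := by rw [fr₃ 20 rfl]; exact h20
      power := h21 }
  refine (searchProg_spec hL hm hnT hmN hN hNT slots_pos roundedValue_le weightAt_nonneg
    capAt_nonneg hbits senv ?_).mono' ?_
  · intro r hr j hj
    rw [fr₃ 22 rfl, fr₂ 22 rfl, fr₁ 22 rfl, h22 r hr j hj]
  · intro s₄ h fr
    refine ⟨senv.congr (fr 0 rfl) (fr 1 rfl) (fr 10 rfl) (fr 12 rfl) (fr 2 rfl) (fr 3 rfl)
      (fr 20 rfl) (fr 21 rfl), ?_, h⟩
    rw [fr 11 rfl, fr₃ 11 rfl, fr₂ 11 rfl, h11]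

end SetupProg

/-! ### The program: rounding and payments -/

section OutputProg

variable {L Z : ℕ} {s s' : Store} {n m d : ℕ} {G : Instance n m} {v : Values n m}

lemma floor_two_mul_cast (i : ℕ) : ⌊(2 : ℚ) * i⌋₊ = 2 * i := by
  exact_mod_cast Nat.floor_natCast (R := ℚ) (2 * i)

lemma floor_two_mul_add_one_cast (i : ℕ) : ⌊(2 : ℚ) * i + 1⌋₊ = 2 * i + 1 := by
  exact_mod_cast Nat.floor_natCast (R := ℚ) (2 * i + 1)

/-- Computes the numbers drawn from the coins in the array `26`. -/
def drawProg : Prog :=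
  .for 30 (.mul (.nat 2) (.var 0)) <|
    .seq (.set 41 (.nat 0)) <| .seq (.set 40 (.nat 1)) <| .seq
      (.for 31 (.var 11)
        (.seq (.set 41 (.add (.var 41) (.mul (.var 40)
            (.cell 5 (.add (.mul (.var 30) (.var 11)) (.var 31)) (.nat 0)))))
          (.set 40 (.mul (.nat 2) (.var 40)))))
      (.assign 26 (.var 30) (.nat 0) (.var 41))

lemma drawProg_spec {τ : ℕ} {c : ℕ → ℕ} (hL : Z < L) (hnZ : 2 * n ≤ Z) (hτ : τ ≤ Z)
    (hT : 2 ^ τ ≤ Z) (hc : ∀ l, c l ≤ 1) (hn : s 0 0 0 = n) (h11 : s 11 0 0 = τ)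
    (h5 : ∀ l, s 5 l 0 = c l) :
    Triple L Z drawProg s fun s' => ∀ x < 2 * n, s' 26 x 0 = draw τ c x := by
  have b0 : bitSize 0 ≤ L := by exact_mod_cast bitSize_nat_le hL (Nat.zero_le Z)
  have b1 : bitSize 1 ≤ L := by
    exact_mod_cast bitSize_nat_le hL (show 1 ≤ Z from (Nat.two_pow_pos τ).trans_le hT)
  refine Triple.for (2 * n) hnZ hL (fun k s' => ∀ x < k, s' 26 x 0 = draw τ c x) ?_ rfl ?_ ?_ ?_ ?_
  · intro k s' y h; simpa using h
  · simp
  · intro k s' hk h hx fr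
    simp [fr 0 rfl, hn]
  · intro x s₁ hx h₁ hx₁ fr₁
    have e11 : s₁ 11 0 0 = τ := by rw [fr₁ 11 rfl, h11]
    have e5 : ∀ l, s₁ 5 l 0 = c l := by rw [fr₁ 5 rfl]; exact h5
    clear fr₁
    refine Triple.seq (Triple.set_eq 0 (by simp) b0 ?_)
    refine Triple.seq (Triple.set_eq 1 (by simp) b1 ?_)
    refine Triple.seq (Triple.for τ hτ hL
      (fun l s' => s' 41 0 0 = (∑ q ∈ range l, 2 ^ q * c (x * τ + q) : ℕ) ∧
        s' 40 0 0 = (2 ^ l : ℕ)) ?_ rfl ?_ ?_ ?_ ?_)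
    · intro k s' y h; simpa using h
    · simp
    · intro l s' hl h hx fr
      simp [fr 11 rfl, e11]
    · rintro l s₂ hl ⟨h41, h40⟩ hx₂ fr₂
      have e30 : s₂ 30 0 0 = x := by simp [fr₂ 30 rfl, hx₁]
      have g11 : s₂ 11 0 0 = τ := by simp [fr₂ 11 rfl, e11]
      have g5 : ∀ l, s₂ 5 l 0 = c l := by simpa [fr₂ 5 rfl] using e5
      have hle : 2 ^ (l + 1) ≤ Z := (Nat.pow_le_pow_right (by norm_num) hl).trans hT
      have hsum := sum_two_pow_lt (fun q => c (x * τ + q)) (fun _ => hc _) (l + 1)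
      refine Triple.seq (Triple.set_eq
        ((∑ q ∈ range (l + 1), 2 ^ q * c (x * τ + q) : ℕ) : ℚ) ?_
        (bitSize_nat_le hL (hsum.le.trans hle)) ?_)
      · simp [h41, h40, e30, g11, g5, hx₂, sum_range_succ]
      · refine Triple.set_eq (2 ^ (l + 1) : ℕ) ?_ (bitSize_nat_le hL hle) ?_
        · simp [h40, pow_succ, mul_comm]
        · simp
    · rintro s₂ ⟨h41, -⟩ fr₂
      have e30 : s₂ 30 0 0 = x := by simp [fr₂ 30 rfl, hx₁]
      have e26 : s₂ 26 = s₁ 26 := by simp [fr₂ 26 rfl]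
      refine Triple.assign_eq x 0 (draw τ c x : ℕ) (by simp [e30]) (by simp) (by simp [h41, draw])
        (bitSize_nat_le hL ((draw_lt hc x).le.trans hT)) ?_
      intro y hy
      rcases Nat.lt_succ_iff_lt_or_eq.1 hy with hy | rfl
      · simp [hy.ne, e26, h₁ y hy]
      · simp
  · intro s' h _; exact h

/-- Finds the owner of the item in the variable `31`; the result is in the variable `47`. -/
def ownerProg : Prog :=
  .seq (.set 47 (.nat 0)) <| .seq (.set 48 (.nat 0)) <|
    .for 30 (.var 0) <| .seq (.set 41 (.nat 0)) <| .seq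
      (.for 32 (.var 10) (.set 41 (.add (.var 41)
        (.cell 22 (.add (.mul (.var 30) (.var 10)) (.var 32)) (.var 31))))) <|
      .ifLe (.nat 1) (.cell 22 (.add (.mul (.var 30) (.var 10))
          (.cell 26 (.mul (.nat 2) (.var 30)) (.nat 0))) (.var 31))
        (.ifLe (.mul (.mul (.var 10) (.var 10)) (.sub (.nat 1) (.cell 21 (.var 41) (.nat 0))))
          (.mul (.cell 26 (.add (.mul (.nat 2) (.var 30)) (.nat 1)) (.nat 0)) (.var 41))
          .skip
          (.ifLe (.cell 20 (.var 30) (.var 31)) (.var 48) .skip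
            (.seq (.set 48 (.cell 20 (.var 30) (.var 31)))
              (.set 47 (.add (.var 30) (.nat 1))))))
        .skip

lemma ownerProg_spec {T N : ℕ} {vt : ℕ → ℕ → ℕ} {w : ℕ → ℕ → ℚ} {C : ℕ → ℚ} {A : ℕ → Finset ℕ}
    {z : ℕ → ℕ} {j : ℕ} (hL : Z < L) (hnZ : n ≤ Z) (hTZ : T ≤ Z) (hNZ : N ≤ Z)
    (hvt : ∀ i j, vt i j ≤ N) (henv : SearchEnv n m T N vt w C s) (hA : HoldsRows n m T A s)
    (h26 : ∀ x < 2 * n, s 26 x 0 = z x) (hz : ∀ x, z x < T) (hj : j < m) (h31 : s 31 0 0 = j) :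
    Triple L Z ownerProg s fun s' =>
      s' 47 0 0 = topIdx (fun i => Claims T A i j (z (2 * i)) (z (2 * i + 1)))
        (fun i => vt i j) n := by
  have b0 : bitSize 0 ≤ L := by exact_mod_cast bitSize_nat_le hL (Nat.zero_le Z)
  set cl : ℕ → Prop := fun i => Claims T A i j (z (2 * i)) (z (2 * i + 1)) with hcl
  refine Triple.seq (Triple.set_eq 0 (by simp) b0 ?_)
  refine Triple.seq (Triple.set_eq 0 (by simp) b0 ?_)
  refine Triple.for n hnZ hL (fun k s' =>
    s' 47 0 0 = topIdx cl (fun i => vt i j) k ∧ s' 48 0 0 = topVal cl (fun i => vt i j) k)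
    ?_ rfl ?_ ?_ ?_ ?_
  · intro k s' y h; simpa using h
  · simp [topIdx, topVal]
  · intro k s' hk h hx fr
    simp [fr 0 rfl, henv.size_n]
  · rintro i s₁ hi ⟨h47, h48⟩ hx₁ fr
    have env₁ := henv.congr (s' := s₁) (by simp [fr 0 rfl]) (by simp [fr 1 rfl])
      (by simp [fr 10 rfl]) (by simp [fr 12 rfl]) (by simp [fr 2 rfl]) (by simp [fr 3 rfl])
      (by simp [fr 20 rfl]) (by simp [fr 21 rfl])
    have hA₁ : HoldsRows n m T A s₁ := by simpa [HoldsRows, fr 22 rfl] using hA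
    have e26 : ∀ x < 2 * n, s₁ 26 x 0 = z x := by simpa [fr 26 rfl] using h26
    have e31 : s₁ 31 0 0 = j := by simpa [fr 31 rfl] using h31
    clear fr
    refine Triple.seq (Triple.set_eq 0 (by simp) b0 ?_)
    refine Triple.seq (Triple.for T hTZ hL (fun k s' =>
      s' 41 0 0 = (∑ t ∈ range k, if j ∈ A (i * T + t) then 1 else 0 : ℕ)) ?_ rfl ?_ ?_ ?_ ?_)
    · intro k s' y h; simpa using h
    · simp
    · intro k s' hk h hx fr
      simp [fr 10 rfl, env₁.slots]
    · intro t s₂ ht h₂ hx₂ fr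
      have g22 : s₂ 22 (i * T + t) j = if j ∈ A (i * T + t) then 1 else 0 := by
        simpa [fr 22 rfl] using hA₁ _ (row_lt hi ht) j hj
      have g30 : s₂ 30 0 0 = i := by simp [fr 30 rfl, hx₁]
      have g31 : s₂ 31 0 0 = j := by simp [fr 31 rfl, e31]
      have g10 : s₂ 10 0 0 = T := by simp [fr 10 rfl, env₁.slots]
      have hle : (∑ t ∈ range (t + 1), if j ∈ A (i * T + t) then 1 else 0) ≤ t + 1 := by
        refine (sum_le_card_nsmul _ _ 1 fun _ _ => by split_ifs <;> simp).trans ?_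
        simp
      refine Triple.set_eq _ ?_ (bitSize_nat_le hL (hle.trans (by omega)))
        (Store.write_self _ _ _ _ _ _ _)
      rw [sum_range_succ]
      simp [h₂, g30, g31, g10, hx₂, g22]
    intro s₂ h₂ fr
    have env₂ := env₁.congr (s' := s₂) (by simp [fr 0 rfl]) (by simp [fr 1 rfl])
      (by simp [fr 10 rfl]) (by simp [fr 12 rfl]) (by simp [fr 2 rfl]) (by simp [fr 3 rfl])
      (by simp [fr 20 rfl]) (by simp [fr 21 rfl])
    have g26 : s₂ 26 = s₁ 26 := by simp [fr 26 rfl]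
    have g22 : s₂ 22 = s₁ 22 := by simp [fr 22 rfl]
    have g30 : s₂ 30 0 0 = i := by simp [fr 30 rfl, hx₁]
    have g31 : s₂ 31 0 0 = j := by simp [fr 31 rfl, e31]
    have g47 : s₂ 47 0 0 = topIdx cl (fun i => vt i j) i := by simp [fr 47 rfl, h47]
    have g48 : s₂ 48 0 0 = topVal cl (fun i => vt i j) i := by simp [fr 48 rfl, h48]
    clear fr
    change s₂ 41 0 0 = (rowCount T A i j : ℕ) at h₂
    have hcount : rowCount T A i j ≤ T := by
      refine (sum_le_card_nsmul _ _ 1 fun _ _ => by split_ifs <;> simp).trans ?_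
      simp
    have hle : rowCount T A i j ≤ n * T := hcount.trans (Nat.le_mul_of_pos_left T (by omega))
    have hrow : s₂ 22 (i * T + z (2 * i)) j = if j ∈ A (i * T + z (2 * i)) then 1 else 0 := by
      rw [g22]; exact hA₁ _ (row_lt hi (hz _)) j hj
    have hz0 : s₂ 26 (2 * i) 0 = z (2 * i) := by rw [g26]; exact e26 _ (by omega)
    have hz1 : s₂ 26 (2 * i + 1) 0 = z (2 * i + 1) := by rw [g26]; exact e26 _ (by omega)
    have keep : ¬ (cl i ∧ topVal cl (fun i => vt i j) i < vt i j) →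
        s₂ 47 0 0 = topIdx cl (fun i => vt i j) (i + 1) ∧
        s₂ 48 0 0 = topVal cl (fun i => vt i j) (i + 1) := by
      intro h
      rw [topIdx, topVal, if_neg h, if_neg h]
      exact ⟨g47, g48⟩
    refine Triple.ifLe_eq 1 (if j ∈ A (i * T + z (2 * i)) then 1 else 0) (by simp)
      (by simp [g30, g31, env₂.slots, floor_two_mul_cast, hz0, hrow]) (fun h1 => ?_) (fun h1 => ?_)
    · have hmem : j ∈ A (i * T + z (2 * i)) := by
        by_contra h
        rw [if_neg h] at h1
        norm_num at h1
      refine Triple.ifLe_eq (T * T * (1 - decay T ^ rowCount T A i j))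
        ((z (2 * i + 1) : ℚ) * rowCount T A i j)
        (by simp [env₂.slots, h₂, env₂.power _ hle])
        (by simp [g30, floor_two_mul_add_one_cast, hz1, h₂]) (fun h2 => ?_) (fun h2 => ?_)
      · exact Triple.skip (keep fun h => absurd h.1.2 (not_lt.2 h2))
      · have hci : cl i := ⟨hmem, h2⟩
        refine Triple.ifLe_eq (vt i j : ℚ) (topVal cl (fun i => vt i j) i : ℚ)
          (by simp [g30, g31, env₂.value i hi j hj]) (by simp [g48]) (fun h3 => ?_) (fun h3 => ?_)
        · have h3 : vt i j ≤ topVal cl (fun i => vt i j) i := by exact_mod_cast h3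
          exact Triple.skip (keep fun h => absurd h.2 (not_lt.2 h3))
        · have h3 : topVal cl (fun i => vt i j) i < vt i j := by exact_mod_cast h3
          refine Triple.seq (Triple.set_eq (vt i j : ℚ)
            (by simp [g30, g31, env₂.value i hi j hj])
            (bitSize_nat_le hL ((hvt i j).trans hNZ)) ?_)
          refine Triple.set_eq (i + 1 : ℕ) (by simp [g30]) (bitSize_nat_le hL (by omega)) ?_
          rw [topIdx, topVal, if_pos ⟨hci, h3⟩, if_pos ⟨hci, h3⟩]
          simp
    · have hmem : ¬ j ∈ A (i * T + z (2 * i)) := by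
        intro h
        rw [if_pos h] at h1
        norm_num at h1
      exact Triple.skip (keep fun h => hmem h.1.1)
  · rintro s' ⟨h, -⟩ _; exact h

/-- Writes the allocation into the array `6`. -/
def assignProg : Prog :=
  .for 31 (.var 1) <| .seq ownerProg <|
    .ifLe (.nat 1) (.var 47) (.assign 6 (.sub (.var 47) (.nat 1)) (.var 31) (.nat 1)) .skip

lemma assignProg_spec {c : ℕ → ℕ} (hL : Z < L) (hnZ : n ≤ Z) (hmZ : m ≤ Z)
    (hTZ : slots d n m ≤ Z) (hNZ : levels d n m ≤ Z) (hc : ∀ l, c l ≤ 1)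
    (henv : RelaxEnv d G v s) (h26 : ∀ x < 2 * n, s 26 x 0 = draw (logSlots d n m) c x)
    (h6 : ∀ i < n, ∀ j < m, s 6 i j = 0) :
    Triple L Z assignProg s fun s' =>
      ∀ i < n, ∀ j < m, s' 6 i j = if owner d G v c j = i + 1 then 1 else 0 := by
  have b1 : bitSize 1 ≤ L := by exact_mod_cast bitSize_nat_le hL (slots_pos.trans_le hTZ)
  refine Triple.for m hmZ hL (fun k s' =>
    (∀ i < n, ∀ j < k, s' 6 i j = if owner d G v c j = i + 1 then 1 else 0) ∧
    ∀ i < n, ∀ j < m, k ≤ j → s' 6 i j = 0) ?_ rfl ?_ ?_ ?_ ?_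
  · intro k s' y h; simpa using h
  · exact ⟨by simp, fun i hi j hj _ => h6 i hi j hj⟩
  · intro k s' hk h hx fr
    simp [fr 1 rfl, henv.search.size_m]
  · rintro j s₁ hj ⟨h₁, h₁'⟩ hx₁ fr
    have env₁ := henv.search.congr (fr 0 rfl) (fr 1 rfl) (fr 10 rfl) (fr 12 rfl) (fr 2 rfl)
      (fr 3 rfl) (fr 20 rfl) (fr 21 rfl)
    have hA₁ : HoldsRows n m (slots d n m) (finalState d G v) s₁ := by
      simpa [HoldsRows, fr 22 rfl] using henv.rows
    refine Triple.seq ((ownerProg_spec hL hnZ hTZ hNZ roundedValue_le env₁ hA₁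
      (by rw [fr 26 rfl]; exact h26) (fun x => draw_lt hc x) hj hx₁).mono' ?_)
    intro s₂ h₂ fr₂
    change s₂ 47 0 0 = (owner d G v c j : ℕ) at h₂
    have e31 : s₂ 31 0 0 = j := by rw [fr₂ 31 rfl, hx₁]
    have e6 : s₂ 6 = s₁ 6 := fr₂ 6 rfl
    refine Triple.ifLe_eq 1 (owner d G v c j : ℕ) (by simp) (by simp [h₂]) (fun h1 => ?_)
      (fun h1 => ?_)
    · have h1 : 1 ≤ owner d G v c j := by exact_mod_cast h1
      obtain ⟨o, ho⟩ : ∃ o, owner d G v c j = o + 1 := ⟨_, (Nat.succ_pred_eq_of_pos h1).symm⟩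
      refine Triple.assign_eq o j 1 (by simp [h₂, ho]) (by simp [e31]) (by simp) b1 ⟨?_, ?_⟩
      · intro i hi k hk
        rcases Nat.lt_succ_iff_lt_or_eq.1 hk with hk | rfl
        · simp [hk.ne, e6, h₁ i hi k hk]
        · simp [ho, e6, h₁' i hi k hj le_rfl, eq_comm]
      · intro i hi k hk hjk
        simp [show k ≠ j by omega, e6, h₁' i hi k hk (by omega)]
    · have h1 : owner d G v c j < 1 := by exact_mod_cast h1
      refine Triple.skip ⟨?_, ?_⟩
      · intro i hi k hk
        rcases Nat.lt_succ_iff_lt_or_eq.1 hk with hk | rfl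
        · rw [e6, h₁ i hi k hk]
        · rw [e6, h₁' i hi k hj le_rfl, if_neg (by omega)]
      · intro i hi k hk hjk
        rw [e6, h₁' i hi k hk (by omega)]
  · rintro s' ⟨h, -⟩ -; exact h

/-- Writes the payments into the array `7`. -/
def payProg : Prog :=
  .seq (.set 50 (.nat 0)) <| .seq
    (.for 30 (.var 0) <| .seq (.set 41 (.nat 0)) <| .seq
      (.for 31 (.var 1) (.set 41 (.add (.var 41)
        (.mul (.cell 6 (.var 30) (.var 31)) (.cell 4 (.var 30) (.var 31)))))) <|
      .seq (.assign 7 (.var 30) (.nat 0) (.var 41)) (.set 50 (.add (.var 50) (.var 41))))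
    (.for 30 (.var 0)
      (.assign 7 (.var 30) (.nat 0) (.sub (.cell 7 (.var 30) (.nat 0)) (.var 50))))

lemma payProg_spec {x y : ℕ → ℕ → ℚ} (hL : Z < L) (hnZ : n ≤ Z) (hmZ : m ≤ Z)
    (hn : s 0 0 0 = n) (hm : s 1 0 0 = m) (h6 : ∀ i < n, ∀ j < m, s 6 i j = x i j)
    (h4 : ∀ i < n, ∀ j < m, s 4 i j = y i j)
    (hrow : ∀ i < n, ∀ k ≤ m, bitSize (∑ j ∈ range k, x i j * y i j) ≤ L)
    (htot : ∀ k ≤ n, bitSize (∑ i ∈ range k, ∑ j ∈ range m, x i j * y i j) ≤ L)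
    (hpay : ∀ i < n, bitSize (∑ j ∈ range m, x i j * y i j -
      ∑ k ∈ range n, ∑ j ∈ range m, x k j * y k j) ≤ L) :
    Triple L Z payProg s fun s' => ∀ i < n, s' 7 i 0 =
      ∑ j ∈ range m, x i j * y i j - ∑ k ∈ range n, ∑ j ∈ range m, x k j * y k j := by
  have b0 : bitSize 0 ≤ L := by exact_mod_cast bitSize_nat_le hL (Nat.zero_le Z)
  refine Triple.seq (Triple.set_eq 0 (by simp) b0 ?_)
  refine Triple.seq (Triple.for n hnZ hL (fun k s' =>
    (∀ i < k, s' 7 i 0 = ∑ j ∈ range m, x i j * y i j) ∧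
    s' 50 0 0 = ∑ i ∈ range k, ∑ j ∈ range m, x i j * y i j) ?_ rfl (by simp) ?_ ?_ ?_)
  · intro k s' y h; simpa using h
  · intro k s' hk h hx fr
    simp [fr 0 rfl, hn]
  · rintro i s₁ hi ⟨h7, h50⟩ hx₁ fr₁
    refine Triple.seq (Triple.set_eq 0 (by simp) b0 ?_)
    refine Triple.seq (Triple.for m hmZ hL
      (fun k s' => s' 41 0 0 = ∑ j ∈ range k, x i j * y i j) ?_ rfl (by simp) ?_ ?_ ?_)
    · intro k s' y h; simpa using h
    · intro k s' hk h hx fr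
      simp [fr 1 rfl, fr₁ 1 rfl, hm]
    · intro j s₂ hj h₂ hx₂ fr
      have e6 : s₂ 6 i j = x i j := by simp [fr 6 rfl, fr₁ 6 rfl, h6 i hi j hj]
      have e4 : s₂ 4 i j = y i j := by simp [fr 4 rfl, fr₁ 4 rfl, h4 i hi j hj]
      have e30 : s₂ 30 0 0 = i := by simp [fr 30 rfl, hx₁]
      refine Triple.set_eq _ ?_ (hrow i hi (j + 1) hj) (Store.write_self _ _ _ _ _ _ _)
      rw [sum_range_succ]
      simp [h₂, e30, hx₂, e6, e4]
    · intro s₂ h₂ fr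
      have e30 : s₂ 30 0 0 = i := by simp [fr 30 rfl, hx₁]
      have e7 : s₂ 7 = s₁ 7 := by simp [fr 7 rfl]
      have e50 : s₂ 50 = s₁ 50 := by simp [fr 50 rfl]
      refine Triple.seq (Triple.assign_eq i 0 (∑ j ∈ range m, x i j * y i j) (by simp [e30])
        (by simp) (by simp [h₂]) (hrow i hi m le_rfl) ?_)
      refine Triple.set_eq (∑ k ∈ range (i + 1), ∑ j ∈ range m, x k j * y k j) ?_
        (htot _ hi) ⟨?_, by simp⟩
      · simp [h₂, e50, h50, sum_range_succ _ i]
      · intro k hk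
        rcases Nat.lt_succ_iff_lt_or_eq.1 hk with hk | rfl
        · simp [hk.ne, e7, h7 k hk]
        · simp
  rintro s₁ ⟨h7, h50⟩ fr₁
  refine Triple.for n hnZ hL (fun k s' =>
    (∀ i < k, s' 7 i 0 = ∑ j ∈ range m, x i j * y i j -
      ∑ k ∈ range n, ∑ j ∈ range m, x k j * y k j) ∧
    ∀ i < n, k ≤ i → s' 7 i 0 = ∑ j ∈ range m, x i j * y i j) ?_ rfl ?_ ?_ ?_ ?_
  · intro k s' y h; simpa using h
  · exact ⟨by simp, fun i hi _ => h7 i hi⟩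
  · intro k s' hk h hx fr
    simp [fr 0 rfl, fr₁ 0 rfl, hn]
  · rintro i s₂ hi ⟨h₂, h₂'⟩ hx₂ fr
    have e50 : s₂ 50 = s₁ 50 := by simp [fr 50 rfl]
    refine Triple.assign_eq i 0 _ (by simp [hx₂]) (by simp) ?_ (hpay i hi) ⟨?_, ?_⟩
    · simp [hx₂, e50, h50, h₂' i hi le_rfl]
    · intro k hk
      rcases Nat.lt_succ_iff_lt_or_eq.1 hk with hk | rfl
      · simp [hk.ne, h₂ k hk]
      · simp
    · intro k hk hik
      simp [show k ≠ i by omega, h₂' k hk (by omega)]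
  · rintro s' ⟨h, -⟩ -; exact h

end OutputProg

/-! ### Bounds on the bit lengths -/

section Bits

lemma size_add_le_of_pos {a b : ℕ} (ha : 0 < a) (hb : 0 < b) :
    (a + b).size ≤ a.size + b.size := by
  rw [Nat.size_le, pow_add]
  have h1 := Nat.lt_size_self a
  have h2 := Nat.lt_size_self b
  have h3 : 2 ^ 1 ≤ 2 ^ a.size := Nat.pow_le_pow_right (by norm_num) (Nat.size_pos.2 ha)
  have h4 : 2 ^ 1 ≤ 2 ^ b.size := Nat.pow_le_pow_right (by norm_num) (Nat.size_pos.2 hb)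
  nlinarith

lemma size_sum_le {ι : Type*} (s : Finset ι) (f : ι → ℕ) :
    (∑ i ∈ s, f i).size ≤ ∑ i ∈ s, (f i).size := by
  classical
  induction s using Finset.induction_on with
  | empty => simp
  | insert a s ha ih =>
    rw [sum_insert ha, sum_insert ha]
    rcases Nat.eq_zero_or_pos (f a) with h | h
    · simpa [h] using ih
    rcases Nat.eq_zero_or_pos (∑ i ∈ s, f i) with h' | h'
    · simp [h']
    · exact (size_add_le_of_pos h h').trans (by omega)

lemma exists_int_sum {ι : Type*} {D : ℕ} {s : Finset ι} {f : ι → ℚ}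
    (h : ∀ i ∈ s, ∃ z : ℤ, f i * D = z) : ∃ z : ℤ, (∑ i ∈ s, f i) * D = z := by
  refine sum_induction f (fun q => ∃ z : ℤ, q * D = z) ?_ ⟨0, by simp⟩ h
  rintro a b ⟨x, hx⟩ ⟨y, hy⟩
  exact ⟨x + y, by rw [add_mul, hx, hy]; push_cast; rfl⟩

lemma exists_int_mul_of_den_dvd {q : ℚ} {D : ℕ} (h : q.den ∣ D) : ∃ z : ℤ, q * D = z := by
  obtain ⟨c, rfl⟩ := h
  refine ⟨q.num * c, ?_⟩
  push_cast
  rw [← mul_assoc, Rat.mul_den_eq_num]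

lemma decay_pow_mul {T K e : ℕ} (hT : 0 < T) (he : e ≤ K) :
    ∃ z : ℤ, decay T ^ e * (T ^ K : ℕ) = z := by
  refine ⟨((T : ℤ) - 1) ^ e * T ^ (K - e), ?_⟩
  have h : (T : ℚ) ≠ 0 := by positivity
  have h1 : decay T * T = T - 1 := by unfold decay; field_simp
  obtain ⟨c, rfl⟩ := Nat.exists_eq_add_of_le he
  push_cast
  rw [pow_add, ← mul_assoc, ← mul_pow, h1, Nat.add_sub_cancel_left]

lemma bitSize_sum_decay_le {T K N k : ℕ} (hT : 0 < T) (hk : k ≤ N) {e : ℕ → ℕ}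
    (he : ∀ θ, e θ ≤ K) :
    bitSize (∑ θ ∈ range k, decay T ^ e θ) ≤ N + 2 * (1 + K * T) := by
  have h0 : 0 ≤ ∑ θ ∈ range k, decay T ^ e θ :=
    sum_nonneg fun _ _ => pow_nonneg (decay_nonneg T) _
  have h1 : ∑ θ ∈ range k, decay T ^ e θ ≤ N := by
    refine (sum_le_card_nsmul _ _ 1 fun _ _ => decay_pow_le_one _).trans ?_
    simpa using hk
  refine (bitSize_le_of_mul_eq (Nat.pow_pos hT) (exists_int_sum fun θ _ =>
    decay_pow_mul hT (he θ)) (by rwa [abs_of_nonneg h0])).trans ?_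
  have h2 := size_le_self N
  have h3 := size_pow_le T K
  have h4 := Nat.mul_le_mul_left K (size_le_self T)
  omega

lemma bitSize_decay_pow_le {T K c : ℕ} (hT : 0 < T) (hc : c ≤ K) :
    bitSize (decay T ^ c) ≤ 1 + 2 * (1 + K * T) := by
  simpa using bitSize_sum_decay_le (N := 1) hT le_rfl (e := fun _ => c) fun _ => hc

lemma natAbs_num_cast_ge {q : ℚ} (hq : 0 ≤ q) : q ≤ (q.num.natAbs : ℕ) := by
  have h : ((q.num.natAbs : ℕ) : ℚ) = q.num := by
    rw [Nat.cast_natAbs, abs_of_nonneg (Rat.num_nonneg.2 hq)]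
  rw [h, ← Rat.mul_den_eq_num q]
  have h1 : (1 : ℚ) ≤ q.den := by exact_mod_cast q.pos
  nlinarith

/-- The numbers that occur in the knapsack recursion are multiples of one over the product of the
denominators of the capacity and the weights. -/
lemma bitSize_knapDP_le {b : ℕ → ℕ} {w : ℕ → ℚ} {C : ℚ} {m : ℕ} (hw : ∀ j, 0 ≤ w j) (hC : 0 ≤ C) :
    (∀ j ≤ m, ∀ q, bitSize (knapDP b w C j q) ≤
      4 * (1 + bitSize C + ∑ j ∈ range m, bitSize (w j))) ∧
    ∀ j < m, ∀ q, bitSize (knapDP b w C j q - w j) ≤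
      4 * (1 + bitSize C + ∑ j ∈ range m, bitSize (w j)) := by
  set D := C.den * ∏ j ∈ range m, (w j).den with hD
  have hD0 : 0 < D := Nat.mul_pos C.pos (prod_pos fun j _ => (w j).pos)
  have hDs : D.size ≤ C.den.size + (1 + ∑ j ∈ range m, (w j).den.size) :=
    (size_mul_le _ _).trans (Nat.add_le_add_left (size_prod_le _ _) _)
  have hwD : ∀ j < m, ∃ z : ℤ, w j * D = z := fun j hj => exists_int_mul_of_den_dvd
    ((dvd_prod_of_mem (fun j => (w j).den) (mem_range.2 hj)).trans (Dvd.intro_left _ rfl))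
  have hCD : ∃ z : ℤ, C * D = z := exists_int_mul_of_den_dvd (Dvd.intro _ rfl)
  set E := ∑ j ∈ range m, (w j).den.size with hE
  set F := ∑ j ∈ range m, (w j).num.natAbs.size with hF
  have hsum : ∑ j ∈ range m, bitSize (w j) = F + E := by rw [hE, hF, ← sum_add_distrib]; rfl
  have hCb : bitSize C = C.num.natAbs.size + C.den.size := rfl
  have hM : ∀ x : ℕ, x.size ≤ F → (1 + C.num.natAbs + x).size ≤ 3 + C.num.natAbs.size + F := by
    intro x hx
    have h1 := size_add_le (1 + C.num.natAbs) x
    have h2 := size_add_le 1 C.num.natAbs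
    have h3 : Nat.size 1 = 1 := by simp
    have h4 : (1 + C.num.natAbs).size ≤ 1 + C.num.natAbs.size := by
      rcases Nat.eq_zero_or_pos C.num.natAbs with h | h
      · simp [h]
      · simpa using size_add_le_of_pos one_pos h
    omega
  have hd1 : 1 ≤ C.den.size := Nat.size_pos.2 C.pos
  have hle : 3 + C.num.natAbs.size + F + 2 * D.size ≤
      4 * (1 + bitSize C + ∑ j ∈ range m, bitSize (w j)) := by
    rw [hsum, hCb]; omega
  have hCn := natAbs_num_cast_ge hC
  constructor
  · intro j hj q
    obtain ⟨h1, h2⟩ := knapDP_bounds (b := b) hw hC j q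
    refine (bitSize_le_of_mul_eq (M := 1 + C.num.natAbs + 0) hD0
      (knapDP_mul_int hwD hCD hj q) ?_).trans ?_
    · push_cast
      rw [abs_le]; constructor <;> linarith
    · have := hM 0 (by simp)
      omega
  · intro j hj q
    obtain ⟨h1, h2⟩ := knapDP_bounds (b := b) hw hC j q
    have hwn := natAbs_num_cast_ge (hw j)
    have hwj := hw j
    refine (bitSize_le_of_mul_eq (M := 1 + C.num.natAbs + (w j).num.natAbs) hD0 ?_ ?_).trans ?_
    · obtain ⟨x, hx⟩ := knapDP_mul_int (b := b) hwD hCD hj.le q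
      obtain ⟨y, hy⟩ := hwD j hj
      exact ⟨x - y, by rw [sub_mul, hx, hy]; push_cast; rfl⟩
    · push_cast
      rw [abs_le]; constructor <;> linarith
    · have := hM (w j).num.natAbs (single_le_sum (f := fun j => (w j).num.natAbs.size)
        (fun _ _ => Nat.zero_le _) (mem_range.2 hj))
      omega

/-- Partial sums of a matrix of nonnegative multiples of `1 / D`, and their differences. -/
lemma bitSize_partial_sums_le {n m D M L : ℕ} {u : ℕ → ℕ → ℚ} (hD : 0 < D)
    (hu : ∀ i < n, ∀ j < m, ∃ z : ℤ, u i j * D = z) (h0 : ∀ i < n, ∀ j < m, 0 ≤ u i j)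
    (hM : ∑ i ∈ range n, ∑ j ∈ range m, u i j ≤ M) (hL : M.size + 2 * D.size ≤ L) :
    (∀ i < n, ∀ k ≤ m, bitSize (∑ j ∈ range k, u i j) ≤ L) ∧
    (∀ k ≤ n, bitSize (∑ i ∈ range k, ∑ j ∈ range m, u i j) ≤ L) ∧
    ∀ i < n, bitSize (∑ j ∈ range m, u i j - ∑ k ∈ range n, ∑ j ∈ range m, u k j) ≤ L := by
  have hrow0 : ∀ i < n, ∀ k ≤ m, 0 ≤ ∑ j ∈ range k, u i j := fun i hi k hk =>
    sum_nonneg fun j hj => h0 i hi j ((mem_range.1 hj).trans_le hk)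
  have hrowm : ∀ i < n, ∑ j ∈ range m, u i j ≤ ∑ i ∈ range n, ∑ j ∈ range m, u i j := fun i hi =>
    single_le_sum (f := fun i => ∑ j ∈ range m, u i j)
      (fun k hk => hrow0 k (mem_range.1 hk) m le_rfl) (mem_range.2 hi)
  have hrowk : ∀ i < n, ∀ k ≤ m, ∑ j ∈ range k, u i j ≤ ∑ j ∈ range m, u i j := fun i hi k hk =>
    sum_le_sum_of_subset_of_nonneg (range_subset_range.2 hk)
      fun j hj _ => h0 i hi j (mem_range.1 hj)
  have irow : ∀ i < n, ∀ k ≤ m, ∃ z : ℤ, (∑ j ∈ range k, u i j) * D = z := fun i hi k hk =>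
    exists_int_sum fun j hj => hu i hi j ((mem_range.1 hj).trans_le hk)
  have itot : ∀ k ≤ n, ∃ z : ℤ, (∑ i ∈ range k, ∑ j ∈ range m, u i j) * D = z := fun k hk =>
    exists_int_sum fun i hi => irow i ((mem_range.1 hi).trans_le hk) m le_rfl
  refine ⟨fun i hi k hk => ?_, fun k hk => ?_, fun i hi => ?_⟩
  · refine (bitSize_le_of_mul_eq hD (irow i hi k hk) ?_).trans hL
    rw [abs_of_nonneg (hrow0 i hi k hk)]
    exact (hrowk i hi k hk).trans ((hrowm i hi).trans hM)
  · refine (bitSize_le_of_mul_eq hD (itot k hk) ?_).trans hL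
    have hk0 : ∀ i ∈ range n, 0 ≤ ∑ j ∈ range m, u i j := fun i hi =>
      hrow0 i (mem_range.1 hi) m le_rfl
    rw [abs_of_nonneg (sum_nonneg fun i hi => hk0 i (range_subset_range.2 hk hi))]
    exact (sum_le_sum_of_subset_of_nonneg (range_subset_range.2 hk)
      fun i hi _ => hk0 i hi).trans hM
  · obtain ⟨x, hx⟩ := irow i hi m le_rfl
    obtain ⟨y, hy⟩ := itot n le_rfl
    refine (bitSize_le_of_mul_eq hD ⟨x - y, by rw [sub_mul, hx, hy]; push_cast; rfl⟩ ?_).trans hL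
    have h1 := hrow0 i hi m le_rfl
    have h2 := hrowm i hi
    rw [abs_le]; constructor <;> linarith

end Bits

/-! ### The running time -/

section PolyTime

variable {n m d : ℕ} {G : Instance n m} {v : Values n m}

lemma bitSize_capacity_le (i : Fin n) : bitSize (G.capacity i) ≤ inputSize G v := by
  have := single_le_sum (f := fun i => bitSize (G.capacity i)) (fun _ _ => Nat.zero_le _)
    (mem_univ i)
  unfold inputSize
  omega

lemma sum_bitSize_row_le (i : Fin n) :
    bitSize (G.capacity i) + ∑ j, (bitSize (G.weight i j) + bitSize (v i j)) ≤ inputSize G v := by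
  have h1 := single_le_sum (f := fun i => bitSize (G.capacity i)) (fun _ _ => Nat.zero_le _)
    (mem_univ i)
  have h2 := single_le_sum (f := fun i => ∑ j, (bitSize (G.weight i j) + bitSize (v i j)))
    (fun _ _ => Nat.zero_le _) (mem_univ i)
  unfold inputSize
  omega

lemma bitSize_entries_le (i : Fin n) (j : Fin m) :
    bitSize (G.weight i j) + bitSize (v i j) ≤ inputSize G v := by
  have h1 := sum_bitSize_row_le (G := G) (v := v) i
  have h2 := single_le_sum (f := fun j => bitSize (G.weight i j) + bitSize (v i j))
    (fun _ _ => Nat.zero_le _) (mem_univ j)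
  omega

lemma bitSize_zero : bitSize 0 = 1 := by simp [bitSize]

lemma bitsLe_inputStore {L : ℕ} (hL : inputSize G v + 2 ≤ L) {k : ℕ} (r : Fin k → Bool) :
    (inputStore G v r).BitsLe L := by
  have b0 : bitSize 0 ≤ L := by rw [bitSize_zero]; omega
  have b1 : bitSize 1 ≤ L := by
    have := bitSize_natCast 1
    rw [Nat.cast_one] at this
    omega
  intro a i j
  unfold inputStore
  split
  · have := bitSize_natCast n
    unfold inputSize at hL; omega
  · have := bitSize_natCast m
    unfold inputSize at hL; omega
  · split_ifs with h
    · have := bitSize_capacity_le (G := G) (v := v) ⟨_, h⟩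
      omega
    · exact b0
  · split_ifs with h
    · have := bitSize_entries_le (G := G) (v := v) ⟨_, h.1⟩ ⟨_, h.2⟩
      omega
    · exact b0
  · split_ifs with h
    · have := bitSize_entries_le (G := G) (v := v) ⟨_, h.1⟩ ⟨_, h.2⟩
      omega
    · exact b0
  · split_ifs
    · exact b1
    · exact b0
    · exact b0
  · exact b0

lemma inputEnv_inputStore {k : ℕ} (r : Fin k → Bool) : InputEnv G v (inputStore G v r) where
  size_n := rfl
  size_m := rfl
  cap _ _ := rfl
  weight _ _ _ _ := rfl
  value i j := by simp [inputStore]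

/-- The program for the mechanism. -/
def grovesProg (d : ℕ) : Prog :=
  .seq (relaxProg d) <| .seq drawProg <| .seq assignProg payProg

/-- A parameter in terms of which all bounds are expressed. -/
def sizeBound (d σ : ℕ) : ℕ := σ + 5 * σ ^ d + 1

lemma accuracy_add_le : n + m + accuracy d n m + 1 ≤ sizeBound d (inputSize G v) := by
  have h : n + m ≤ inputSize G v := by unfold inputSize; omega
  have := Nat.pow_le_pow_left h d
  unfold sizeBound accuracy
  omega

lemma slots_le : slots d n m ≤ 2 * accuracy d n m + 1 := by
  unfold slots logSlots
  rcases Nat.lt_or_ge 1 (accuracy d n m) with h | h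
  · have h1 := Nat.clog_pos (b := 2) (by norm_num) h
    have h2 := Nat.pow_pred_clog_lt_self (b := 2) (by norm_num) h
    obtain ⟨c, hc⟩ : ∃ c, Nat.clog 2 (accuracy d n m) = c + 1 :=
      ⟨_, (Nat.succ_pred_eq_of_pos h1).symm⟩
    rw [hc] at h2 ⊢
    rw [Nat.pred_succ] at h2
    rw [pow_succ]
    omega
  · rw [Nat.clog_of_right_le_one h]
    simp

lemma searchBits_of_le {L : ℕ} (hL : 4 * (1 + inputSize G v) ≤ L)
    (hL' : levels d n m + 2 * (1 + n * slots d n m * slots d n m) ≤ L) :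
    SearchBits L n m (slots d n m) (levels d n m) (weightAt G) (capAt G) := by
  have hrow : ∀ i < n, 4 * (1 + bitSize (capAt G i) + ∑ j ∈ range m, bitSize (weightAt G i j)) ≤
      L := by
    intro i hi
    have h1 := sum_bitSize_row_le (G := G) (v := v) ⟨i, hi⟩
    rw [sum_add_distrib] at h1
    have h2 : ∑ j ∈ range m, bitSize (weightAt G i j) = ∑ j, bitSize (G.weight ⟨i, hi⟩ j) := by
      rw [Finset.sum_range]
      exact sum_congr rfl fun j _ => congrArg bitSize (weightAt_fin ⟨i, hi⟩ j)
    have h3 : capAt G i = G.capacity ⟨i, hi⟩ := capAt_fin ⟨i, hi⟩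
    rw [h2, h3]
    omega
  refine ⟨fun k hk e he => (bitSize_sum_decay_le slots_pos hk he).trans hL', ?_, ?_⟩
  · intro i hi b j hj q
    exact ((bitSize_knapDP_le (weightAt_nonneg i) (capAt_nonneg i)).1 j hj q).trans (hrow i hi)
  · intro i hi b j hj q
    exact ((bitSize_knapDP_le (weightAt_nonneg i) (capAt_nonneg i)).2 j hj q).trans (hrow i hi)

/-- The reported values, `0` outside of the range of the indices. -/
def valueAt (v : Values n m) (i j : ℕ) : ℚ :=
  if h : i < n ∧ j < m then (v ⟨i, h.1⟩ ⟨j, h.2⟩ : ℚ) else 0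

lemma valueAt_fin (i : Fin n) (j : Fin m) : valueAt v i j = v i j := by
  simp [valueAt]

lemma valueAt_nonneg (i j : ℕ) : 0 ≤ valueAt v i j := by
  unfold valueAt; split_ifs
  · exact NNRat.coe_nonneg _
  · exact le_rfl

/-- The indicator that the item `j` goes to bin `i`. -/
def ownsAt (d : ℕ) (G : Instance n m) (v : Values n m) (c : ℕ → ℕ) (i j : ℕ) : ℚ :=
  if owner d G v c j = i + 1 then 1 else 0

lemma sum_ownsAt (c : ℕ → ℕ) (i : Fin n) :
    ∑ j ∈ range m, ownsAt d G v c i j * valueAt v i j = ownValue d G v c i := by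
  rw [Finset.sum_range, ownValue, allocation, sum_filter]
  refine sum_congr rfl fun j _ => ?_
  rw [valueAt_fin, ownsAt, ite_mul, one_mul, zero_mul]

lemma bitSize_payments_le {L : ℕ} (hL : 3 * inputSize G v + 2 ≤ L) (c : ℕ → ℕ) :
    (∀ i < n, ∀ k ≤ m, bitSize (∑ j ∈ range k, ownsAt d G v c i j * valueAt v i j) ≤ L) ∧
    (∀ k ≤ n, bitSize (∑ i ∈ range k, ∑ j ∈ range m, ownsAt d G v c i j * valueAt v i j) ≤ L) ∧
    ∀ i < n, bitSize (∑ j ∈ range m, ownsAt d G v c i j * valueAt v i j -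
      ∑ k ∈ range n, ∑ j ∈ range m, ownsAt d G v c k j * valueAt v k j) ≤ L := by
  set D := ∏ p : Fin n × Fin m, (v p.1 p.2 : ℚ).den with hD
  set M := ∑ p : Fin n × Fin m, (v p.1 p.2 : ℚ).num.natAbs with hM
  have hown : ∀ i j, ownsAt d G v c i j = 0 ∨ ownsAt d G v c i j = 1 := by
    intro i j; unfold ownsAt; split_ifs <;> simp
  have hsize : M.size + 2 * D.size ≤ L := by
    have h1 : M.size ≤ _ := size_sum_le univ fun p : Fin n × Fin m => (v p.1 p.2 : ℚ).num.natAbs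
    have h2 : D.size ≤ _ := size_prod_le univ fun p : Fin n × Fin m => (v p.1 p.2 : ℚ).den
    have h3 : ∑ p : Fin n × Fin m, (v p.1 p.2 : ℚ).num.natAbs.size +
        ∑ p : Fin n × Fin m, (v p.1 p.2 : ℚ).den.size ≤ inputSize G v := by
      rw [← sum_add_distrib, Fintype.sum_prod_type]
      have : ∑ i, ∑ j, bitSize (v i j : ℚ) ≤
          ∑ i, ∑ j, (bitSize (G.weight i j) + bitSize (v i j)) :=
        sum_le_sum fun i _ => sum_le_sum fun j _ => Nat.le_add_left _ _
      have h : ∑ i, ∑ j, bitSize (v i j : ℚ) ≤ inputSize G v := by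
        unfold inputSize; omega
      exact h
    omega
  refine bitSize_partial_sums_le (D := D) (M := M) (prod_pos fun p _ => Rat.pos _) ?_ ?_ ?_ hsize
  · intro i hi j hj
    have h1 : ∃ z : ℤ, valueAt v i j * D = z := by
      rw [show valueAt v i j = v ⟨i, hi⟩ ⟨j, hj⟩ from valueAt_fin ⟨i, hi⟩ ⟨j, hj⟩]
      exact exists_int_mul_of_den_dvd
        (dvd_prod_of_mem (fun p : Fin n × Fin m => (v p.1 p.2 : ℚ).den)
          (mem_univ ((⟨i, hi⟩ : Fin n), (⟨j, hj⟩ : Fin m))))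
    rcases hown i j with h | h
    · exact ⟨0, by simp [h]⟩
    · simpa [h] using h1
  · intro i hi j hj
    rcases hown i j with h | h
    · simp [h]
    · simpa [h] using valueAt_nonneg i j
  · rw [hM, Fintype.sum_prod_type, Finset.sum_range]
    push_cast
    refine sum_le_sum fun i _ => ?_
    rw [Finset.sum_range]
    refine sum_le_sum fun j _ => ?_
    have h1 := natAbs_num_cast_ge (NNRat.coe_nonneg (v i j))
    rcases hown i j with h | h
    · rw [h, zero_mul]; exact (NNRat.coe_nonneg _).trans h1
    · rw [h, one_mul, valueAt_fin]; exact h1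

lemma grovesProg_spec {k : ℕ} (r : Fin k → Bool) :
    Triple (16 * sizeBound d (inputSize G v) ^ 4) (13 * sizeBound d (inputSize G v) ^ 4)
      (grovesProg d) (inputStore G v r) fun s =>
        IsOutput s (allocation d G v (coinSeq r)) fun i =>
          ownValue d G v (coinSeq r) i - ∑ k, ownValue d G v (coinSeq r) k := by
  have hB := accuracy_add_le (d := d) (G := G) (v := v)
  have hσ : inputSize G v + 1 ≤ sizeBound d (inputSize G v) := by unfold sizeBound; omega
  have hT := slots_le (d := d) (n := n) (m := m)
  have hτ := logSlots_le (d := d) (n := n) (m := m)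
  have hNdef : levels d n m = 6 * n * m * accuracy d n m := rfl
  set B := sizeBound d (inputSize G v) with hBdef
  have hB1 : 1 ≤ B := by omega
  have hT' : slots d n m ≤ 2 * B := by omega
  have hn : n ≤ B := by omega
  have hm : m ≤ B := by omega
  have hN : levels d n m ≤ 6 * B ^ 3 := by
    rw [hNdef]
    calc 6 * n * m * accuracy d n m ≤ 6 * B * B * B := by gcongr; omega
      _ = _ := by ring
  have p2 : B ≤ B ^ 2 := Nat.le_self_pow (by norm_num) B
  have p3 : B ^ 2 ≤ B ^ 3 := Nat.pow_le_pow_right hB1 (by norm_num)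
  have p4 : B ^ 3 ≤ B ^ 4 := Nat.pow_le_pow_right hB1 (by norm_num)
  have hnT : n * slots d n m ≤ 2 * B ^ 2 := by
    calc n * slots d n m ≤ B * (2 * B) := by gcongr
      _ = _ := by ring
  have hnTT : n * slots d n m * slots d n m ≤ 4 * B ^ 3 := by
    calc n * slots d n m * slots d n m ≤ 2 * B ^ 2 * (2 * B) := by gcongr
      _ = _ := by ring
  have hmN : m * levels d n m ≤ 6 * B ^ 4 := by
    calc m * levels d n m ≤ B * (6 * B ^ 3) := by gcongr
      _ = _ := by ring
  have hNT : levels d n m * slots d n m ≤ 12 * B ^ 4 := by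
    calc levels d n m * slots d n m ≤ 6 * B ^ 3 * (2 * B) := by gcongr
      _ = _ := by ring
  have hL : 13 * B ^ 4 < 16 * B ^ 4 := by omega
  have hb : ∀ c ≤ n * slots d n m, bitSize (decay (slots d n m) ^ c) ≤ 16 * B ^ 4 := fun c hc =>
    (bitSize_decay_pow_le slots_pos hc).trans (by omega)
  have hbits : SearchBits (16 * B ^ 4) n m (slots d n m) (levels d n m) (weightAt G) (capAt G) :=
    searchBits_of_le (v := v) (by omega) (by omega)
  have henv := inputEnv_inputStore (G := G) (v := v) r
  obtain ⟨hrow, htot, hpay⟩ := bitSize_payments_le (d := d) (G := G) (v := v) (L := 16 * B ^ 4)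
    (by omega) (coinSeq r)
  refine Triple.seq ((relaxProg_spec (d := d) hL (by omega) (by omega) (by omega) (by omega)
    (by omega) (by omega) (by omega) (by omega) (by omega) hb hbits henv
    fun _ _ _ _ => rfl).mono' ?_)
  intro s₁ h₁ fr₁
  have env₁ := henv.congr (fr₁ 0 rfl) (fr₁ 1 rfl) (fr₁ 2 rfl) (fr₁ 3 rfl) (fr₁ 4 rfl)
  refine Triple.seq ((drawProg_spec (τ := logSlots d n m) (c := coinSeq r) hL (by omega) (by omega)
    (show slots d n m ≤ _ by omega) (coinSeq_le_one r) env₁.size_n h₁.logSlots ?_).mono' ?_)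
  · intro l
    rw [fr₁ 5 rfl]
    simp only [inputStore, coinSeq]
    split_ifs <;> simp
  intro s₂ h₂ fr₂
  have env₂ := env₁.congr (fr₂ 0 rfl) (fr₂ 1 rfl) (fr₂ 2 rfl) (fr₂ 3 rfl) (fr₂ 4 rfl)
  have renv₂ : RelaxEnv d G v s₂ :=
    { search := h₁.search.congr (fr₂ 0 rfl) (fr₂ 1 rfl) (fr₂ 10 rfl) (fr₂ 12 rfl) (fr₂ 2 rfl)
        (fr₂ 3 rfl) (fr₂ 20 rfl) (fr₂ 21 rfl)
      logSlots := by rw [fr₂ 11 rfl]; exact h₁.logSlots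
      rows := by simpa [HoldsRows, fr₂ 22 rfl] using h₁.rows }
  refine Triple.seq ((assignProg_spec hL (by omega) (by omega) (by omega) (by omega)
    (coinSeq_le_one r) renv₂ h₂ ?_).mono' ?_)
  · intro i _ j _
    rw [fr₂ 6 rfl, fr₁ 6 rfl]
    rfl
  intro s₃ h₃ fr₃
  have env₃ := env₂.congr (fr₃ 0 rfl) (fr₃ 1 rfl) (fr₃ 2 rfl) (fr₃ 3 rfl) (fr₃ 4 rfl)
  refine (payProg_spec (x := ownsAt d G v (coinSeq r)) (y := valueAt v) hL (by omega) (by omega)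
    env₃.size_n env₃.size_m h₃ ?_ hrow htot hpay).mono' ?_
  · intro i hi j hj
    exact (env₃.value ⟨i, hi⟩ ⟨j, hj⟩).trans (valueAt_fin ⟨i, hi⟩ ⟨j, hj⟩).symm
  · intro s₄ h₄ fr₄
    constructor
    · intro i j
      rw [fr₄ 6 rfl, h₃ i i.2 j j.2]
      simp [allocation]
    · intro i
      rw [h₄ i i.2, sum_ownsAt, Finset.sum_range]
      simp only [sum_ownsAt]

theorem groves_isPolyTime (d : ℕ) : (groves d).IsPolyTime := by
  let B : Polynomial ℕ := .X + 5 * .X ^ d + 1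
  refine ⟨grovesProg d, 10 * .X ^ (d + 1),
    .C (grovesProg d).wt * ((13 * B ^ 4 + 1) ^ (grovesProg d).depth * (16 * B ^ 4 + 1)), ?_⟩
  intro n m G v
  refine ⟨rfl, fun r => ?_⟩
  have hL : inputSize G v + 2 ≤ 16 * sizeBound d (inputSize G v) ^ 4 := by
    have h : inputSize G v + 1 ≤ sizeBound d (inputSize G v) := by unfold sizeBound; omega
    have := Nat.le_self_pow (show 4 ≠ 0 by norm_num) (sizeBound d (inputSize G v))
    omega
  obtain ⟨s, t, h1, h2, -, h4⟩ := grovesProg_spec (d := d) (G := G) (v := v) r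
    (bitsLe_inputStore hL r)
  refine ⟨s, t, h1, h2.trans (le_of_eq ?_), h4⟩
  simp [B, sizeBound]

end PolyTime
end GAP

theorem theorem2 (ε : ℕ → ℕ → ℝ)
    (hle : ∀ m n : ℕ, 0 < m → 0 < n → ε m n ≤ 1)
    (hpoly : ∃ q : MvPolynomial (Fin 2) ℕ, ∀ m n : ℕ, 0 < m → 0 < n →
      1 ≤ (MvPolynomial.eval ![m, n] q : ℝ) * ε m n) :
    ∃ M : GAP.Mechanism, M.IsPolyTime ∧
      ∀ (n m : ℕ) (G : GAP.Instance n m),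
        M.IsApproxTruthfulInExpectation G (ε m n) ∧
        M.IsApproximation G (1 - 1 / Real.exp 1 - ε m n) := by
  obtain ⟨q, hq⟩ := hpoly
  obtain ⟨d, hd⟩ := GAP.exists_eval_le_pow q
  have hε : ∀ n m : ℕ, 0 < m → 0 < n → 1 / (((n + m) ^ d : ℕ) : ℝ) ≤ ε m n := by
    intro n m hm hn
    have h1 := hq m n hm hn
    have h2 : (MvPolynomial.eval ![m, n] q : ℝ) ≤ ((n + m) ^ d : ℕ) := by
      exact_mod_cast hd m n hm hn
    have h3 : (0 : ℝ) ≤ (MvPolynomial.eval ![m, n] q : ℕ) := Nat.cast_nonneg _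
    have h4 : 0 < ε m n := by
      by_contra h
      nlinarith
    rw [div_le_iff₀ (by positivity), mul_comm]
    exact h1.trans (mul_le_mul_of_nonneg_right h2 h4.le)
  exact ⟨GAP.groves d, GAP.groves_isPolyTime d, fun n m G =>
    ⟨GAP.groves_truthful (hε n m), GAP.groves_approximation (hε n m)⟩⟩
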